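/- Let $H,U$ be separable complex Hilbert spaces (inner products linear in the first argument), $T>0$, $A$ the generator of a strongly continuous semigroup $(e^{tA})_{t\ge0}$ on $H$, $K\in L^2(0,T;\mathbb R)$, $B\in\mathcal L(U,H)$, and $Q\in\mathcal L(H)$ with $Q=Q^*\ge0$. All operator-valued integrals are in the strong sense. **The operators $P_i$.** Consider the minimization of $\int_\tau^T(\langle Qw,w\rangle_H+\|u\|_U^2)\,dt$ for the Volterra equation $w'(t)=Aw(t)+\int_\tau^tK(t-s)w(s)\,ds+\int_0^\tau K(t-s)\xi(s)\,ds+Bu(t)$ on $(\tau,T)$, $w(\tau^+)=\xi_0$. Put $\mu(t)=\int_0^te^{(t-s)A}K(s)\,ds$, let $R$ solve $R(t)-\int_0^t\mu(t-s)R(s)\,ds=-\mu(t)$, i.e. $R=-\sum_{n\ge1}\mu_n$ with $\mu_1=\mu$ and $\mu_{n+1}(t)=\int_0^t\mu(t-s)\mu_n(s)\,ds$, and put $$F(t,\tau)=e^{(t-\tau)A}-\int_\tau^tR(t-s)e^{(s-\tau)A}ds,\qquad G(t,\sigma,\tau)=\mu(t-\sigma)-e^{(t-\tau)A}\mu(\tau-\sigma),$$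 $$M(t,\sigma,\tau)=G(t,\sigma,\tau)-\int_\tau^tR(t-s)G(s,\sigma,\tau)\,ds .$$ Let $(L_\tau u)(t)=\int_\tau^tF(t,\sigma)Bu(\sigma)\,d\sigma$ from $L^2(\tau,T;U)$ to $L^2(\tau,T;H)$, with adjoint $(L_\tau^*g)(\sigma)=\int_\sigma^TB^*F(t,\sigma)^*g(t)\,dt$, let $\Lambda_\tau=I+L_\tau^*QL_\tau$, and $$\Psi_1(t,\tau)=-[\Lambda_\tau^{-1}L_\tau^*QF(\cdot,\tau)](t),\qquad \Psi_2(t,\sigma,\tau)=-[\Lambda_\tau^{-1}L_\tau^*QM(\cdot,\sigma,\tau)](t),$$ $$Z_1(t,\tau)=F(t,\tau)+\int_\tau^tF(t,\sigma)B\Psi_1(\sigma,\tau)\,d\sigma,\qquad Z_2(t,s,\tau)=M(t,s,\tau)+\int_\tau^tF(t,\sigma)B\Psi_2(\sigma,s,\tau)\,d\sigma .$$ Define $$P_0(t)=\int_t^T[\Psi_1(p,t)^*\Psi_1(p,t)+Z_1(p,t)^*QZ_1(p,t)]\,dp,$$ $$P_1(t,s)=\int_t^T[\Psi_1(p,t)^*\Psi_2(p,s,t)+Z_1(p,t)^*QZ_2(p,s,t)]\,dp,$$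 $$P_2(t,s,q)=\int_t^T[\Psi_2(p,q,t)^*\Psi_2(p,s,t)+Z_2(p,q,t)^*QZ_2(p,s,t)]\,dp .$$ **The equation.** Let $Y_t=H\times L^2(0,t;H)$, with $Y_\tau\subset Y_t$ for $\tau\le t$ through extension of the second component by $0$. An operator matrix $V(t)\in\mathcal L(Y_t)$ has entries $V_{00}(t),V_{01}(t,s),V_{10}(t,q),V_{11}(t,s,q)\in\mathcal L(H)$, $s,q\in[0,t]$, and acts by $$V(t)(x,f)=\Big(V_{00}(t)x+\int_0^tV_{01}(t,s)f(s)\,ds,\ \ q\mapsto V_{10}(t,q)x+\int_0^tV_{11}(t,s,q)f(s)\,ds\Big);$$ for each $t$ its kernels are required to be strongly continuous on $[0,t]$, resp. (jointly) on $[0,t]^2$. Let $$\mathcal A=\begin{pmatrix}A&0\\0&0\end{pmatrix},\quad \mathcal B\mathcal B^*=\begin{pmatrix}BB^*&0\\0&0\end{pmatrix},\quad \mathcal Q=\begin{pmatrix}Q&0\\0&0\end{pmatrix},$$ $$\mathcal K_1(t)(x,f)=\Big(\int_0^tK(t-s)f(s)\,ds,\,0\Big),\qquad \mathcal K_2(t)(x,f)=(0,\,q\mapsto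 K(t-q)x),$$ and let $\mathcal D_{1,t}(x,f)=(0,\delta_tx)$, $\mathcal D_{2,t}(x,f)=(f(t),0)$, where $\delta_t$ is the Dirac delta at $t$; thus $$V(t)\mathcal D_{1,t}(x,f)=(V_{01}(t,t)x,\ q\mapsto V_{11}(t,t,q)x),\qquad \mathcal D_{2,t}V(t)(x,f)=\Big(V_{10}(t,t)x+\int_0^tV_{11}(t,s,t)f(s)\,ds,\ 0\Big).$$ A *solution* is a family $V(t)$, $0<t\le T$, of such operator matrices, uniformly bounded (the norms $\|V(t)\|_{\mathcal L(Y_t)}$ and those of all the entries are bounded by one constant), with $V(T)=0$ and $$\frac{d}{dt}V+V(\mathcal A+\mathcal K_1(t)+\mathcal D_{1,t})+(\mathcal A^*+\mathcal K_2(t)+\mathcal D_{2,t})V-V\mathcal B\mathcal B^*V+\mathcal Q=0 \tag{R}$$ in the following sense: for all $\tau\in(0,T)$ and $X,X'\in D(A)\times L^2(0,\tau;D(A))$, the function $t\mapsto\langle V(t)X,X'\rangle_{Y_t}$ is differentiable on $[\tau,T]$ (one-sidedly at the end points), and at every $t\in[\tau,T]$ the identity obtained by applying (R) to $X$ and pairing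 with $X'$ holds, where $\langle\mathcal A^*V(t)X,X'\rangle$ means $\langle V(t)X,\mathcal AX'\rangle$. **Theorem.** The operator matrix $$P(t)=\begin{pmatrix}P_0(t)&P_1(t,\cdot)\\P_1(t,:)^*&P_2(t,\cdot,:)\end{pmatrix}$$ (entries $P_0(t)$, $P_1(t,s)$, $P_1(t,q)^*$, $P_2(t,s,q)$) is a solution, and it is the only one: every solution $V$ satisfies $V(t)=P(t)$ for all $t\in(0,T]$. -/

import Mathlib

open MeasureTheory Set Filter Topology
open scoped ENNReal

noncomputable section

/-! ### Strongly defined operators -/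

section StrongOperators

variable {E F : Type*} [NormedAddCommGroup E] [NormedSpace ℂ E]
  [NormedAddCommGroup F] [NormedSpace ℂ F]

open Classical in
/-- The bounded linear operator whose action is the map `f`
(by convention `0` if `f` is not the action of a bounded linear operator). -/
def opOf (f : E → F) : E →L[ℂ] F :=
  if h : ∃ L : E →L[ℂ] F, ∀ x, L x = f x then h.choose else 0

theorem opOf_apply {f : E → F} (L : E →L[ℂ] F) (h : ∀ x, L x = f x) : opOf f = L := by
  have h' : ∃ L : E →L[ℂ] F, ∀ x, L x = f x := ⟨L, h⟩
  unfold opOf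
  rw [dif_pos h']
  ext x
  rw [h'.choose_spec x, h x]

/-- The operator `x ↦ ∫ₐᵇ Φ(s) x ds` (an operator-valued integral in the strong sense). -/
def strongInt (Φ : ℝ → E →L[ℂ] F) (a b : ℝ) : E →L[ℂ] F :=
  opOf fun x => ∫ s in a..b, Φ s x

end StrongOperators

/-! ### Strongly continuous semigroups -/

section Semigroups

variable {H : Type*} [NormedAddCommGroup H] [NormedSpace ℂ H]

/-- `S t`, `t ≥ 0`, is a strongly continuous semigroup of bounded operators
(the values of `S` at negative times play no role). -/
structure IsC0Semigroup (S : ℝ → H →L[ℂ] H) : Prop where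
  map_zero : S 0 = 1
  map_add : ∀ s t, 0 ≤ s → 0 ≤ t → S (s + t) = S s * S t
  strong_continuity : ∀ x, ContinuousOn (fun t => S t x) (Ici 0)

/-- `A` is the infinitesimal generator of `S`: its graph is the set of the pairs `(x, y)` with
`(S h x - x) / h → y` as `h ↓ 0`. In particular the domain of `A` is the full set of the `x`
for which the limit exists. -/
def IsGenerator (S : ℝ → H →L[ℂ] H) (A : H →ₗ.[ℂ] H) : Prop :=
  ∀ x y, (x, y) ∈ A.graph ↔
    Tendsto (fun h : ℝ => (h : ℂ)⁻¹ • (S h x - x)) (𝓝[>] 0) (𝓝 y)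

end Semigroups

/-! ### The operators of the controlled Volterra equation -/

section Volterra

variable {H U : Type*} [NormedAddCommGroup H] [InnerProductSpace ℂ H] [CompleteSpace H]
  [NormedAddCommGroup U] [InnerProductSpace ℂ U] [CompleteSpace U]

/-- `μ(t) = ∫₀ᵗ e^{(t-s)A} K(s) ds`. -/
def muOp (S : ℝ → H →L[ℂ] H) (K : ℝ → ℝ) (t : ℝ) : H →L[ℂ] H :=
  strongInt (fun s => ((K s : ℝ) : ℂ) • S (t - s)) 0 t

/-- The iterated kernels `μ₁ = μ`, `μₙ₊₁(t) = ∫₀ᵗ μ(t-s) μₙ(s) ds` (indexed from `0`). -/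
def muIter (S : ℝ → H →L[ℂ] H) (K : ℝ → ℝ) : ℕ → ℝ → H →L[ℂ] H
  | 0 => muOp S K
  | n + 1 => fun t => strongInt (fun s => muOp S K (t - s) ∘L muIter S K n s) 0 t

/-- The resolvent kernel `R = - ∑ₙ μₙ`, i.e. the solution of
`R(t) - ∫₀ᵗ μ(t-s) R(s) ds = -μ(t)`. -/
def resolventKernel (S : ℝ → H →L[ℂ] H) (K : ℝ → ℝ) (t : ℝ) : H →L[ℂ] H :=
  -∑' n, muIter S K n t

/-- `F(t,τ) = e^{(t-τ)A} - ∫_τ^t R(t-s) e^{(s-τ)A} ds`. -/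
def FOp (S : ℝ → H →L[ℂ] H) (K : ℝ → ℝ) (t τ : ℝ) : H →L[ℂ] H :=
  S (t - τ) - strongInt (fun s => resolventKernel S K (t - s) ∘L S (s - τ)) τ t

/-- `G(t,σ,τ) = μ(t-σ) - e^{(t-τ)A} μ(τ-σ)`. -/
def GOp (S : ℝ → H →L[ℂ] H) (K : ℝ → ℝ) (t σ τ : ℝ) : H →L[ℂ] H :=
  muOp S K (t - σ) - S (t - τ) ∘L muOp S K (τ - σ)

/-- `M(t,σ,τ) = G(t,σ,τ) - ∫_τ^t R(t-s) G(s,σ,τ) ds`. -/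
def MOp (S : ℝ → H →L[ℂ] H) (K : ℝ → ℝ) (t σ τ : ℝ) : H →L[ℂ] H :=
  GOp S K t σ τ - strongInt (fun s => resolventKernel S K (t - s) ∘L GOp S K s σ τ) τ t

/-- `(L_τ u)(t) = ∫_τ^t F(t,σ) B u(σ) dσ`. -/
def inputMap (S : ℝ → H →L[ℂ] H) (K : ℝ → ℝ) (B : U →L[ℂ] H) (τ : ℝ) (u : ℝ → U) (t : ℝ) : H :=
  ∫ σ in τ..t, FOp S K t σ (B (u σ))

/-- `(L_τ^* g)(σ) = ∫_σ^T B^* F(t,σ)^* g(t) dt`, the adjoint of `L_τ : L²(τ,T;U) → L²(τ,T;H)`. -/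
def inputMapAdj (T : ℝ) (S : ℝ → H →L[ℂ] H) (K : ℝ → ℝ) (B : U →L[ℂ] H)
    (g : ℝ → H) (σ : ℝ) : U :=
  ∫ t in σ..T, ContinuousLinearMap.adjoint B (ContinuousLinearMap.adjoint (FOp S K t σ) (g t))

/-- `u` is the (everywhere defined) solution on `[τ,T]` of `Λ_τ u = g`, where
`Λ_τ = I + L_τ^* Q L_τ`; it is extended by `0` outside `[τ,T]`. -/
def IsLambdaSolution (T : ℝ) (S : ℝ → H →L[ℂ] H) (K : ℝ → ℝ) (B : U →L[ℂ] H) (Q : H →L[ℂ] H)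
    (τ : ℝ) (g u : ℝ → U) : Prop :=
  MemLp u 2 (volume.restrict (Ioc τ T)) ∧
  (∀ t ∈ Icc τ T, u t + inputMapAdj T S K B (fun p => Q (inputMap S K B τ u p)) t = g t) ∧
  ∀ t ∉ Icc τ T, u t = 0

open Classical in
/-- `Λ_τ⁻¹ g`. -/
def lambdaInv (T : ℝ) (S : ℝ → H →L[ℂ] H) (K : ℝ → ℝ) (B : U →L[ℂ] H) (Q : H →L[ℂ] H)
    (τ : ℝ) (g : ℝ → U) : ℝ → U :=
  if h : ∃ u, IsLambdaSolution T S K B Q τ g u then h.choose else 0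

/-- `Ψ₁(t,τ) = -[Λ_τ⁻¹ L_τ^* Q F(·,τ)](t)`. -/
def Psi1 (T : ℝ) (S : ℝ → H →L[ℂ] H) (K : ℝ → ℝ) (B : U →L[ℂ] H) (Q : H →L[ℂ] H)
    (t τ : ℝ) : H →L[ℂ] U :=
  opOf fun x => -lambdaInv T S K B Q τ (inputMapAdj T S K B fun p => Q (FOp S K p τ x)) t

/-- `Ψ₂(t,σ,τ) = -[Λ_τ⁻¹ L_τ^* Q M(·,σ,τ)](t)`. -/
def Psi2 (T : ℝ) (S : ℝ → H →L[ℂ] H) (K : ℝ → ℝ) (B : U →L[ℂ] H) (Q : H →L[ℂ] H)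
    (t σ τ : ℝ) : H →L[ℂ] U :=
  opOf fun x => -lambdaInv T S K B Q τ (inputMapAdj T S K B fun p => Q (MOp S K p σ τ x)) t

/-- `Z₁(t,τ) = F(t,τ) + ∫_τ^t F(t,σ) B Ψ₁(σ,τ) dσ`. -/
def Z1 (T : ℝ) (S : ℝ → H →L[ℂ] H) (K : ℝ → ℝ) (B : U →L[ℂ] H) (Q : H →L[ℂ] H)
    (t τ : ℝ) : H →L[ℂ] H :=
  FOp S K t τ + strongInt (fun σ => FOp S K t σ ∘L B ∘L Psi1 T S K B Q σ τ) τ t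

/-- `Z₂(t,s,τ) = M(t,s,τ) + ∫_τ^t F(t,σ) B Ψ₂(σ,s,τ) dσ`. -/
def Z2 (T : ℝ) (S : ℝ → H →L[ℂ] H) (K : ℝ → ℝ) (B : U →L[ℂ] H) (Q : H →L[ℂ] H)
    (t s τ : ℝ) : H →L[ℂ] H :=
  MOp S K t s τ + strongInt (fun σ => FOp S K t σ ∘L B ∘L Psi2 T S K B Q σ s τ) τ t

/-- `P₀(t) = ∫_t^T [Ψ₁(p,t)^* Ψ₁(p,t) + Z₁(p,t)^* Q Z₁(p,t)] dp`. -/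
def P0 (T : ℝ) (S : ℝ → H →L[ℂ] H) (K : ℝ → ℝ) (B : U →L[ℂ] H) (Q : H →L[ℂ] H)
    (t : ℝ) : H →L[ℂ] H :=
  strongInt (fun p =>
    ContinuousLinearMap.adjoint (Psi1 T S K B Q p t) ∘L Psi1 T S K B Q p t +
    ContinuousLinearMap.adjoint (Z1 T S K B Q p t) ∘L Q ∘L Z1 T S K B Q p t) t T

/-- `P₁(t,s) = ∫_t^T [Ψ₁(p,t)^* Ψ₂(p,s,t) + Z₁(p,t)^* Q Z₂(p,s,t)] dp`. -/
def P1 (T : ℝ) (S : ℝ → H →L[ℂ] H) (K : ℝ → ℝ) (B : U →L[ℂ] H) (Q : H →L[ℂ] H)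
    (t s : ℝ) : H →L[ℂ] H :=
  strongInt (fun p =>
    ContinuousLinearMap.adjoint (Psi1 T S K B Q p t) ∘L Psi2 T S K B Q p s t +
    ContinuousLinearMap.adjoint (Z1 T S K B Q p t) ∘L Q ∘L Z2 T S K B Q p s t) t T

/-- `P₂(t,s,q) = ∫_t^T [Ψ₂(p,q,t)^* Ψ₂(p,s,t) + Z₂(p,q,t)^* Q Z₂(p,s,t)] dp`. -/
def P2 (T : ℝ) (S : ℝ → H →L[ℂ] H) (K : ℝ → ℝ) (B : U →L[ℂ] H) (Q : H →L[ℂ] H)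
    (t s q : ℝ) : H →L[ℂ] H :=
  strongInt (fun p =>
    ContinuousLinearMap.adjoint (Psi2 T S K B Q p q t) ∘L Psi2 T S K B Q p s t +
    ContinuousLinearMap.adjoint (Z2 T S K B Q p q t) ∘L Q ∘L Z2 T S K B Q p s t) t T

end Volterra

/-! ### The product spaces `Y_t = H × L²(0,t;H)` and operator matrices on them -/

section Product

variable (H : Type*) [NormedAddCommGroup H] [InnerProductSpace ℂ H] [CompleteSpace H]

/-- `L²(0,t;H)`. -/
abbrev HistSpace (t : ℝ) : Type _ := Lp H 2 (volume.restrict (Ioc (0 : ℝ) t))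

/-- The Hilbert space `Y_t = H × L²(0,t;H)`. -/
abbrev YSpace (t : ℝ) : Type _ := WithLp 2 (H × HistSpace H t)

variable {H}

open Classical in
/-- The class in `L²(0,t;H)` of a square-integrable function (`0` for other functions). -/
def toHist (t : ℝ) (g : ℝ → H) : HistSpace H t :=
  if h : MemLp g 2 (volume.restrict (Ioc (0 : ℝ) t)) then h.toLp g else 0

/-- The element `(x, g)` of `Y_t`. -/
def mkY (t : ℝ) (x : H) (g : ℝ → H) : YSpace H t := WithLp.toLp 2 (x, toHist t g)

/-- The inclusion of `Y_τ` in `Y_t`, `τ ≤ t`: the history is extended by `0` to `(τ,t]`. -/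
def embedY (τ t : ℝ) (X : YSpace H τ) : YSpace H t :=
  mkY t X.fst (indicator (Ioc 0 τ) X.snd)

/-- The entries of an operator matrix on `H × L²(0,t;H)`: an operator on `H`, a kernel
`k01 s` integrated against the history, a kernel `k10 q` producing a history, and a kernel
`k11 s q` (`s` the input variable, `q` the output variable). -/
structure BlockKernel (H : Type*) [NormedAddCommGroup H] [InnerProductSpace ℂ H] where
  k00 : H →L[ℂ] H
  k01 : ℝ → H →L[ℂ] H
  k10 : ℝ → H →L[ℂ] H
  k11 : ℝ → ℝ → H →L[ℂ] H

/-- First component of the action of an operator matrix: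
`k00 x + ∫₀ᵗ k01(s) f(s) ds`. -/
def BlockKernel.act0 (k : BlockKernel H) (t : ℝ) (X : YSpace H t) : H :=
  k.k00 X.fst + ∫ s in (0 : ℝ)..t, k.k01 s (X.snd s)

/-- Second component of the action of an operator matrix, as a function of `q`:
`k10(q) x + ∫₀ᵗ k11(s,q) f(s) ds`. -/
def BlockKernel.act1 (k : BlockKernel H) (t : ℝ) (X : YSpace H t) (q : ℝ) : H :=
  k.k10 q X.fst + ∫ s in (0 : ℝ)..t, k.k11 s q (X.snd s)

/-- The operator on `Y_t` given by an operator matrix. -/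
def BlockKernel.toOp (k : BlockKernel H) (t : ℝ) : YSpace H t →L[ℂ] YSpace H t :=
  opOf fun X => mkY t (k.act0 t X) (k.act1 t X)

/-- `V ∈ 𝓛(Y_t)` is the operator matrix with entries `k`, whose kernels are strongly
continuous on `[0,t]` resp. `[0,t]²`; in particular the kernels can be evaluated at `t`.
For `t > 0` these entries are determined by `V`. -/
structure BlockKernel.Represents (k : BlockKernel H) (t : ℝ)
    (V : YSpace H t →L[ℂ] YSpace H t) : Prop where
  cont01 : ∀ x, ContinuousOn (fun s => k.k01 s x) (Icc 0 t)
  cont10 : ∀ x, ContinuousOn (fun q => k.k10 q x) (Icc 0 t)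
  cont11 : ∀ x, ContinuousOn (fun p : ℝ × ℝ => k.k11 p.1 p.2 x) (Icc 0 t ×ˢ Icc 0 t)
  fst_eq : ∀ X, (V X).fst = k.act0 t X
  snd_eq : ∀ X, (V X).snd =ᵐ[volume.restrict (Ioc (0 : ℝ) t)] k.act1 t X

/-- The entries of the operator matrix on `Y_t` are bounded by `C`. -/
structure BlockKernel.BoundedBy (k : BlockKernel H) (t C : ℝ) : Prop where
  bound00 : ‖k.k00‖ ≤ C
  bound01 : ∀ s ∈ Icc 0 t, ‖k.k01 s‖ ≤ C
  bound10 : ∀ q ∈ Icc 0 t, ‖k.k10 q‖ ≤ C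
  bound11 : ∀ s ∈ Icc 0 t, ∀ q ∈ Icc 0 t, ‖k.k11 s q‖ ≤ C

/-! ### The coefficients of the Riccati equation -/

/-- `𝒦₁(t) (x, f) = (∫₀ᵗ K(t-s) f(s) ds, 0)`. -/
def memK1 (K : ℝ → ℝ) (t : ℝ) (X : YSpace H t) : YSpace H t :=
  mkY t (∫ s in (0 : ℝ)..t, ((K (t - s) : ℝ) : ℂ) • X.snd s) 0

/-- `𝒦₂(t) (x, f) = (0, q ↦ K(t-q) x)`. -/
def memK2 (K : ℝ → ℝ) (t : ℝ) (X : YSpace H t) : YSpace H t :=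
  mkY t 0 fun q => ((K (t - q) : ℝ) : ℂ) • X.fst

/-- `V 𝒟_{1,t} (x, f)` for the operator matrix `V` with entries `k`, where
`𝒟_{1,t} (x, f) = (0, δ_t x)`: the second column of the matrix is evaluated at `s = t`,
`V 𝒟_{1,t} (x, f) = (k01(t) x, q ↦ k11(t,q) x)`. -/
def BlockKernel.compDirac1 (k : BlockKernel H) (t : ℝ) (X : YSpace H t) : YSpace H t :=
  mkY t (k.k01 t X.fst) fun q => k.k11 t q X.fst

/-- `𝒟_{2,t} V (x, f)` for the operator matrix `V` with entries `k`, where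
`𝒟_{2,t} (y, g) = (g(t), 0)`: the (continuous) second component of `V (x, f)` is evaluated
at `t`. -/
def BlockKernel.dirac2Comp (k : BlockKernel H) (t : ℝ) (X : YSpace H t) : YSpace H t :=
  mkY t (k.act1 t X t) 0

/-- The dense subspace `D(A) × L²(0,τ;D(A))` of `Y_τ`. -/
structure InTestDomain (A : H →ₗ.[ℂ] H) (τ : ℝ) (X : YSpace H τ) : Prop where
  fst_mem : X.fst ∈ A.domain
  snd_mem : ∃ g : HistSpace H τ, ∀ᵐ s ∂volume.restrict (Ioc (0 : ℝ) τ), (X.snd s, g s) ∈ A.graph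

variable {U : Type*} [NormedAddCommGroup U] [InnerProductSpace ℂ U] [CompleteSpace U]

/-- `ℬℬ^* (x, f) = (B B^* x, 0)`. -/
def blockBB (B : U →L[ℂ] H) (t : ℝ) (X : YSpace H t) : YSpace H t :=
  mkY t (B (ContinuousLinearMap.adjoint B X.fst)) 0

/-- `𝒬 (x, f) = (Q x, 0)`. -/
def blockQ (Q : H →L[ℂ] H) (t : ℝ) (X : YSpace H t) : YSpace H t := mkY t (Q X.fst) 0

/-- The sesquilinear form
`⟨[V(𝒜 + 𝒦₁(t) + 𝒟_{1,t}) + (𝒜^* + 𝒦₂(t) + 𝒟_{2,t})V - Vℬℬ^*V + 𝒬] X, X'⟩`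
on `Y_t`, where `V` is the operator matrix with entries `k`, `a = A X₀` and `a' = A X₀'` (so that
`𝒜 X = (a, 0)` and `⟨𝒜^* V X, X'⟩ = ⟨V X, 𝒜 X'⟩ = ⟨V X, (a', 0)⟩`). Mathlib's inner product is
linear in its second argument. -/
def riccatiForm (K : ℝ → ℝ) (B : U →L[ℂ] H) (Q : H →L[ℂ] H) (t : ℝ)
    (V : YSpace H t →L[ℂ] YSpace H t) (k : BlockKernel H) (X X' : YSpace H t) (a a' : H) : ℂ :=
  inner ℂ X' (V (mkY t a 0 + memK1 K t X) + k.compDirac1 t X)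
    + (inner ℂ (mkY t a' 0) (V X) + inner ℂ X' (memK2 K t (V X) + k.dirac2Comp t X))
    - inner ℂ X' (V (blockBB B t (V X)))
    + inner ℂ X' (blockQ Q t X)

/-- The family `V(t) ∈ 𝓛(Y_t)`, `0 < t ≤ T`, with matrix entries `k t`, is uniformly bounded,
vanishes at `T`, and solves the Riccati equation
`d/dt V + V(𝒜 + 𝒦₁(t) + 𝒟_{1,t}) + (𝒜^* + 𝒦₂(t) + 𝒟_{2,t})V - Vℬℬ^*V + 𝒬 = 0`
on `(0,T]` when tested on pairs of elements of `D(A) × L²(0,τ;D(A))`, `τ ≤ t`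
(`Y_τ` being a subspace of `Y_t`). -/
structure SolvesRiccatiWith (T : ℝ) (A : H →ₗ.[ℂ] H) (K : ℝ → ℝ) (B : U →L[ℂ] H)
    (Q : H →L[ℂ] H) (V : (t : ℝ) → YSpace H t →L[ℂ] YSpace H t)
    (k : ℝ → BlockKernel H) : Prop where
  represents : ∀ t ∈ Ioc 0 T, (k t).Represents t (V t)
  bounded : ∃ C, ∀ t ∈ Ioc 0 T, ‖V t‖ ≤ C ∧ (k t).BoundedBy t C
  final : V T = 0
  equation : ∀ τ ∈ Ioo 0 T, ∀ X X' : YSpace H τ,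
    ∀ (hX : InTestDomain A τ X) (hX' : InTestDomain A τ X'), ∀ t ∈ Icc τ T,
      HasDerivWithinAt (fun r => inner ℂ (embedY τ r X') (V r (embedY τ r X)))
        (-riccatiForm K B Q t (V t) (k t) (embedY τ t X) (embedY τ t X')
          (A ⟨X.fst, hX.fst_mem⟩) (A ⟨X'.fst, hX'.fst_mem⟩))
        (Icc τ T) t

/-- The family `V(t) ∈ 𝓛(Y_t)`, `0 < t ≤ T`, is a solution of the Riccati equation. -/
def SolvesRiccati (T : ℝ) (A : H →ₗ.[ℂ] H) (K : ℝ → ℝ) (B : U →L[ℂ] H) (Q : H →L[ℂ] H)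
    (V : (t : ℝ) → YSpace H t →L[ℂ] YSpace H t) : Prop :=
  ∃ k : ℝ → BlockKernel H, SolvesRiccatiWith T A K B Q V k

/-- The entries `P₀(t)`, `P₁(t,·)`, `P₁(t,:)^*`, `P₂(t,·,:)`. -/
def costKernel (T : ℝ) (S : ℝ → H →L[ℂ] H) (K : ℝ → ℝ) (B : U →L[ℂ] H) (Q : H →L[ℂ] H)
    (t : ℝ) : BlockKernel H where
  k00 := P0 T S K B Q t
  k01 := fun s => P1 T S K B Q t s
  k10 := fun q => ContinuousLinearMap.adjoint (P1 T S K B Q t q)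
  k11 := fun s q => P2 T S K B Q t s q

/-- The operator matrix `P(t) = [[P₀(t), P₁(t,·)], [P₁(t,:)^*, P₂(t,·,:)]]` on `Y_t`. -/
def costOp (T : ℝ) (S : ℝ → H →L[ℂ] H) (K : ℝ → ℝ) (B : U →L[ℂ] H) (Q : H →L[ℂ] H)
    (t : ℝ) : YSpace H t →L[ℂ] YSpace H t :=
  (costKernel T S K B Q t).toOp t

end Product

end

/-!
The operator matrix `P(t)` is the quadratic form of a minimal cost. If `y` is the uncontrolled
trajectory on `(t,T]` for the datum `(x, f) ∈ Y_t` and `C = L_t`, then the minimum over `u` of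
`⟨Q(y + C u), y + C u⟩ + ‖u‖²` is `⟨N_t y, y⟩` with `N_t = Q - Q C Λ_t⁻¹ C^* Q` (`costForm`), the
optimal control is `-C^* N_t y`, and the optimal state `w` satisfies `Q w = N_t y`. All operators act
on `L²(ℝ)`, functions on `(t,T]` being extended by `0`; so their dependence on `t` is only a cutoff.
This uses that `F(t,τ) = Φ(t-τ)` for a fundamental solution `Φ`, and that
`M(t,σ,τ) = ∫_τ^t Φ(t-r) K(r-σ) dr` (`FOp_eq_fundSol`, `MOp_apply`): with these formulas `P(t)`
becomes the compression of `N_t` by the map from data to trajectories (`IsModel.costOp_eq`).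

*Existence.* In the difference of the costs at two initial times `t₁ ≤ t₂`, the pairing of the two
optimal states can be evaluated by either of the two optimality conditions
(`inner_costForm_sub_inner_costForm`). What remains is an integral over `(t₁,t₂]` whose integrand is
jointly continuous in `t₁`, `t₂` and the integration variable (`IsRegular.inner_cost_sub`), without
differentiating the optimal control. Its value on the diagonal is the Riccati form: for `x` in the
domain of `A`, minus the derivative of the uncontrolled trajectory in the initial time is the trajectory
started from `A x + (K * f)(t)` plus the trajectory with memory of a unit mass `x` at the time `t`,
which accounts for `𝒜`, `𝒦₁` and `𝒟₁` (`IsModel.solvesRiccatiWith`).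

*Uniqueness.* Let `D` be the difference of two solutions, tested on `(e^{(r-t)A} x, f)` for
`r ∈ [t,T]`. Along these test elements the terms with `A` cancel, and the derivative of the pairing
is bounded by the entries of `D(r)`, the history being measured in `L¹`
(`SolvesRiccatiWith.exists_hasDerivWithinAt_sub`). The memory terms involve `(K * f)(r)`, which is
controlled in `L²(dr)` by `‖K‖_{L²} ‖f‖_{L¹}`; hence after integration over `[t,T]` against
`e^{l(T-r)}` they carry a factor `l^{-1/2}` (`SolvesRiccatiWith.norm_inner_sub_le`). Since
the kernels are strongly continuous, pairings with step functions recover the entries, including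
those at the end points of `[0,t]` (`BlockKernel.Represents.boundedBy`). For `l` large the entries of
`D` therefore contract in the weighted supremum norm, and `D = 0`.
-/

noncomputable section

set_option linter.unusedSectionVars false

/-! ### Strongly continuous operator functions and strong measurability -/

section StrongContinuity

variable {E F G : Type*} [NormedAddCommGroup E] [NormedSpace ℂ E]
  [NormedAddCommGroup F] [NormedSpace ℂ F] [NormedAddCommGroup G] [NormedSpace ℂ G]

/-- Continuity of an operator-valued function on the whole line for the strong operator
topology. -/
def StrCont (a : ℝ → E →L[ℂ] F) : Prop := ∀ x, Continuous fun t => a t x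

theorem StrCont.exists_bound [CompleteSpace E] {a : ℝ → E →L[ℂ] F} (ha : StrCont a) (b c : ℝ) :
    ∃ C, 0 ≤ C ∧ ∀ t ∈ Icc b c, ‖a t‖ ≤ C := by
  obtain ⟨C, hC⟩ := banach_steinhaus (g := fun t : Icc b c => a t) (fun x => by
    obtain ⟨C, hC⟩ := isCompact_Icc.exists_bound_of_continuousOn (ha x).continuousOn (s := Icc b c)
    exact ⟨C, fun i => hC i i.2⟩)
  exact ⟨max C 0, le_max_right _ _, fun t ht => (hC ⟨t, ht⟩).trans (le_max_left _ _)⟩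

/-- Strong continuity is joint continuity of `(t, x) ↦ a(t) x`, by the uniform boundedness
principle. -/
theorem StrCont.continuous_uncurry [CompleteSpace E] {a : ℝ → E →L[ℂ] F} (ha : StrCont a) :
    Continuous fun p : ℝ × E => a p.1 p.2 := by
  rw [continuous_iff_continuousAt]
  rintro ⟨t, x⟩
  obtain ⟨C, hC0, hC⟩ := ha.exists_bound (t - 1) (t + 1)
  have h1 : Tendsto (fun p : ℝ × E => a p.1 x) (𝓝 (t, x)) (𝓝 (a t x)) :=
    ((ha x).tendsto t).comp (continuous_fst.tendsto (t, x))
  have h2 : Tendsto (fun p : ℝ × E => a p.1 (p.2 - x)) (𝓝 (t, x)) (𝓝 0) := by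
    have h3 : Tendsto (fun p : ℝ × E => C * ‖p.2 - x‖) (𝓝 (t, x)) (𝓝 0) := by
      have : Continuous fun p : ℝ × E => C * ‖p.2 - x‖ := by fun_prop
      simpa using this.tendsto (t, x)
    refine squeeze_zero_norm' ?_ h3
    have : ∀ᶠ p : ℝ × E in 𝓝 (t, x), p.1 ∈ Icc (t - 1) (t + 1) :=
      (continuous_fst.tendsto (t, x)) (Icc_mem_nhds (by simp) (by simp))
    filter_upwards [this] with p hp
    exact (a p.1).le_of_opNorm_le (hC _ hp) _
  have := h1.add h2
  simpa [ContinuousAt] using this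

theorem StrCont.continuous_apply [CompleteSpace E] {X : Type*} [TopologicalSpace X]
    {a : ℝ → E →L[ℂ] F} (ha : StrCont a) {g : X → ℝ} {f : X → E} (hg : Continuous g)
    (hf : Continuous f) : Continuous fun p => a (g p) (f p) :=
  ha.continuous_uncurry.comp (hg.prodMk hf)

theorem StrCont.aestronglyMeasurable_apply [CompleteSpace E] {X : Type*} [MeasurableSpace X]
    {ν : Measure X} {a : ℝ → E →L[ℂ] F} (ha : StrCont a) {g : X → ℝ} {f : X → E}
    (hg : AEStronglyMeasurable g ν) (hf : AEStronglyMeasurable f ν) :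
    AEStronglyMeasurable (fun p => a (g p) (f p)) ν :=
  ha.continuous_uncurry.comp_aestronglyMeasurable (hg.prodMk hf)

theorem StrCont.comp [CompleteSpace F] {a : ℝ → F →L[ℂ] G} {b : ℝ → E →L[ℂ] F}
    (ha : StrCont a) (hb : StrCont b) : StrCont fun t => a t ∘L b t := fun x =>
  ha.continuous_apply continuous_id (hb x)

theorem StrCont.const (L : E →L[ℂ] F) : StrCont fun _ => L := fun _ => continuous_const

theorem StrCont.comp_const {a : ℝ → F →L[ℂ] G} (ha : StrCont a) (L : E →L[ℂ] F) :
    StrCont fun t => a t ∘L L := fun x => ha (L x)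

theorem StrCont.const_comp {b : ℝ → E →L[ℂ] F} (L : F →L[ℂ] G)
    (hb : StrCont b) : StrCont fun t => L ∘L b t := fun x => L.continuous.comp (hb x)

theorem StrCont.add {a b : ℝ → E →L[ℂ] F} (ha : StrCont a) (hb : StrCont b) :
    StrCont fun t => a t + b t := fun x => (ha x).add (hb x)

theorem StrCont.sub {a b : ℝ → E →L[ℂ] F} (ha : StrCont a) (hb : StrCont b) :
    StrCont fun t => a t - b t := fun x => (ha x).sub (hb x)

theorem StrCont.reparam {a : ℝ → E →L[ℂ] F} (ha : StrCont a) {g : ℝ → ℝ} (hg : Continuous g) :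
    StrCont fun t => a (g t) := fun x => (ha x).comp hg

/-- A strong integral exists as a bounded operator once the integrand is strongly measurable and
dominated in norm by an integrable function. -/
theorem strongInt_apply {Φ : ℝ → E →L[ℂ] F} {a b : ℝ} {c : ℝ → ℝ}
    (hm : ∀ x, AEStronglyMeasurable (fun s => Φ s x) (volume.restrict (uIoc a b)))
    (hc : IntervalIntegrable c volume a b)
    (hb : ∀ᵐ s ∂volume.restrict (uIoc a b), ‖Φ s‖ ≤ c s) (x : E) :
    strongInt Φ a b x = ∫ s in a..b, Φ s x := by
  have hbx : ∀ x, ∀ᵐ s ∂volume.restrict (uIoc a b), ‖Φ s x‖ ≤ c s * ‖x‖ := fun x => by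
    filter_upwards [hb] with s hs using (Φ s).le_of_opNorm_le hs x
  have hi : ∀ x, IntervalIntegrable (fun s => Φ s x) volume a b := fun x => by
    rw [intervalIntegrable_iff] at hc ⊢
    exact Integrable.mono' (hc.mul_const ‖x‖) (hm x) (hbx x)
  let L : E →ₗ[ℂ] F :=
    { toFun := fun x => ∫ s in a..b, Φ s x
      map_add' := fun x y => by
        simp only [map_add]
        exact intervalIntegral.integral_add (hi x) (hi y)
      map_smul' := fun r x => by
        simp only [map_smul, RingHom.id_apply]
        exact intervalIntegral.integral_smul r _ }
  have hL : ∀ x, ‖L x‖ ≤ |∫ s in a..b, c s| * ‖x‖ := fun x => by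
    have h := intervalIntegral.norm_integral_le_abs_of_norm_le (μ := volume) (hbx x)
      (hc.mul_const ‖x‖)
    rwa [intervalIntegral.integral_mul_const, abs_mul, abs_of_nonneg (norm_nonneg x)] at h
  exact congrArg (· x)
    (opOf_apply (f := fun x => ∫ s in a..b, Φ s x) (L.mkContinuous _ hL) (fun x => rfl))

theorem strongInt_apply_of_bound {Φ : ℝ → E →L[ℂ] F} {a b C : ℝ}
    (hm : ∀ x, AEStronglyMeasurable (fun s => Φ s x) (volume.restrict (uIoc a b)))
    (hb : ∀ s ∈ uIoc a b, ‖Φ s‖ ≤ C) (x : E) :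
    strongInt Φ a b x = ∫ s in a..b, Φ s x :=
  strongInt_apply (c := fun _ => C) hm intervalIntegrable_const
    ((ae_restrict_iff' measurableSet_uIoc).2 (ae_of_all _ hb)) x

theorem strongInt_apply_of_strCont [CompleteSpace E] {Φ : ℝ → E →L[ℂ] F} (hΦ : StrCont Φ)
    (a b : ℝ) (x : E) : strongInt Φ a b x = ∫ s in a..b, Φ s x := by
  obtain ⟨C, -, hC⟩ := hΦ.exists_bound (min a b) (max a b)
  exact strongInt_apply_of_bound (fun x => (hΦ x).aestronglyMeasurable)
    (fun s hs => hC s (Ioc_subset_Icc_self hs)) x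

theorem norm_strongInt_le {Φ : ℝ → E →L[ℂ] F} {a b : ℝ} {c : ℝ → ℝ} (hab : a ≤ b)
    (hm : ∀ x, AEStronglyMeasurable (fun s => Φ s x) (volume.restrict (uIoc a b)))
    (hc : IntervalIntegrable c volume a b)
    (hb : ∀ᵐ s ∂volume.restrict (uIoc a b), ‖Φ s‖ ≤ c s) (hc0 : 0 ≤ ∫ s in a..b, c s) :
    ‖strongInt Φ a b‖ ≤ ∫ s in a..b, c s := by
  refine ContinuousLinearMap.opNorm_le_bound _ hc0 fun x => ?_
  rw [strongInt_apply hm hc hb, ← intervalIntegral.integral_mul_const]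
  refine intervalIntegral.norm_integral_le_of_norm_le hab ?_ (hc.mul_const _)
  rw [← ae_restrict_iff' measurableSet_Ioc, ← uIoc_of_le hab]
  filter_upwards [hb] with s hs using (Φ s).le_of_opNorm_le hs x

theorem strongInt_congr {Φ Ψ : ℝ → E →L[ℂ] F} {a b : ℝ}
    (h : ∀ᵐ s ∂volume.restrict (uIoc a b), Φ s = Ψ s) : strongInt Φ a b = strongInt Ψ a b := by
  unfold strongInt
  congr 1
  funext x
  refine intervalIntegral.integral_congr_ae ?_
  rw [← ae_restrict_iff' measurableSet_uIoc]
  filter_upwards [h] with s hs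
  rw [hs]

theorem strongInt_comp_add (Φ : ℝ → E →L[ℂ] F) (a b d : ℝ) :
    strongInt (fun s => Φ (s + d)) a b = strongInt Φ (a + d) (b + d) := by
  unfold strongInt
  congr 1
  funext x
  exact intervalIntegral.integral_comp_add_right (fun s => Φ s x) d

end StrongContinuity

section Pettis

variable {H : Type*} [NormedAddCommGroup H] [InnerProductSpace ℂ H] [CompleteSpace H]
  [TopologicalSpace.SeparableSpace H]

/-- Pettis' theorem in a separable Hilbert space: weak measurability is strong measurability,
the function being the limit of its expansions in a countable orthonormal basis. -/
theorem aestronglyMeasurable_of_inner {α : Type*} [MeasurableSpace α] {ν : Measure α} {f : α → H}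
    (h : ∀ x, AEStronglyMeasurable (fun t => inner ℂ x (f t)) ν) : AEStronglyMeasurable f ν := by
  obtain ⟨w, b, hb⟩ := exists_hilbertBasis ℂ H
  have hw : w.Countable := by
    have hd : w.PairwiseDisjoint fun x => Metric.ball x (1 / 2) := by
      intro x hx y hy hxy
      refine Metric.ball_disjoint_ball ?_
      have h1 : ‖x - y‖ ^ 2 = 2 := by
        have ho := b.orthonormal
        rw [hb] at ho
        have h3 := ho.2 (i := ⟨x, hx⟩) (j := ⟨y, hy⟩) (by simpa [Subtype.ext_iff] using hxy)
        have h4 := ho.1 ⟨x, hx⟩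
        have h5 := ho.1 ⟨y, hy⟩
        simp only at h3 h4 h5
        rw [@norm_sub_sq ℂ, h3, h4, h5]
        norm_num
      rw [dist_eq_norm]
      nlinarith [norm_nonneg (x - y)]
    exact hd.countable_of_isOpen (fun _ _ => Metric.isOpen_ball)
      (fun x _ => ⟨x, Metric.mem_ball_self (by norm_num)⟩)
  have : Countable w := hw.to_subtype
  refine aestronglyMeasurable_of_tendsto_ae (u := atTop)
    (f := fun (s : Finset w) t => ∑ i ∈ s, (b.repr (f t) i) • b i) (fun s => ?_)
    (ae_of_all _ fun t => b.hasSum_repr (f t))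
  refine Finset.aestronglyMeasurable_fun_sum _ fun i _ => ?_
  simp only [b.repr_apply_apply]
  exact (h (b i)).smul_const _

end Pettis

/-! ### Convolutions of operator functions -/

section Convolution

variable {E F G : Type*} [NormedAddCommGroup E] [NormedSpace ℂ E] [CompleteSpace E]
  [NormedAddCommGroup F] [NormedSpace ℂ F] [CompleteSpace F]
  [NormedAddCommGroup G] [NormedSpace ℂ G] [CompleteSpace G]

/-- Associativity `a * (b * g) = (a * b) * g` of the causal convolution of strongly continuous
operator functions `a`, `b` with an integrable function `g`. -/
theorem integral_convolution_assoc {a : ℝ → F →L[ℂ] G} {b : ℝ → E →L[ℂ] F}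
    (ha : StrCont a) (hb : StrCont b) {g : ℝ → E} {t : ℝ} (ht : 0 ≤ t)
    (hg : IntervalIntegrable g volume 0 t) :
    ∫ s in 0..t, a (t - s) (∫ r in 0..s, b (s - r) (g r)) =
      ∫ r in 0..t, ∫ s in 0..(t - r), a (t - r - s) (b s (g r)) := by
  obtain ⟨Ca, hCa0, hCa⟩ := ha.exists_bound 0 t
  obtain ⟨Cb, hCb0, hCb⟩ := hb.exists_bound 0 t
  have hg' : IntegrableOn g (Ioc 0 t) := (intervalIntegrable_iff_integrableOn_Ioc_of_le ht).1 hg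
  set ν := (volume : Measure ℝ).restrict (Ioc 0 t) with hν
  let k : ℝ → ℝ → G := fun s r => (Iic s).indicator (fun r => a (t - s) (b (s - r) (g r))) r
  have hk : Integrable (Function.uncurry k) (ν.prod ν) := by
    have hm : AEStronglyMeasurable (Function.uncurry k) (ν.prod ν) := by
      have h1 : AEStronglyMeasurable (fun p : ℝ × ℝ => g p.2) (ν.prod ν) :=
        hg'.aestronglyMeasurable.comp_snd
      have h2 : AEStronglyMeasurable (fun p : ℝ × ℝ => a (t - p.1) (b (p.1 - p.2) (g p.2)))
          (ν.prod ν) :=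
        ha.aestronglyMeasurable_apply (by fun_prop)
          (hb.aestronglyMeasurable_apply (by fun_prop) h1)
      have h3 : MeasurableSet {p : ℝ × ℝ | p.2 ≤ p.1} :=
        measurableSet_le measurable_snd measurable_fst
      have h4 := h2.indicator h3
      refine h4.congr (ae_of_all _ fun p => ?_)
      simp [k, Function.uncurry, indicator_apply]
    have hbd : Integrable (fun p : ℝ × ℝ => Ca * (Cb * ‖g p.2‖)) (ν.prod ν) := by
      have := (hg'.norm.const_mul Cb).const_mul Ca
      exact this.comp_snd ν
    refine Integrable.mono' hbd hm ?_
    rw [hν, Measure.prod_restrict]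
    rw [ae_restrict_iff' (measurableSet_Ioc.prod measurableSet_Ioc)]
    refine ae_of_all _ fun p hp => ?_
    simp only [Function.uncurry, k, indicator_apply, mem_Iic]
    split_ifs with h
    · refine (a _).le_of_opNorm_le_of_le (hCa _ ⟨?_, ?_⟩) ((b _).le_of_opNorm_le (hCb _ ⟨?_, ?_⟩) _)
        <;> linarith [hp.1.1, hp.1.2, hp.2.1, hp.2.2]
    · simp; positivity
  have hL : ∀ s ∈ Ioc 0 t, a (t - s) (∫ r in 0..s, b (s - r) (g r)) = ∫ r in Ioc 0 t, k s r := by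
    intro s hs
    have hgs : IntegrableOn g (Ioc 0 s) := hg'.mono_set (Ioc_subset_Ioc_right hs.2)
    have hi : IntegrableOn (fun r => b (s - r) (g r)) (Ioc 0 s) := by
      refine Integrable.mono' (hgs.norm.const_mul Cb)
        (hb.aestronglyMeasurable_apply (by fun_prop) hgs.aestronglyMeasurable) ?_
      rw [ae_restrict_iff' measurableSet_Ioc]
      refine ae_of_all _ fun r hr => (b _).le_of_opNorm_le (hCb _ ⟨?_, ?_⟩) _ <;>
        linarith [hr.1, hr.2, hs.1, hs.2]
    rw [intervalIntegral.integral_of_le hs.1.le, ← ContinuousLinearMap.integral_comp_comm _ hi]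
    simp only [k]
    rw [setIntegral_indicator measurableSet_Iic, Ioc_inter_Iic, min_eq_right hs.2]
  have hR : ∀ r ∈ Ioc 0 t, ∫ s in Ioc 0 t, k s r =
      ∫ s in 0..(t - r), a (t - r - s) (b s (g r)) := by
    intro r hr
    have h1 : ∀ s, k s r = (Ici r).indicator (fun s => a (t - s) (b (s - r) (g r))) s := fun s => by
      simp [k, indicator_apply]
    simp only [h1]
    rw [setIntegral_indicator measurableSet_Ici]
    have h2 : Ioc 0 t ∩ Ici r = Icc r t := by
      ext s; simp only [mem_inter_iff, mem_Ioc, mem_Ici, mem_Icc]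
      constructor
      · rintro ⟨⟨_, h⟩, h'⟩; exact ⟨h', h⟩
      · rintro ⟨h, h'⟩; exact ⟨⟨lt_of_lt_of_le hr.1 h, h'⟩, h⟩
    rw [h2, integral_Icc_eq_integral_Ioc, ← intervalIntegral.integral_of_le hr.2]
    have h3 := intervalIntegral.integral_comp_add_right (a := 0) (b := t - r)
      (fun s => a (t - s) (b (s - r) (g r))) r
    simp only [zero_add, sub_add_cancel] at h3
    rw [← h3]
    refine intervalIntegral.integral_congr fun s _ => ?_
    simp only [add_sub_cancel_right]
    congr 2; ring
  rw [intervalIntegral.integral_of_le ht, intervalIntegral.integral_of_le ht,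
    setIntegral_congr_fun measurableSet_Ioc hL, integral_integral_swap hk,
    setIntegral_congr_fun measurableSet_Ioc hR]

/-- The causal convolution `t ↦ ∫₀ᵗ a(t-s) b(s) ds`. -/
def opConv (a : ℝ → F →L[ℂ] G) (b : ℝ → E →L[ℂ] F) (t : ℝ) : E →L[ℂ] G :=
  strongInt (fun s => a (t - s) ∘L b s) 0 t

theorem opConv_apply {a : ℝ → F →L[ℂ] G} {b : ℝ → E →L[ℂ] F}
    (ha : StrCont a) (hb : StrCont b) (t : ℝ) (x : E) :
    opConv a b t x = ∫ s in 0..t, a (t - s) (b s x) :=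
  strongInt_apply_of_strCont
    ((ha.reparam (continuous_const.sub continuous_id)).comp hb) _ _ _

theorem StrCont.opConv {a : ℝ → F →L[ℂ] G} {b : ℝ → E →L[ℂ] F}
    (ha : StrCont a) (hb : StrCont b) : StrCont (opConv a b) := by
  intro x
  simp only [opConv_apply ha hb]
  refine intervalIntegral.continuous_parametric_intervalIntegral_of_continuous
    (f := fun t s => a (t - s) (b s x)) ?_ continuous_id
  exact ha.continuous_apply (by fun_prop) ((hb x).comp continuous_snd)

theorem integral_opConv {a : ℝ → F →L[ℂ] G} {b : ℝ → E →L[ℂ] F}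
    (ha : StrCont a) (hb : StrCont b) {g : ℝ → E} {t : ℝ} (ht : 0 ≤ t)
    (hg : IntervalIntegrable g volume 0 t) :
    ∫ s in 0..t, a (t - s) (∫ r in 0..s, b (s - r) (g r)) =
      ∫ r in 0..t, opConv a b (t - r) (g r) := by
  rw [integral_convolution_assoc ha hb ht hg]
  simp only [opConv_apply ha hb]

theorem opConv_assoc {D : Type*} [NormedAddCommGroup D] [NormedSpace ℂ D] [CompleteSpace D]
    {a : ℝ → F →L[ℂ] G} {b : ℝ → E →L[ℂ] F} {c : ℝ → D →L[ℂ] E}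
    (ha : StrCont a) (hb : StrCont b) (hc : StrCont c) {t : ℝ} (ht : 0 ≤ t) :
    _root_.opConv a (_root_.opConv b c) t = _root_.opConv (_root_.opConv a b) c t := by
  ext x
  rw [opConv_apply ha (hb.opConv hc), opConv_apply (ha.opConv hb) hc]
  simp only [opConv_apply hb hc]
  exact integral_opConv ha hb ht ((hc x).intervalIntegrable _ _)

theorem opConv_congr {a a' : ℝ → F →L[ℂ] G} {b b' : ℝ → E →L[ℂ] F} {t : ℝ} (ht : 0 ≤ t)
    (ha : ∀ s ∈ Icc 0 t, a s = a' s) (hb : ∀ s ∈ Icc 0 t, b s = b' s) :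
    opConv a b t = opConv a' b' t := by
  refine strongInt_congr ?_
  rw [uIoc_of_le ht, ae_restrict_iff' measurableSet_Ioc]
  refine ae_of_all _ fun s hs => ?_
  rw [ha (t - s) ⟨by linarith [hs.2], by linarith [hs.1]⟩, hb s ⟨hs.1.le, hs.2⟩]

end Convolution

/-! ### The fundamental solution of the Volterra equation -/

section ScalarKernel

variable {E F : Type*} [NormedAddCommGroup E] [NormedSpace ℂ E] [CompleteSpace E]
  [NormedAddCommGroup F] [NormedSpace ℂ F] [CompleteSpace F]

/-- A representative of the memory kernel that is measurable, square integrable on the line and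
vanishes off `(0, T]`. -/
structure IsKernelRep (T : ℝ) (K K₀ : ℝ → ℝ) : Prop where
  measurable : Measurable K₀
  memLp : MemLp K₀ 2 volume
  eq_zero : ∀ s ∉ Ioc 0 T, K₀ s = 0
  ae_eq : ∀ᵐ s ∂volume.restrict (Ioc 0 T), K₀ s = K s

theorem exists_isKernelRep {T : ℝ} {K : ℝ → ℝ} (hK : MemLp K 2 (volume.restrict (Ioc 0 T))) :
    ∃ K₀, IsKernelRep T K K₀ := by
  obtain ⟨g, hg, hgK⟩ := hK.aestronglyMeasurable
  refine ⟨(Ioc 0 T).indicator g, hg.measurable.indicator measurableSet_Ioc, ?_, ?_, ?_⟩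
  · rw [memLp_indicator_iff_restrict measurableSet_Ioc]
    exact (memLp_congr_ae hgK).1 hK
  · exact fun s hs => indicator_of_notMem hs _
  · filter_upwards [hgK, ae_restrict_mem measurableSet_Ioc] with s hs hs'
    rw [indicator_of_mem hs', hs]

variable {T : ℝ} {K K₀ : ℝ → ℝ}

theorem IsKernelRep.integrable (h : IsKernelRep T K K₀) : Integrable K₀ := by
  have h1 : IntegrableOn K₀ (Ioc 0 T) := by
    have : MemLp K₀ 2 (volume.restrict (Ioc 0 T)) := h.memLp.restrict _
    exact this.integrable (by norm_num)
  have h2 : (Ioc 0 T).indicator K₀ = K₀ := by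
    funext s
    by_cases hs : s ∈ Ioc 0 T
    · rw [indicator_of_mem hs]
    · rw [indicator_of_notMem hs, h.eq_zero s hs]
  rw [← h2, integrable_indicator_iff measurableSet_Ioc]
  exact h1

/-- The convolution `t ↦ ∫₀ᵗ K₀(s) a(t-s) ds` of a scalar kernel with an operator function. -/
def kernelConv (K₀ : ℝ → ℝ) (a : ℝ → E →L[ℂ] F) (t : ℝ) : E →L[ℂ] F :=
  strongInt (fun s => ((K₀ s : ℝ) : ℂ) • a (t - s)) 0 t

theorem kernelConv_apply (h : IsKernelRep T K K₀) {a : ℝ → E →L[ℂ] F} (ha : StrCont a) (t : ℝ)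
    (x : E) : kernelConv K₀ a t x = ∫ s in 0..t, ((K₀ s : ℝ) : ℂ) • a (t - s) x := by
  obtain ⟨C, hC0, hC⟩ := ha.exists_bound (-|t|) |t|
  refine strongInt_apply (c := fun s => |K₀ s| * C) (fun x => ?_) ?_ ?_ x
  · have h1 : Measurable fun s => ((K₀ s : ℝ) : ℂ) := by
      have := h.measurable
      fun_prop
    exact h1.aestronglyMeasurable.smul
      (ha.aestronglyMeasurable_apply (f := fun _ => x) (by fun_prop) (by fun_prop))
  · exact (h.integrable.norm.mul_const C).intervalIntegrable
  · rw [ae_restrict_iff' measurableSet_uIoc]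
    refine ae_of_all _ fun s hs => ?_
    rw [norm_smul, Complex.norm_real, Real.norm_eq_abs]
    refine mul_le_mul_of_nonneg_left (hC _ ?_) (abs_nonneg _)
    rcases le_total 0 t with ht | ht
    · rw [uIoc_of_le ht] at hs
      rw [abs_of_nonneg ht]
      constructor <;> linarith [hs.1, hs.2]
    · rw [uIoc_of_ge ht] at hs
      rw [abs_of_nonpos ht]
      constructor <;> linarith [hs.1, hs.2]

theorem kernelConv_apply_eq (h : IsKernelRep T K K₀) {a : ℝ → E →L[ℂ] F} (ha : StrCont a) (t : ℝ)
    (x : E) : kernelConv K₀ a t x = ∫ s in Ioc 0 T,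
      (Iic t).indicator (fun s => ((K₀ s : ℝ) : ℂ) • a (t - s) x) s := by
  rw [kernelConv_apply h ha, setIntegral_indicator measurableSet_Iic]
  rcases le_total 0 t with ht | ht
  · rw [intervalIntegral.integral_of_le ht]
    refine setIntegral_eq_of_subset_of_forall_sdiff_eq_zero measurableSet_Ioc ?_ ?_
    · exact fun s hs => ⟨hs.1.1, hs.2⟩
    · intro s hs
      rw [h.eq_zero s fun h' => hs.2 ⟨h', hs.1.2⟩]
      simp
  · rw [intervalIntegral.integral_of_ge ht, setIntegral_eq_zero_of_forall_eq_zero,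
      setIntegral_eq_zero_of_forall_eq_zero, neg_zero]
    · intro s hs
      exact absurd (hs.1.1.trans_le hs.2) (not_lt.2 ht)
    · intro s hs
      rw [h.eq_zero s fun h' => absurd (h'.1.trans_le hs.2) (lt_irrefl _)]
      simp

theorem StrCont.kernelConv (h : IsKernelRep T K K₀) {a : ℝ → E →L[ℂ] F} (ha : StrCont a) :
    StrCont (kernelConv K₀ a) := by
  intro x
  simp only [kernelConv_apply_eq h ha]
  rw [continuous_iff_continuousAt]
  intro t₀
  obtain ⟨C, hC0, hC⟩ := ha.exists_bound (t₀ - 1 - T) (t₀ + 1)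
  have hKm : Measurable fun s => ((K₀ s : ℝ) : ℂ) := by
    have := h.measurable
    fun_prop
  refine continuousAt_of_dominated (bound := fun s => |K₀ s| * (C * ‖x‖)) ?_ ?_ ?_ ?_
  · refine Eventually.of_forall fun t => ?_
    refine AEStronglyMeasurable.indicator ?_ measurableSet_Iic
    exact hKm.aestronglyMeasurable.smul
      (ha.aestronglyMeasurable_apply (f := fun _ => x) (by fun_prop) (by fun_prop))
  · filter_upwards [Icc_mem_nhds (sub_one_lt t₀) (lt_add_one t₀)] with t ht
    rw [ae_restrict_iff' measurableSet_Ioc]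
    refine ae_of_all _ fun s hs => (norm_indicator_le_norm_self _ _).trans ?_
    rw [norm_smul, Complex.norm_real, Real.norm_eq_abs]
    refine mul_le_mul_of_nonneg_left ((a _).le_of_opNorm_le (hC _ ?_) _) (abs_nonneg _)
    constructor <;> linarith [hs.1, hs.2, ht.1, ht.2]
  · exact (h.integrable.norm.mul_const _).integrableOn
  · have hne : ∀ᵐ s : ℝ ∂volume.restrict (Ioc 0 T), s ≠ t₀ :=
      ae_restrict_of_ae (Measure.ae_ne volume t₀)
    filter_upwards [hne] with s hs
    rcases lt_or_gt_of_ne hs with hlt | hgt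
    · have h1 : ContinuousAt (fun t => ((K₀ s : ℝ) : ℂ) • a (t - s) x) t₀ :=
        (((ha x).comp (continuous_id.sub continuous_const)).const_smul _).continuousAt
      refine h1.congr ?_
      filter_upwards [Ioi_mem_nhds hlt] with t ht
      rw [indicator_of_mem (show s ∈ Iic t from (mem_Ioi.1 ht).le)]
    · refine (continuousAt_const (y := (0 : F))).congr ?_
      filter_upwards [Iio_mem_nhds hgt] with t ht
      rw [indicator_of_notMem (show s ∉ Iic t from not_le.2 (mem_Iio.1 ht))]

end ScalarKernel

section Resolvent

variable {H : Type*} [NormedAddCommGroup H] [InnerProductSpace ℂ H] [CompleteSpace H]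
  {T : ℝ} {S : ℝ → H →L[ℂ] H} {K K₀ : ℝ → ℝ}

/-- The semigroup, extended by its value at `0` to negative times. -/
def semigroupExt (S : ℝ → H →L[ℂ] H) (t : ℝ) : H →L[ℂ] H := S (max t 0)

theorem semigroupExt_of_nonneg {t : ℝ} (ht : 0 ≤ t) : semigroupExt S t = S t := by
  rw [semigroupExt, max_eq_left ht]

theorem IsC0Semigroup.strCont_semigroupExt (hS : IsC0Semigroup S) : StrCont (semigroupExt S) :=
  fun x => (hS.strong_continuity x).comp_continuous (continuous_id.max continuous_const)
    fun t => le_max_right t 0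

/-- `μ(t) = ∫₀ᵗ e^{(t-s)A} K(s) ds`, as a strongly continuous function on the line. -/
def muExt (S : ℝ → H →L[ℂ] H) (K₀ : ℝ → ℝ) : ℝ → H →L[ℂ] H := kernelConv K₀ (semigroupExt S)

theorem strCont_muExt (hS : IsC0Semigroup S) (hK : IsKernelRep T K K₀) : StrCont (muExt S K₀) :=
  hS.strCont_semigroupExt.kernelConv hK

theorem muOp_eq_muExt (hK : IsKernelRep T K K₀) {t : ℝ} (ht : t ∈ Icc 0 T) :
    muOp S K t = muExt S K₀ t := by
  refine strongInt_congr ?_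
  rw [uIoc_of_le ht.1]
  filter_upwards [ae_restrict_of_ae_restrict_of_subset (Ioc_subset_Ioc_right ht.2) hK.ae_eq,
    ae_restrict_mem measurableSet_Ioc] with s hs hs'
  rw [hs, semigroupExt_of_nonneg (by linarith [hs'.2])]

/-- The iterated kernels, as strongly continuous functions on the line. -/
def muIterExt (S : ℝ → H →L[ℂ] H) (K₀ : ℝ → ℝ) : ℕ → ℝ → H →L[ℂ] H
  | 0 => muExt S K₀
  | n + 1 => opConv (muExt S K₀) (muIterExt S K₀ n)

theorem strCont_muIterExt (hS : IsC0Semigroup S) (hK : IsKernelRep T K K₀) (n : ℕ) :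
    StrCont (muIterExt S K₀ n) := by
  induction n with
  | zero => exact strCont_muExt hS hK
  | succ n ih => exact (strCont_muExt hS hK).opConv ih

theorem muIter_eq_muIterExt (hK : IsKernelRep T K K₀) (n : ℕ) :
    ∀ t ∈ Icc 0 T, muIter S K n t = muIterExt S K₀ n t := by
  induction n with
  | zero => exact fun t ht => muOp_eq_muExt hK ht
  | succ n ih =>
    exact fun t ht => opConv_congr ht.1
      (fun s hs => muOp_eq_muExt hK ⟨hs.1, hs.2.trans ht.2⟩) fun s hs => ih s ⟨hs.1, hs.2.trans ht.2⟩

/-- The convolution powers of `μ` can also be built up by multiplication from the right. -/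
theorem muIterExt_succ_eq (hS : IsC0Semigroup S) (hK : IsKernelRep T K K₀) (n : ℕ) :
    ∀ t, 0 ≤ t → muIterExt S K₀ (n + 1) t = opConv (muIterExt S K₀ n) (muExt S K₀) t := by
  induction n with
  | zero => exact fun t _ => rfl
  | succ n ih =>
    intro t ht
    calc muIterExt S K₀ (n + 1 + 1) t
        = opConv (muExt S K₀) (muIterExt S K₀ (n + 1)) t := rfl
      _ = opConv (muExt S K₀) (opConv (muIterExt S K₀ n) (muExt S K₀)) t :=
          opConv_congr ht (fun _ _ => rfl) fun s hs => ih s hs.1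
      _ = opConv (opConv (muExt S K₀) (muIterExt S K₀ n)) (muExt S K₀) t :=
          opConv_assoc (strCont_muExt hS hK) (strCont_muIterExt hS hK n) (strCont_muExt hS hK) ht

theorem exists_norm_muIterExt_le (hS : IsC0Semigroup S) (hK : IsKernelRep T K K₀) :
    ∃ C, 0 ≤ C ∧ ∀ n, ∀ t ∈ Icc 0 T, ‖muIterExt S K₀ n t‖ ≤ C * ((C * t) ^ n / n.factorial) := by
  obtain ⟨C, hC0, hC⟩ := (strCont_muExt hS hK).exists_bound 0 T
  refine ⟨C, hC0, fun n => ?_⟩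
  induction n with
  | zero => intro t ht; simpa [muIterExt] using hC t ht
  | succ n ih =>
    intro t ht
    have hint : ∫ s in 0..t, C * (C * ((C * s) ^ n / n.factorial)) =
        C * ((C * t) ^ (n + 1) / (n + 1).factorial) := by
      have : ∀ s : ℝ, C * (C * ((C * s) ^ n / n.factorial)) =
          (C * C * C ^ n / n.factorial) * s ^ n := fun s => by
        rw [mul_pow]; ring
      simp only [this]
      rw [intervalIntegral.integral_const_mul, integral_pow, Nat.factorial_succ]
      push_cast
      have h1 : ((n.factorial : ℕ) : ℝ) ≠ 0 := by positivity
      have h2 : (n : ℝ) + 1 ≠ 0 := by positivity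
      field_simp
      simp
      ring
    rw [← hint]
    refine norm_strongInt_le ht.1 (fun x => ?_) ?_ ?_ ?_
    · exact (((strCont_muExt hS hK).reparam (continuous_const.sub continuous_id)).comp
        (strCont_muIterExt hS hK n) x).aestronglyMeasurable
    · exact Continuous.intervalIntegrable (by fun_prop) _ _
    · rw [uIoc_of_le ht.1, ae_restrict_iff' measurableSet_Ioc]
      refine ae_of_all _ fun s hs => (ContinuousLinearMap.opNorm_comp_le _ _).trans ?_
      refine mul_le_mul (hC _ ⟨?_, ?_⟩) (ih s ⟨?_, ?_⟩) (norm_nonneg _) hC0 <;>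
        linarith [hs.1, hs.2, ht.1, ht.2]
    · rw [hint]
      have := ht.1
      positivity

/-- `-R = ∑ₙ μₙ`, frozen outside `[0,T]`. -/
def resolventExt (T : ℝ) (S : ℝ → H →L[ℂ] H) (K₀ : ℝ → ℝ) (t : ℝ) : H →L[ℂ] H :=
  ∑' n, muIterExt S K₀ n (max 0 (min t T))

theorem resolventExt_of_mem {t : ℝ} (ht : t ∈ Icc 0 T) :
    resolventExt T S K₀ t = ∑' n, muIterExt S K₀ n t := by
  rw [resolventExt, min_eq_left ht.2, max_eq_right ht.1]

theorem resolventKernel_eq (hK : IsKernelRep T K K₀) {t : ℝ} (ht : t ∈ Icc 0 T) :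
    resolventKernel S K t = -resolventExt T S K₀ t := by
  rw [resolventExt_of_mem ht, resolventKernel]
  simp only [muIter_eq_muIterExt hK _ t ht]

theorem exists_summable_muIterExt (hS : IsC0Semigroup S) (hK : IsKernelRep T K K₀) :
    ∃ c : ℕ → ℝ, Summable c ∧ ∀ n, ∀ t ∈ Icc 0 T, ‖muIterExt S K₀ n t‖ ≤ c n := by
  obtain ⟨C, hC0, hC⟩ := exists_norm_muIterExt_le hS hK
  refine ⟨fun n => C * ((C * T) ^ n / n.factorial),
    (Real.summable_pow_div_factorial (C * T)).mul_left C, fun n t ht => (hC n t ht).trans ?_⟩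
  have := ht.1
  have h2 := ht.2
  dsimp only
  gcongr

theorem strCont_resolventExt (hT : 0 ≤ T) (hS : IsC0Semigroup S) (hK : IsKernelRep T K K₀) :
    StrCont (resolventExt T S K₀) := by
  obtain ⟨c, hc, hbd⟩ := exists_summable_muIterExt hS hK
  have hmem : ∀ t : ℝ, max 0 (min t T) ∈ Icc 0 T := fun t =>
    ⟨le_max_left _ _, max_le hT (min_le_right _ _)⟩
  intro x
  have hsum : ∀ t, HasSum (fun n => muIterExt S K₀ n (max 0 (min t T)) x)
      (resolventExt T S K₀ t x) := fun t => by
    have h1 : Summable fun n => muIterExt S K₀ n (max 0 (min t T)) :=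
      Summable.of_norm_bounded hc fun n => hbd n _ (hmem t)
    exact h1.hasSum.mapL (ContinuousLinearMap.apply ℂ H x)
  have h2 : (fun t => resolventExt T S K₀ t x) =
      fun t => ∑' n, muIterExt S K₀ n (max 0 (min t T)) x := by
    funext t; exact (hsum t).tsum_eq.symm
  rw [h2]
  refine continuous_tsum (u := fun n => c n * ‖x‖) (fun n => ?_) (hc.mul_right _) fun n t => ?_
  · exact (strCont_muIterExt hS hK n x).comp (by fun_prop)
  · exact ContinuousLinearMap.le_of_opNorm_le _ (hbd n _ (hmem t)) x

/-- The resolvent equation `-R = μ + (-R) * μ`. -/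
theorem resolventExt_eq (hT : 0 ≤ T) (hS : IsC0Semigroup S) (hK : IsKernelRep T K K₀)
    {t : ℝ} (ht : t ∈ Icc 0 T) :
    resolventExt T S K₀ t = muExt S K₀ t + opConv (resolventExt T S K₀) (muExt S K₀) t := by
  obtain ⟨c, hc, hbd⟩ := exists_summable_muIterExt hS hK
  obtain ⟨C, hC0, hC⟩ := (strCont_muExt hS hK).exists_bound 0 T
  have hs1 : ∀ s ∈ Icc 0 T, Summable fun n => muIterExt S K₀ n s := fun s hs =>
    Summable.of_norm_bounded hc fun n => hbd n s hs
  ext x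
  rw [_root_.add_apply, opConv_apply (strCont_resolventExt hT hS hK)
    (strCont_muExt hS hK)]
  have h1 : HasSum (fun n => ∫ s in 0..t, muIterExt S K₀ n (t - s) (muExt S K₀ s x))
      (∫ s in 0..t, resolventExt T S K₀ (t - s) (muExt S K₀ s x)) := by
    refine intervalIntegral.hasSum_integral_of_dominated_convergence
      (fun n _ => c n * (C * ‖x‖)) (fun n => ?_) (fun n => ?_) ?_ ?_ ?_
    · exact (((strCont_muIterExt hS hK n).reparam (continuous_const.sub continuous_id)).comp
        (strCont_muExt hS hK) x).aestronglyMeasurable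
    · refine ae_of_all _ fun s hs => ?_
      rw [uIoc_of_le ht.1] at hs
      refine ContinuousLinearMap.le_of_opNorm_le_of_le _ (hbd n _ ⟨?_, ?_⟩)
        (ContinuousLinearMap.le_of_opNorm_le _ (hC s ⟨?_, ?_⟩) x) <;>
        linarith [hs.1, hs.2, ht.1, ht.2]
    · exact ae_of_all _ fun s _ => hc.mul_right _
    · exact intervalIntegrable_const
    · refine ae_of_all _ fun s hs => ?_
      rw [uIoc_of_le ht.1] at hs
      have hm : t - s ∈ Icc 0 T := ⟨by linarith [hs.2], by linarith [hs.1, ht.2]⟩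
      rw [resolventExt_of_mem hm]
      exact (hs1 _ hm).hasSum.mapL (ContinuousLinearMap.apply ℂ H _)
  have h2 : ∀ n, ∫ s in 0..t, muIterExt S K₀ n (t - s) (muExt S K₀ s x) =
      muIterExt S K₀ (n + 1) t x := fun n => by
    rw [muIterExt_succ_eq hS hK n t ht.1,
      opConv_apply (strCont_muIterExt hS hK n) (strCont_muExt hS hK)]
  simp only [h2] at h1
  have h3 : HasSum (fun n => muIterExt S K₀ n t x) (resolventExt T S K₀ t x) := by
    rw [resolventExt_of_mem ht]
    exact (hs1 t ht).hasSum.mapL (ContinuousLinearMap.apply ℂ H x)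
  have h4 := (hasSum_nat_add_iff' 1).2 h3
  have h5 := h4.unique h1
  rw [← h5]
  simp [muIterExt]

/-- The fundamental solution `Φ(t) = F(t,0)` of the homogeneous Volterra equation. -/
def fundSol (T : ℝ) (S : ℝ → H →L[ℂ] H) (K₀ : ℝ → ℝ) (t : ℝ) : H →L[ℂ] H :=
  semigroupExt S t + opConv (resolventExt T S K₀) (semigroupExt S) t

theorem strCont_fundSol (hT : 0 ≤ T) (hS : IsC0Semigroup S) (hK : IsKernelRep T K K₀) :
    StrCont (fundSol T S K₀) :=
  hS.strCont_semigroupExt.add ((strCont_resolventExt hT hS hK).opConv hS.strCont_semigroupExt)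

theorem fundSol_zero (hT : 0 ≤ T) (hS : IsC0Semigroup S) (hK : IsKernelRep T K K₀) :
    fundSol T S K₀ 0 = 1 := by
  ext x
  rw [fundSol, _root_.add_apply,
    opConv_apply (strCont_resolventExt hT hS hK) hS.strCont_semigroupExt,
    semigroupExt_of_nonneg le_rfl, hS.map_zero]
  simp

theorem fundSol_apply (hT : 0 ≤ T) (hS : IsC0Semigroup S) (hK : IsKernelRep T K K₀) (t : ℝ)
    (x : H) : fundSol T S K₀ t x = semigroupExt S t x +
      ∫ s in 0..t, resolventExt T S K₀ (t - s) (semigroupExt S s x) := by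
  rw [fundSol, _root_.add_apply,
    opConv_apply (strCont_resolventExt hT hS hK) hS.strCont_semigroupExt]

/-- The Volterra equation for `Φ`, convolved with an integrable function. -/
theorem integral_fundSol (hT : 0 ≤ T) (hS : IsC0Semigroup S) (hK : IsKernelRep T K K₀)
    {g : ℝ → H} {t : ℝ} (ht : 0 ≤ t) (hg : IntervalIntegrable g volume 0 t) :
    ∫ r in 0..t, fundSol T S K₀ (t - r) (g r) =
      (∫ r in 0..t, semigroupExt S (t - r) (g r)) +
      ∫ s in 0..t, resolventExt T S K₀ (t - s) (∫ r in 0..s, semigroupExt S (s - r) (g r)) := by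
  have hi : ∀ {a : ℝ → H →L[ℂ] H}, StrCont a →
      IntervalIntegrable (fun r => a (t - r) (g r)) volume 0 t := fun {a} ha => by
    obtain ⟨C, hC0, hC⟩ := ha.exists_bound 0 t
    rw [intervalIntegrable_iff_integrableOn_Ioc_of_le ht] at hg ⊢
    refine Integrable.mono' (hg.norm.const_mul C)
      (ha.aestronglyMeasurable_apply (by fun_prop) hg.aestronglyMeasurable) ?_
    rw [ae_restrict_iff' measurableSet_Ioc]
    refine ae_of_all _ fun s hs => ContinuousLinearMap.le_of_opNorm_le _ (hC _ ⟨?_, ?_⟩) _ <;>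
      linarith [hs.1, hs.2]
  have hR := strCont_resolventExt hT hS hK
  rw [integral_opConv hR hS.strCont_semigroupExt ht hg, ← intervalIntegral.integral_add
    (hi hS.strCont_semigroupExt) (hi (hR.opConv hS.strCont_semigroupExt))]
  rfl

end Resolvent

/-! ### The generator, and identification of `F` and `M` -/

section Generator

variable {H : Type*} [NormedAddCommGroup H] [InnerProductSpace ℂ H] [CompleteSpace H]
  {S : ℝ → H →L[ℂ] H} {A : H →ₗ.[ℂ] H}

theorem IsC0Semigroup.semigroupExt_add (hS : IsC0Semigroup S) {s t : ℝ} (hs : 0 ≤ s)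
    (ht : 0 ≤ t) (x : H) :
    semigroupExt S (s + t) x = semigroupExt S s (semigroupExt S t x) := by
  rw [semigroupExt_of_nonneg hs, semigroupExt_of_nonneg ht,
    semigroupExt_of_nonneg (add_nonneg hs ht), hS.map_add s t hs ht]
  rfl

theorem IsC0Semigroup.semigroupExt_zero (hS : IsC0Semigroup S) (x : H) :
    semigroupExt S 0 x = x := by
  rw [semigroupExt_of_nonneg le_rfl, hS.map_zero]; rfl

theorem IsGenerator.map_graph (hA : IsGenerator S A) (hS : IsC0Semigroup S) {x y : H}
    (h : (x, y) ∈ A.graph) {t : ℝ} (ht : 0 ≤ t) :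
    (semigroupExt S t x, semigroupExt S t y) ∈ A.graph := by
  rw [hA] at h ⊢
  have h1 := ((semigroupExt S t).continuous.tendsto y).comp h
  refine h1.congr' ?_
  filter_upwards [self_mem_nhdsWithin] with u hu
  have hu0 : (0 : ℝ) ≤ u := (mem_Ioi.1 hu).le
  simp only [Function.comp_apply, map_smul, map_sub]
  rw [← semigroupExt_of_nonneg (S := S) hu0, ← hS.semigroupExt_add ht hu0, ← hS.semigroupExt_add hu0 ht,
    add_comm]

theorem IsGenerator.hasDerivWithinAt_right (hA : IsGenerator S A) (hS : IsC0Semigroup S) {x y : H}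
    (h : (x, y) ∈ A.graph) {t : ℝ} (ht : 0 ≤ t) :
    HasDerivWithinAt (fun r => semigroupExt S r x) (semigroupExt S t y) (Ioi t) t := by
  rw [hasDerivWithinAt_iff_tendsto_slope' (by simp)]
  have h1 := (hA _ _).1 (hA.map_graph hS h ht)
  have h2 : Tendsto (fun u : ℝ => u - t) (𝓝[>] t) (𝓝[>] 0) := by
    refine tendsto_nhdsWithin_iff.2 ⟨?_, ?_⟩
    · have : Tendsto (fun u : ℝ => u - t) (𝓝 t) (𝓝 (t - t)) :=
        (continuous_id.sub continuous_const).tendsto t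
      rw [sub_self] at this
      exact this.mono_left nhdsWithin_le_nhds
    · filter_upwards [self_mem_nhdsWithin] with u hu
      exact sub_pos.2 (mem_Ioi.1 hu)
  refine (h1.comp h2).congr' ?_
  filter_upwards [self_mem_nhdsWithin] with u hu
  have hu0 : (0 : ℝ) ≤ u - t := (sub_pos.2 (mem_Ioi.1 hu)).le
  simp only [Function.comp_apply, slope, vsub_eq_sub]
  rw [← semigroupExt_of_nonneg (S := S) hu0, ← hS.semigroupExt_add hu0 ht, sub_add_cancel,
    ← Complex.ofReal_inv, Complex.coe_smul]

theorem IsGenerator.semigroupExt_eq_integral (hA : IsGenerator S A) (hS : IsC0Semigroup S)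
    {x y : H} (h : (x, y) ∈ A.graph) {t : ℝ} (ht : 0 ≤ t) :
    semigroupExt S t x = x + ∫ r in 0..t, semigroupExt S r y := by
  have h1 := intervalIntegral.integral_eq_sub_of_hasDeriv_right_of_le ht
    (hS.strCont_semigroupExt x).continuousOn
    (fun r hr => hA.hasDerivWithinAt_right hS h hr.1.le)
    ((hS.strCont_semigroupExt y).intervalIntegrable 0 t)
  rw [h1, hS.semigroupExt_zero]
  abel

theorem IsGenerator.hasDerivWithinAt (hA : IsGenerator S A) (hS : IsC0Semigroup S)
    {x y : H} (h : (x, y) ∈ A.graph) {t : ℝ} (ht : 0 ≤ t) :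
    HasDerivWithinAt (fun r => semigroupExt S r x) (semigroupExt S t y) (Ici 0) t := by
  have h1 : HasDerivAt (fun r => x + ∫ s in 0..r, semigroupExt S s y) (semigroupExt S t y) t :=
    (intervalIntegral.integral_hasDerivAt_right
      ((hS.strCont_semigroupExt y).intervalIntegrable 0 t)
      (hS.strCont_semigroupExt y).stronglyMeasurable.stronglyMeasurableAtFilter
      (hS.strCont_semigroupExt y).continuousAt).const_add x
  exact h1.hasDerivWithinAt.congr (fun r hr => hA.semigroupExt_eq_integral hS h hr)
    (hA.semigroupExt_eq_integral hS h ht)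

/-- The averages `∫₀ʰ e^{sA} x ds` belong to the domain of the generator. -/
theorem IsGenerator.integral_mem_graph (hA : IsGenerator S A) (hS : IsC0Semigroup S)
    {h : ℝ} (hh : 0 ≤ h) (x : H) :
    (∫ s in 0..h, semigroupExt S s x, semigroupExt S h x - x) ∈ A.graph := by
  have hc := hS.strCont_semigroupExt x
  rw [hA]
  have hd : ∀ t, HasDerivAt (fun r => ∫ s in 0..r, semigroupExt S s x) (semigroupExt S t x) t :=
    fun t => intervalIntegral.integral_hasDerivAt_right (hc.intervalIntegrable 0 t)
      hc.stronglyMeasurable.stronglyMeasurableAtFilter hc.continuousAt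
  have h1 : HasDerivAt (fun u => (∫ s in 0..(u + h), semigroupExt S s x) -
      ∫ s in 0..u, semigroupExt S s x) (semigroupExt S h x - semigroupExt S 0 x) 0 := by
    refine HasDerivAt.sub ?_ (hd 0)
    have := HasDerivAt.comp_add_const (0 : ℝ) h (by rw [zero_add]; exact hd h)
    exact this
  rw [hS.semigroupExt_zero] at h1
  have h2 := (hasDerivWithinAt_iff_tendsto_slope' (s := Ioi (0 : ℝ)) (by simp)).1
    h1.hasDerivWithinAt
  refine h2.congr' ?_
  filter_upwards [self_mem_nhdsWithin] with u hu
  have hu0 : (0 : ℝ) ≤ u := (mem_Ioi.1 hu).le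
  simp only [slope, vsub_eq_sub, sub_zero, zero_add, intervalIntegral.integral_same]
  rw [← Complex.ofReal_inv, Complex.coe_smul]
  congr 1
  rw [← ContinuousLinearMap.intervalIntegral_comp_comm _ (hc.intervalIntegrable 0 h)]
  have h3 : ∫ s in 0..h, S u (semigroupExt S s x) = ∫ s in 0..h, semigroupExt S (s + u) x := by
    refine intervalIntegral.integral_congr fun s hs => ?_
    rw [uIcc_of_le hh] at hs
    rw [add_comm, hS.semigroupExt_add hu0 hs.1, semigroupExt_of_nonneg hu0]
  rw [h3, intervalIntegral.integral_comp_add_right (fun s => semigroupExt S s x) u, zero_add,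
    add_comm h u]
  have h4 := intervalIntegral.integral_add_adjacent_intervals (hc.intervalIntegrable 0 u)
    (hc.intervalIntegrable (μ := volume) u (u + h))
  rw [← h4]; abel

theorem IsGenerator.dense_domain (hA : IsGenerator S A) (hS : IsC0Semigroup S) :
    Dense (A.domain : Set H) := by
  intro x
  have hc := hS.strCont_semigroupExt x
  have hd : HasDerivAt (fun r => ∫ s in 0..r, semigroupExt S s x) (semigroupExt S 0 x) 0 :=
    intervalIntegral.integral_hasDerivAt_right (hc.intervalIntegrable 0 0)
      hc.stronglyMeasurable.stronglyMeasurableAtFilter hc.continuousAt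
  rw [hS.semigroupExt_zero] at hd
  have h2 := (hasDerivWithinAt_iff_tendsto_slope' (s := Ioi (0 : ℝ)) (by simp)).1
    hd.hasDerivWithinAt
  refine mem_closure_of_tendsto h2 ?_
  filter_upwards [self_mem_nhdsWithin] with u hu
  have h3 := LinearPMap.mem_domain_of_mem_graph (hA.integral_mem_graph hS (mem_Ioi.1 hu).le x)
  simp only [slope, vsub_eq_sub, sub_zero, intervalIntegral.integral_same]
  rw [← Complex.coe_smul]
  exact A.domain.smul_mem _ h3

end Generator

section Identification

variable {H : Type*} [NormedAddCommGroup H] [InnerProductSpace ℂ H] [CompleteSpace H]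
  {T : ℝ} {S : ℝ → H →L[ℂ] H} {K K₀ : ℝ → ℝ}

theorem FOp_eq_fundSol (hS : IsC0Semigroup S) (hK : IsKernelRep T K K₀) {t τ : ℝ} (hτ : 0 ≤ τ)
    (hτt : τ ≤ t) (ht : t ≤ T) : FOp S K t τ = fundSol T S K₀ (t - τ) := by
  have hT : 0 ≤ T := by linarith
  have hR := strCont_resolventExt hT hS hK
  have h0 : 0 ≤ t - τ := sub_nonneg.2 hτt
  have h1 : strongInt (fun s => resolventKernel S K (t - s) ∘L S (s - τ)) τ t =
      strongInt (fun s => (-resolventExt T S K₀ (t - τ - s)) ∘L semigroupExt S s) 0 (t - τ) := by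
    have := strongInt_comp_add (fun s => resolventKernel S K (t - s) ∘L S (s - τ)) 0 (t - τ) τ
    rw [zero_add, sub_add_cancel] at this
    rw [← this]
    refine strongInt_congr ?_
    rw [uIoc_of_le h0, ae_restrict_iff' measurableSet_Ioc]
    refine ae_of_all _ fun s hs => ?_
    rw [show t - (s + τ) = t - τ - s by ring, add_sub_cancel_right,
      resolventKernel_eq hK ⟨by linarith [hs.2], by linarith [hs.1]⟩,
      semigroupExt_of_nonneg hs.1.le]
  ext x
  rw [FOp, _root_.sub_apply, h1, fundSol_apply hT hS hK, semigroupExt_of_nonneg h0,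
    strongInt_apply_of_strCont]
  · simp [sub_eq_add_neg]
  · have h2 : StrCont fun s => -resolventExt T S K₀ (t - τ - s) := fun x =>
      ((hR x).comp (continuous_const.sub continuous_id)).neg
    exact h2.comp hS.strCont_semigroupExt

theorem intervalIntegrable_shift (hK : IsKernelRep T K K₀) (d a b : ℝ) (x : H) :
    IntervalIntegrable (fun r => ((K₀ (r + d) : ℝ) : ℂ) • x) volume a b := by
  have h1 : Integrable fun r => K₀ (r + d) := hK.integrable.comp_add_right d
  exact (h1.ofReal.smul_const x).intervalIntegrable

theorem GOp_apply (hS : IsC0Semigroup S) (hK : IsKernelRep T K K₀) {s σ τ : ℝ} (hσ : 0 ≤ σ)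
    (hστ : σ ≤ τ) (hτs : τ ≤ s) (hs : s ≤ T) (x : H) :
    GOp S K s σ τ x =
      ∫ r in 0..(s - τ), semigroupExt S (s - τ - r) (((K₀ (r + (τ - σ)) : ℝ) : ℂ) • x) := by
  have hc := hS.strCont_semigroupExt
  have hi : ∀ a b, IntervalIntegrable
      (fun v => ((K₀ v : ℝ) : ℂ) • semigroupExt S (s - σ - v) x) volume a b := fun a b => by
    have h1 : Continuous fun v => semigroupExt S (s - σ - v) x :=
      (hc x).comp (continuous_const.sub continuous_id)
    exact hK.integrable.ofReal.intervalIntegrable.smul_continuousOn h1.continuousOn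
  rw [GOp, _root_.sub_apply, ContinuousLinearMap.comp_apply,
    muOp_eq_muExt hK ⟨by linarith, by linarith⟩, muOp_eq_muExt hK ⟨by linarith, by linarith⟩,
    muExt, kernelConv_apply hK hc, kernelConv_apply hK hc]
  have h1 : S (s - τ) (∫ v in 0..(τ - σ), ((K₀ v : ℝ) : ℂ) • semigroupExt S (τ - σ - v) x) =
      ∫ v in 0..(τ - σ), ((K₀ v : ℝ) : ℂ) • semigroupExt S (s - σ - v) x := by
    have h2 : IntervalIntegrable
      (fun v => ((K₀ v : ℝ) : ℂ) • semigroupExt S (τ - σ - v) x) volume 0 (τ - σ) := by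
      have h1 : Continuous fun v => semigroupExt S (τ - σ - v) x :=
        (hc x).comp (continuous_const.sub continuous_id)
      exact hK.integrable.ofReal.intervalIntegrable.smul_continuousOn h1.continuousOn
    rw [← ContinuousLinearMap.intervalIntegral_comp_comm _ h2]
    refine intervalIntegral.integral_congr fun v hv => ?_
    rw [uIcc_of_le (sub_nonneg.2 hστ)] at hv
    simp only [map_smul]
    rw [← semigroupExt_of_nonneg (S := S) (sub_nonneg.2 hτs),
      ← hS.semigroupExt_add (sub_nonneg.2 hτs) (sub_nonneg.2 hv.2)]
    congr 3; ring
  rw [h1, intervalIntegral.integral_interval_sub_left (hi _ _) (hi _ _)]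
  have h3 := intervalIntegral.integral_comp_add_right (a := 0) (b := s - τ)
    (fun v => ((K₀ v : ℝ) : ℂ) • semigroupExt S (s - σ - v) x) (τ - σ)
  rw [zero_add, show s - τ + (τ - σ) = s - σ by ring] at h3
  rw [← h3]
  refine intervalIntegral.integral_congr fun r _ => ?_
  simp only [map_smul]
  congr 3; ring

theorem MOp_apply (hS : IsC0Semigroup S) (hK : IsKernelRep T K K₀) {t σ τ : ℝ} (hσ : 0 ≤ σ)
    (hστ : σ ≤ τ) (hτt : τ ≤ t) (ht : t ≤ T) (x : H) :
    MOp S K t σ τ x = ∫ r in τ..t, ((K₀ (r - σ) : ℝ) : ℂ) • fundSol T S K₀ (t - r) x := by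
  have hT : 0 ≤ T := by linarith
  have hR := strCont_resolventExt hT hS hK
  have hc := hS.strCont_semigroupExt
  have h0 : 0 ≤ t - τ := sub_nonneg.2 hτt
  have hg := intervalIntegrable_shift hK (τ - σ) 0 (t - τ) x
  have h1 := integral_fundSol hT hS hK h0 hg
  have h2 : strongInt (fun s => resolventKernel S K (t - s) ∘L GOp S K s σ τ) τ t x =
      -∫ s in 0..(t - τ), resolventExt T S K₀ (t - τ - s)
        (∫ r in 0..s, semigroupExt S (s - r) (((K₀ (r + (τ - σ)) : ℝ) : ℂ) • x)) := by
    have h3 : StrCont fun s => (-resolventExt T S K₀ (t - s)) ∘L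
        (muExt S K₀ (s - σ) - semigroupExt S (s - τ) ∘L muExt S K₀ (τ - σ)) := by
      have h4 : StrCont fun s => -resolventExt T S K₀ (t - s) := fun x =>
        ((hR x).comp (continuous_const.sub continuous_id)).neg
      refine h4.comp (StrCont.sub ?_ (StrCont.comp_const ?_ _))
      · exact (strCont_muExt hS hK).reparam (continuous_id.sub continuous_const)
      · exact hc.reparam (continuous_id.sub continuous_const)
    have h5 : strongInt (fun s => resolventKernel S K (t - s) ∘L GOp S K s σ τ) τ t =
        strongInt (fun s => (-resolventExt T S K₀ (t - s)) ∘L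
        (muExt S K₀ (s - σ) - semigroupExt S (s - τ) ∘L muExt S K₀ (τ - σ))) τ t := by
      refine strongInt_congr ?_
      rw [uIoc_of_le hτt, ae_restrict_iff' measurableSet_Ioc]
      refine ae_of_all _ fun s hs => ?_
      rw [resolventKernel_eq hK ⟨by linarith [hs.2], by linarith [hs.1]⟩, GOp,
        muOp_eq_muExt hK ⟨by linarith [hs.1], by linarith [hs.2]⟩,
        muOp_eq_muExt hK ⟨by linarith, by linarith⟩,
        semigroupExt_of_nonneg (by linarith [hs.1])]
    have h6 : ∫ s in τ..t, (resolventKernel S K (t - s) ∘L GOp S K s σ τ) x =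
        strongInt (fun s => resolventKernel S K (t - s) ∘L GOp S K s σ τ) τ t x := by
      rw [h5, strongInt_apply_of_strCont h3]
      refine intervalIntegral.integral_congr fun s hs => ?_
      rw [uIcc_of_le hτt] at hs
      rw [resolventKernel_eq hK ⟨by linarith [hs.2], by linarith [hs.1]⟩, GOp,
        muOp_eq_muExt hK ⟨by linarith [hs.1], by linarith [hs.2]⟩,
        muOp_eq_muExt hK ⟨by linarith, by linarith⟩,
        semigroupExt_of_nonneg (by linarith [hs.1])]
    rw [← h6]
    have h7 := intervalIntegral.integral_comp_add_right (a := 0) (b := t - τ)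
      (fun s => (resolventKernel S K (t - s) ∘L GOp S K s σ τ) x) τ
    rw [zero_add, sub_add_cancel] at h7
    rw [← h7, ← intervalIntegral.integral_neg]
    refine intervalIntegral.integral_congr fun s hs => ?_
    rw [uIcc_of_le h0] at hs
    simp only [ContinuousLinearMap.comp_apply]
    rw [GOp_apply hS hK hσ hστ (by linarith [hs.1]) (by linarith [hs.2]),
      show t - (s + τ) = t - τ - s by ring, add_sub_cancel_right,
      resolventKernel_eq hK ⟨by linarith [hs.2], by linarith [hs.1]⟩, _root_.neg_apply]
  rw [MOp, _root_.sub_apply, h2, GOp_apply hS hK hσ hστ hτt ht, sub_neg_eq_add, ← h1]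
  have h8 := intervalIntegral.integral_comp_add_right (a := 0) (b := t - τ)
    (fun r => ((K₀ (r - σ) : ℝ) : ℂ) • fundSol T S K₀ (t - r) x) τ
  rw [zero_add, sub_add_cancel] at h8
  rw [← h8]
  refine intervalIntegral.integral_congr fun r _ => ?_
  simp only [map_smul]
  rw [show r + (τ - σ) = r + τ - σ by ring, show t - τ - r = t - (r + τ) by ring]

/-- The resolvent equation in the form `-R = Φ * K`. -/
theorem resolventExt_eq_kernelConv (hS : IsC0Semigroup S) (hK : IsKernelRep T K K₀)
    {t : ℝ} (ht : t ∈ Icc 0 T) (x : H) :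
    resolventExt T S K₀ t x = ∫ r in 0..t, ((K₀ r : ℝ) : ℂ) • fundSol T S K₀ (t - r) x := by
  have hT : 0 ≤ T := ht.1.trans ht.2
  have hg := intervalIntegrable_shift hK 0 0 t x
  have h1 := integral_fundSol hT hS hK ht.1 hg
  simp only [add_zero, map_smul] at h1
  rw [h1, resolventExt_eq hT hS hK ht, _root_.add_apply,
    opConv_apply (strCont_resolventExt hT hS hK) (strCont_muExt hS hK)]
  simp only [muExt, kernelConv_apply hK hS.strCont_semigroupExt]

/-- The integrated backward equation for `Φ`:  `Φ' = Φ A - R` on the domain of `A`. -/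
theorem fundSol_eq_integral {A : H →ₗ.[ℂ] H} (hA : IsGenerator S A) (hT : 0 ≤ T)
    (hS : IsC0Semigroup S) (hK : IsKernelRep T K K₀) {x y : H} (h : (x, y) ∈ A.graph) {t : ℝ}
    (ht : 0 ≤ t) : fundSol T S K₀ t x =
      x + ∫ r in 0..t, (fundSol T S K₀ r y + resolventExt T S K₀ r x) := by
  have hR := strCont_resolventExt hT hS hK
  have hc := hS.strCont_semigroupExt
  have hy := (hc y).intervalIntegrable (μ := volume) 0 t
  have hI : StrCont fun _ : ℝ => (1 : H →L[ℂ] H) := StrCont.const 1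
  have h1 : ∫ s in 0..t, resolventExt T S K₀ (t - s) (∫ r in 0..s, semigroupExt S r y) =
      ∫ s in 0..t, ∫ r in 0..s, resolventExt T S K₀ (s - r) (semigroupExt S r y) := by
    have e1 := integral_convolution_assoc hR hI ht hy
    have e2 := integral_convolution_assoc hI hR ht hy
    simp only [one_apply_eq_self] at e1 e2
    rw [e1, e2]
    refine intervalIntegral.integral_congr fun r _ => ?_
    have := intervalIntegral.integral_comp_sub_left (a := 0) (b := t - r)
      (fun s => resolventExt T S K₀ s (semigroupExt S r y)) (t - r)
    simpa using this
  have hΦ : ∀ s, fundSol T S K₀ s y = semigroupExt S s y +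
      ∫ r in 0..s, resolventExt T S K₀ (s - r) (semigroupExt S r y) := fun s =>
    fundSol_apply hT hS hK s y
  have hcv : Continuous fun s =>
      ∫ r in 0..s, resolventExt T S K₀ (s - r) (semigroupExt S r y) := by
    have := hR.opConv hc y
    simpa only [opConv_apply hR hc] using this
  rw [fundSol_apply hT hS hK]
  have h2 : ∫ s in 0..t, resolventExt T S K₀ (t - s) (semigroupExt S s x) =
      (∫ s in 0..t, resolventExt T S K₀ s x) +
      ∫ s in 0..t, resolventExt T S K₀ (t - s) (∫ r in 0..s, semigroupExt S r y) := by
    have e1 : ∫ s in 0..t, resolventExt T S K₀ s x = ∫ s in 0..t, resolventExt T S K₀ (t - s) x := by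
      have := intervalIntegral.integral_comp_sub_left (a := 0) (b := t)
        (fun s => resolventExt T S K₀ s x) t
      simpa using this.symm
    rw [e1, ← intervalIntegral.integral_add]
    · refine intervalIntegral.integral_congr fun s hs => ?_
      rw [uIcc_of_le ht] at hs
      rw [hA.semigroupExt_eq_integral hS h hs.1, map_add]
    · exact ((hR x).comp (continuous_const.sub continuous_id)).intervalIntegrable _ _
    · refine Continuous.intervalIntegrable ?_ _ _
      exact hR.continuous_apply (by fun_prop)
        (intervalIntegral.continuous_primitive (fun a b => (hc y).intervalIntegrable a b) 0)
  rw [h2, h1, hA.semigroupExt_eq_integral hS h ht]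
  rw [intervalIntegral.integral_add ((strCont_fundSol hT hS hK y).intervalIntegrable _ _)
    ((hR x).intervalIntegrable _ _)]
  simp only [hΦ]
  rw [intervalIntegral.integral_add hy (hcv.intervalIntegrable _ _)]
  abel

end Identification

/-! ### Operators on `L²` of the line -/

section LTwo

variable {E F : Type*} [NormedAddCommGroup E] [InnerProductSpace ℂ E]
  [NormedAddCommGroup F] [InnerProductSpace ℂ F]

/-- `L²(ℝ;E)`. -/
abbrev L2R (E : Type*) [NormedAddCommGroup E] : Type _ := Lp E 2 (volume : Measure ℝ)

theorem integrableOn_Lp_two {ν : Measure ℝ} (f : Lp E 2 ν) {J : Set ℝ} (hJ : ν J ≠ ∞) :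
    IntegrableOn f J ν :=
  integrableOn_Lp_of_measure_ne_top f (by norm_num) hJ

/-- The Cauchy–Schwarz inequality on a set of finite measure. -/
theorem setIntegral_norm_le_of_Lp_two {ν : Measure ℝ} (f : Lp E 2 ν) {J : Set ℝ} (hJ : ν J ≠ ∞) :
    ∫ x in J, ‖f x‖ ∂ν ≤ √(ν.real J) * ‖f‖ := by
  have hm : AEStronglyMeasurable f (ν.restrict J) := (Lp.aestronglyMeasurable f).restrict
  have h1 := eLpNorm_le_eLpNorm_mul_rpow_measure_univ (μ := ν.restrict J) (p := 1) (q := 2)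
    (by norm_num) hm
  rw [eLpNorm_one_eq_lintegral_enorm] at h1
  have h2 : eLpNorm f 2 (ν.restrict J) ≤ eLpNorm f 2 ν :=
    eLpNorm_mono_measure _ Measure.restrict_le_self
  rw [integral_norm_eq_lintegral_enorm hm]
  have h3 : ∫⁻ x in J, ‖f x‖ₑ ∂ν ≤ eLpNorm f 2 ν * ν J ^ (1 / 2 : ℝ) := by
    refine h1.trans ?_
    simp only [Measure.restrict_apply_univ]
    norm_num
    gcongr
  have h4 : eLpNorm f 2 ν * ν J ^ (1 / 2 : ℝ) ≠ ∞ :=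
    ENNReal.mul_ne_top (Lp.eLpNorm_ne_top f) (ENNReal.rpow_ne_top_of_nonneg (by norm_num) hJ)
  refine (ENNReal.toReal_mono h4 h3).trans_eq ?_
  rw [ENNReal.toReal_mul, Lp.norm_def, mul_comm, ← ENNReal.toReal_rpow, Real.sqrt_eq_rpow]
  rfl

/-- The class of `1_s f`. -/
def restrFun (s : Set ℝ) (hs : MeasurableSet s) (f : L2R E) : L2R E :=
  ((Lp.memLp f).indicator hs).toLp _

theorem restrFun_coe (s : Set ℝ) (hs : MeasurableSet s) (f : L2R E) :
    restrFun s hs f =ᵐ[volume] s.indicator f :=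
  MemLp.coeFn_toLp _

/-- Multiplication by the indicator function of a measurable set. -/
def restrOp (s : Set ℝ) (hs : MeasurableSet s) : L2R E →L[ℂ] L2R E :=
  LinearMap.mkContinuous
    { toFun := restrFun s hs
      map_add' := fun f g => by
        refine Lp.ext ?_
        filter_upwards [restrFun_coe s hs f, restrFun_coe s hs g, restrFun_coe s hs (f + g),
          Lp.coeFn_add f g, Lp.coeFn_add (restrFun s hs f) (restrFun s hs g)] with x h1 h2 h3 h4 h5
        rw [h3, h5, Pi.add_apply, h1, h2]
        by_cases h : x ∈ s
        · simp only [indicator_of_mem h, h4, Pi.add_apply]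
        · simp only [indicator_of_notMem h, add_zero]
      map_smul' := fun c f => by
        refine Lp.ext ?_
        filter_upwards [restrFun_coe s hs f, restrFun_coe s hs (c • f),
          Lp.coeFn_smul c f, Lp.coeFn_smul c (restrFun s hs f)] with x h1 h3 h4 h5
        rw [h3, RingHom.id_apply, h5, Pi.smul_apply, h1]
        by_cases h : x ∈ s
        · simp only [indicator_of_mem h, h4, Pi.smul_apply]
        · simp only [indicator_of_notMem h, smul_zero] } 1
    (fun f => by
      rw [one_mul]
      refine Lp.norm_le_norm_of_ae_le ?_
      filter_upwards [restrFun_coe s hs f] with x hx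
      exact hx ▸ norm_indicator_le_norm_self _ _)

theorem restrOp_coe (s : Set ℝ) (hs : MeasurableSet s) (f : L2R E) :
    restrOp s hs f =ᵐ[volume] s.indicator f :=
  restrFun_coe s hs f

theorem norm_restrOp_apply_le (s : Set ℝ) (hs : MeasurableSet s) (f : L2R E) :
    ‖restrOp s hs f‖ ≤ ‖f‖ := by
  refine Lp.norm_le_norm_of_ae_le ?_
  filter_upwards [restrOp_coe s hs f] with x hx
  exact hx ▸ norm_indicator_le_norm_self _ _

theorem restrOp_restrOp {s t : Set ℝ} (hs : MeasurableSet s) (ht : MeasurableSet t) (f : L2R E) :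
    restrOp s hs (restrOp t ht f) = restrOp (s ∩ t) (hs.inter ht) f := by
  refine Lp.ext ?_
  filter_upwards [restrOp_coe s hs (restrOp t ht f), restrOp_coe t ht f,
    restrOp_coe (s ∩ t) (hs.inter ht) f] with x h1 h2 h3
  rw [h1, h3, ← indicator_indicator]
  by_cases h : x ∈ s <;> simp [h, h2]

theorem restrOp_eq_self {s : Set ℝ} (hs : MeasurableSet s) {f : L2R E}
    (h : ∀ᵐ x, x ∉ s → f x = 0) : restrOp s hs f = f := by
  refine Lp.ext ?_
  filter_upwards [restrOp_coe s hs f, h] with x h1 h2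
  rw [h1]
  by_cases hx : x ∈ s
  · rw [indicator_of_mem hx]
  · rw [indicator_of_notMem hx, h2 hx]

theorem inner_restrOp_left (s : Set ℝ) (hs : MeasurableSet s) (f g : L2R E) :
    inner ℂ (restrOp s hs f) g = ∫ x in s, inner ℂ (f x) (g x) := by
  rw [L2.inner_def, ← integral_indicator hs]
  refine integral_congr_ae ?_
  filter_upwards [restrOp_coe s hs f] with x hx
  rw [hx]
  by_cases h : x ∈ s <;> simp [h]

theorem inner_restrOp_right (s : Set ℝ) (hs : MeasurableSet s) (f g : L2R E) :
    inner ℂ f (restrOp s hs g) = ∫ x in s, inner ℂ (f x) (g x) := by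
  rw [L2.inner_def, ← integral_indicator hs]
  refine integral_congr_ae ?_
  filter_upwards [restrOp_coe s hs g] with x hx
  rw [hx]
  by_cases h : x ∈ s <;> simp [h]

theorem inner_restrOp_comm (s : Set ℝ) (hs : MeasurableSet s) (f g : L2R E) :
    inner ℂ (restrOp s hs f) g = inner ℂ f (restrOp s hs g) := by
  rw [inner_restrOp_left, inner_restrOp_right]

theorem compLpL_restrOp (L : E →L[ℂ] F) (s : Set ℝ) (hs : MeasurableSet s) (f : L2R E) :
    L.compLpL 2 volume (restrOp s hs f) = restrOp s hs (L.compLpL 2 volume f) := by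
  refine Lp.ext ?_
  filter_upwards [restrOp_coe s hs f, restrOp_coe s hs (L.compLpL 2 volume f),
    L.coeFn_compLpL (p := 2) (μ := volume) f,
    L.coeFn_compLpL (p := 2) (μ := volume) (restrOp s hs f)] with x h1 h2 h3 h4
  rw [h2, h4, h1]
  by_cases h : x ∈ s <;> simp [h, h3]

theorem inner_compLpL_comm [CompleteSpace E] [CompleteSpace F] (L : E →L[ℂ] F) (f : L2R F)
    (g : L2R E) :
    inner ℂ (L.adjoint.compLpL 2 volume f) g = inner ℂ f (L.compLpL 2 volume g) := by
  rw [L2.inner_def, L2.inner_def]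
  refine integral_congr_ae ?_
  filter_upwards [L.coeFn_compLpL (p := 2) (μ := volume) g,
    L.adjoint.coeFn_compLpL (p := 2) (μ := volume) f] with x h1 h2
  rw [h1, h2, ContinuousLinearMap.adjoint_inner_left]

theorem norm_restrOp_sq (s : Set ℝ) (hs : MeasurableSet s) (f : L2R E) :
    ‖restrOp s hs f‖ ^ 2 = ∫ x in s, ‖f x‖ ^ 2 := by
  have h1 : ((‖restrOp s hs f‖ ^ 2 : ℝ) : ℂ) = ((∫ x in s, ‖f x‖ ^ 2 : ℝ) : ℂ) := by
    have h := inner_self_eq_norm_sq_to_K (𝕜 := ℂ) (restrOp s hs f)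
    push_cast
    rw [← integral_complex_ofReal]
    refine (h.symm.trans ?_)
    rw [inner_restrOp_comm, restrOp_restrOp, inner_restrOp_right]
    simp only [inter_self]
    refine integral_congr_ae (ae_of_all _ fun x => ?_)
    simp only [inner_self_eq_norm_sq_to_K]
    push_cast
    rfl
  exact_mod_cast h1

/-- An element of `L²` bounded by `c` on an interval of length `h` and restricted to it has
norm at most `c √h`. -/
theorem norm_restrOp_Ioc_le {a b c : ℝ} (hab : a ≤ b) (hc : 0 ≤ c) {f : L2R E}
    (h : ∀ᵐ x ∂volume.restrict (Ioc a b), ‖f x‖ ≤ c) :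
    ‖restrOp (Ioc a b) measurableSet_Ioc f‖ ≤ c * √(b - a) := by
  have h1 : ‖restrOp (Ioc a b) measurableSet_Ioc f‖ ^ 2 ≤ c ^ 2 * (b - a) := by
    rw [norm_restrOp_sq]
    have h2 : ∫ x in Ioc a b, ‖f x‖ ^ 2 ≤ ∫ x in Ioc a b, c ^ 2 := by
      refine integral_mono_of_nonneg (ae_of_all _ fun x => by positivity) (by simp) ?_
      filter_upwards [h] with x hx
      exact pow_le_pow_left₀ (norm_nonneg _) hx 2
    refine h2.trans_eq ?_
    simp [hab, mul_comm]
  refine abs_le_of_sq_le_sq' ?_ (by positivity) |>.2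
  rw [mul_pow, Real.sq_sqrt (by linarith)]
  exact h1

/-- The cutoff `f ↦ 1_{(t,∞)} f`. -/
def afterOp (t : ℝ) : L2R E →L[ℂ] L2R E := restrOp (Ioi t) measurableSet_Ioi

theorem afterOp_sub_afterOp {s t : ℝ} (h : s ≤ t) (f : L2R E) :
    afterOp s f - afterOp t f = restrOp (Ioc s t) measurableSet_Ioc f := by
  refine Lp.ext ?_
  filter_upwards [restrOp_coe (Ioc s t) measurableSet_Ioc f,
    restrOp_coe (Ioi s) measurableSet_Ioi f, restrOp_coe (Ioi t) measurableSet_Ioi f,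
    Lp.coeFn_sub (afterOp s f) (afterOp t f)] with x h1 h2 h3 h4
  rw [h4, h1, Pi.sub_apply, afterOp, afterOp, h2, h3]
  simp only [indicator_apply, mem_Ioi, mem_Ioc]
  by_cases hs : s < x <;> by_cases ht : t < x
  · simp [hs, ht]
  · simp [hs, ht, not_lt.1 ht]
  · exact absurd (h.trans_lt ht) hs
  · simp [hs, ht]

theorem strCont_afterOp : StrCont (afterOp (E := E)) := by
  intro f
  have hi : Integrable fun x => ‖f x‖ ^ 2 := (Lp.memLp f).integrable_norm_pow (by norm_num)
  have hG : Continuous fun t => ∫ x in (0 : ℝ)..t, ‖f x‖ ^ 2 :=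
    intervalIntegral.continuous_primitive (fun a b => hi.intervalIntegrable) 0
  have hle : ∀ s t, s ≤ t → ‖afterOp t f - afterOp s f‖ =
      √|(∫ x in (0 : ℝ)..t, ‖f x‖ ^ 2) - ∫ x in (0 : ℝ)..s, ‖f x‖ ^ 2| := fun s t h => by
    rw [intervalIntegral.integral_interval_sub_left hi.intervalIntegrable hi.intervalIntegrable,
      intervalIntegral.integral_of_le h, ← norm_restrOp_sq _ measurableSet_Ioc, abs_of_nonneg
      (sq_nonneg _), Real.sqrt_sq (norm_nonneg _), ← afterOp_sub_afterOp h, norm_sub_rev]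
  have hall : ∀ s t, ‖afterOp t f - afterOp s f‖ =
      √|(∫ x in (0 : ℝ)..t, ‖f x‖ ^ 2) - ∫ x in (0 : ℝ)..s, ‖f x‖ ^ 2| := fun s t => by
    rcases le_total s t with h | h
    · exact hle s t h
    · rw [norm_sub_rev, hle t s h, abs_sub_comm]
  rw [continuous_iff_continuousAt]
  intro s
  rw [ContinuousAt, tendsto_iff_norm_sub_tendsto_zero]
  simp only [hall]
  have : Continuous fun t => √|(∫ x in (0 : ℝ)..t, ‖f x‖ ^ 2) - ∫ x in (0 : ℝ)..s, ‖f x‖ ^ 2| := by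
    fun_prop
  simpa using this.tendsto s

/-- The translation `(τ_s f)(p) = f(p - s)`. -/
def shiftOp (s : ℝ) : L2R E →L[ℂ] L2R E :=
  (Lp.compMeasurePreservingₗᵢ ℂ (fun p => p - s)
    (measurePreserving_sub_right volume s)).toContinuousLinearMap

theorem shiftOp_coe (s : ℝ) (f : L2R E) : shiftOp s f =ᵐ[volume] fun p => f (p - s) :=
  Lp.coeFn_compMeasurePreserving f (measurePreserving_sub_right volume s)

theorem norm_shiftOp_apply (s : ℝ) (f : L2R E) : ‖shiftOp s f‖ = ‖f‖ :=
  (Lp.compMeasurePreservingₗᵢ ℂ (fun p => p - s)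
    (measurePreserving_sub_right volume s)).norm_map f

theorem strCont_shiftOp : StrCont (shiftOp (E := E)) := by
  intro f
  let g : ℝ → C(ℝ, ℝ) := fun s => ⟨fun p => p - s, by fun_prop⟩
  have hg : Continuous g :=
    ContinuousMap.continuous_of_continuous_uncurry _ (by
      change Continuous fun p : ℝ × ℝ => p.2 - p.1
      fun_prop)
  exact (continuous_const (y := f)).compMeasurePreservingLp hg
    (fun s => measurePreserving_sub_right volume s) (by norm_num)

theorem inner_shiftOp_left (s : ℝ) (f g : L2R E) :
    inner ℂ (shiftOp s f) g = inner ℂ f (shiftOp (-s) g) := by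
  rw [L2.inner_def, L2.inner_def]
  have h1 : ∫ p, inner ℂ (shiftOp s f p) (g p) = ∫ p, inner ℂ (f (p - s)) (g p) := by
    refine integral_congr_ae ?_
    filter_upwards [shiftOp_coe s f] with x hx
    rw [hx]
  have h2 : ∫ p, inner ℂ (f p) (shiftOp (-s) g p) = ∫ p, inner ℂ (f p) (g (p + s)) := by
    refine integral_congr_ae ?_
    filter_upwards [shiftOp_coe (-s) g] with x hx
    rw [hx, sub_neg_eq_add]
  rw [h1, h2, ← integral_add_right_eq_self _ s]
  simp only [add_sub_cancel_right]

theorem adjoint_shiftOp [CompleteSpace E] (s : ℝ) :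
    ContinuousLinearMap.adjoint (shiftOp (E := E) s) = shiftOp (-s) := by
  symm
  rw [ContinuousLinearMap.eq_adjoint_iff]
  intro f g
  rw [inner_shiftOp_left, neg_neg]

/-- The class of a function in `L²`, `0` for functions that are not square integrable. -/
def ofFun (f : ℝ → E) : L2R E := by
  classical exact if h : MemLp f 2 volume then h.toLp f else 0

theorem ofFun_coe {f : ℝ → E} (h : MemLp f 2 volume) : ofFun f =ᵐ[volume] f := by
  rw [ofFun, dif_pos h]
  exact h.coeFn_toLp

end LTwo

section BochnerPointwise

variable {F : Type*} [NormedAddCommGroup F] [InnerProductSpace ℂ F] [CompleteSpace F]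

/-- A Bochner integral in `L²(ℝ;F)` of classes of functions `k(σ,·)` is the class of the
pointwise integral of `k`. -/
theorem integral_L2R_coe {ν : Measure ℝ} [SFinite ν] {f : ℝ → L2R F} (hf : Integrable f ν)
    {k : ℝ → ℝ → F} (hk : AEStronglyMeasurable (Function.uncurry k) (ν.prod volume))
    (hfk : ∀ᵐ σ ∂ν, f σ =ᵐ[volume] k σ) :
    (∫ σ, f σ ∂ν : L2R F) =ᵐ[volume] fun p => ∫ σ, k σ p ∂ν := by
  have hint : ∀ J : Set ℝ, MeasurableSet J → volume J < ∞ →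
      Integrable (Function.uncurry k) (ν.prod (volume.restrict J)) := by
    intro J hJ hJ'
    have hm : AEStronglyMeasurable (Function.uncurry k) (ν.prod (volume.restrict J)) :=
      hk.mono_measure (by gcongr; exact Measure.restrict_le_self)
    rw [integrable_prod_iff hm]
    refine ⟨?_, ?_⟩
    · filter_upwards [hfk] with σ hσ
      exact (integrableOn_Lp_two (f σ) hJ'.ne).congr (ae_restrict_of_ae hσ)
    · refine Integrable.mono' (hf.norm.const_mul √(volume.real J))
        hm.norm.integral_prod_right' ?_
      filter_upwards [hfk] with σ hσ
      rw [Real.norm_of_nonneg (integral_nonneg fun _ => norm_nonneg _)]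
      refine le_trans (le_of_eq ?_) (setIntegral_norm_le_of_Lp_two (f σ) hJ'.ne)
      refine integral_congr_ae (ae_restrict_of_ae ?_)
      filter_upwards [hσ] with x hx
      rw [hx]; rfl
  refine ae_eq_of_forall_setIntegral_eq_of_sigmaFinite
    (fun J hJ hJ' => integrableOn_Lp_two _ hJ'.ne)
    (fun J hJ hJ' => (hint J hJ hJ').integral_prod_right) fun J hJ hJ' => ?_
  refine ext_inner_left ℂ fun c => ?_
  rw [← L2.inner_indicatorConstLp_eq_inner_setIntegral ℂ hJ hJ'.ne, ← integral_inner hf,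
    ← integral_integral_swap (hint J hJ hJ')]
  refine Eq.trans ?_ (integral_inner (hint J hJ hJ').integral_prod_left c)
  refine integral_congr_ae ?_
  filter_upwards [hfk] with σ hσ
  rw [L2.inner_indicatorConstLp_eq_inner_setIntegral ℂ hJ hJ'.ne]
  congr 1
  refine integral_congr_ae (ae_restrict_of_ae ?_)
  filter_upwards [hσ] with x hx
  rw [hx]; rfl

end BochnerPointwise

section Synthesis

variable {E F : Type*} [NormedAddCommGroup E] [InnerProductSpace ℂ E] [CompleteSpace E]
  [NormedAddCommGroup F] [InnerProductSpace ℂ F]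
  {ν : Measure ℝ} [IsLocallyFiniteMeasure ν]

theorem integrableOn_strCont_apply {a : ℝ → E →L[ℂ] F} (ha : StrCont a) (b c : ℝ) (v : Lp E 2 ν) :
    IntegrableOn (fun σ => a σ (v σ)) (Ioc b c) ν := by
  obtain ⟨C, hC0, hC⟩ := ha.exists_bound b c
  have hv := integrableOn_Lp_two v (measure_Ioc_lt_top (μ := ν) (a := b) (b := c)).ne
  refine Integrable.mono' (hv.norm.const_mul C)
    (ha.aestronglyMeasurable_apply (by fun_prop) hv.aestronglyMeasurable) ?_
  rw [ae_restrict_iff' measurableSet_Ioc]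
  exact ae_of_all _ fun s hs => ContinuousLinearMap.le_of_opNorm_le _ (hC s ⟨hs.1.le, hs.2⟩) _

theorem norm_setIntegral_strCont_apply_le {a : ℝ → E →L[ℂ] F} {b c C : ℝ}
    (hC : ∀ s ∈ Ioc b c, ‖a s‖ ≤ C) (hC0 : 0 ≤ C) (v : Lp E 2 ν) :
    ‖∫ σ in Ioc b c, a σ (v σ) ∂ν‖ ≤ C * (√(ν.real (Ioc b c)) * ‖v‖) := by
  have hfin := (measure_Ioc_lt_top (μ := ν) (a := b) (b := c)).ne
  have h1 : ‖∫ σ in Ioc b c, a σ (v σ) ∂ν‖ ≤ ∫ σ in Ioc b c, C * ‖v σ‖ ∂ν := by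
    refine norm_integral_le_of_norm_le ((integrableOn_Lp_two v hfin).norm.const_mul C) ?_
    rw [ae_restrict_iff' measurableSet_Ioc]
    exact ae_of_all _ fun s hs => ContinuousLinearMap.le_of_opNorm_le _ (hC s hs) _
  refine h1.trans ?_
  rw [integral_const_mul]
  exact mul_le_mul_of_nonneg_left (setIntegral_norm_le_of_Lp_two v hfin) hC0

/-- The operator `v ↦ ∫₀ᵗ a(σ) v(σ) dν(σ)` on `L²(ν;E)` defined by a strongly continuous
operator function. -/
def synthOp (ν : Measure ℝ) [IsLocallyFiniteMeasure ν] (t : ℝ) (a : ℝ → E →L[ℂ] F)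
    (ha : StrCont a) : Lp E 2 ν →L[ℂ] F :=
  LinearMap.mkContinuousOfExistsBound
    { toFun := fun v => ∫ σ in Ioc 0 t, a σ (v σ) ∂ν
      map_add' := fun v w => by
        rw [← integral_add (integrableOn_strCont_apply ha 0 t v)
          (integrableOn_strCont_apply ha 0 t w)]
        refine integral_congr_ae (ae_restrict_of_ae ?_)
        filter_upwards [Lp.coeFn_add v w] with x hx
        rw [hx, Pi.add_apply, map_add]
      map_smul' := fun c v => by
        rw [RingHom.id_apply, ← integral_smul]
        refine integral_congr_ae (ae_restrict_of_ae ?_)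
        filter_upwards [Lp.coeFn_smul c v] with x hx
        rw [hx, Pi.smul_apply, map_smul] }
    (by
      obtain ⟨C, hC0, hC⟩ := ha.exists_bound 0 t
      refine ⟨C * √(ν.real (Ioc 0 t)), fun v => ?_⟩
      rw [mul_assoc]
      exact norm_setIntegral_strCont_apply_le (fun s hs => hC s ⟨hs.1.le, hs.2⟩) hC0 v)

theorem synthOp_apply {a : ℝ → E →L[ℂ] F} (ha : StrCont a) (t : ℝ) (v : Lp E 2 ν) :
    synthOp ν t a ha v = ∫ σ in Ioc 0 t, a σ (v σ) ∂ν := rfl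

theorem inner_synthOp [CompleteSpace F] {a : ℝ → E →L[ℂ] F} (ha : StrCont a) (t : ℝ)
    (v : Lp E 2 ν) (g : F) : inner ℂ g (synthOp ν t a ha v) =
      ∫ σ in Ioc 0 t, inner ℂ ((a σ).adjoint g) (v σ) ∂ν := by
  rw [synthOp_apply, ← integral_inner (integrableOn_strCont_apply ha 0 t v)]
  simp only [ContinuousLinearMap.adjoint_inner_left]

end Synthesis

/-! ### The abstract linear-quadratic problem -/

section LinearQuadratic

variable {X Y : Type*} [NormedAddCommGroup X] [InnerProductSpace ℂ X] [CompleteSpace X]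
  [NormedAddCommGroup Y] [InnerProductSpace ℂ Y] [CompleteSpace Y]

/-- `Λ = I + C^* Q C`. -/
def lambdaOp (C : X →L[ℂ] Y) (Q : Y →L[ℂ] Y) : X →L[ℂ] X := 1 + C.adjoint ∘L Q ∘L C

/-- The operator `N = Q - Q C Λ⁻¹ C^* Q`, for which `⟨N y, y⟩` is the minimum over `u` of
`⟨Q w, w⟩ + ‖u‖²`, `w = y + C u`. -/
def costForm (C : X →L[ℂ] Y) (Q : Y →L[ℂ] Y) : Y →L[ℂ] Y :=
  Q - Q ∘L C ∘L Ring.inverse (lambdaOp C Q) ∘L C.adjoint ∘L Q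

variable {C : X →L[ℂ] Y} {Q : Y →L[ℂ] Y}

theorem isUnit_lambdaOp (hQ : Q.IsPositive) : IsUnit (lambdaOp C Q) := by
  have h1 : (C.adjoint ∘L Q ∘L C).IsPositive := hQ.adjoint_conj C
  have h2 := (SpectrumRestricts.nnreal_iff.1 h1.spectrumRestricts) (-1)
  have h3 : (-1 : ℝ) ∉ spectrum ℝ (C.adjoint ∘L Q ∘L C) := fun h => by
    have := h2 h
    norm_num at this
  rw [spectrum.notMem_iff] at h3
  have h4 := h3.neg
  have h5 : -(algebraMap ℝ (X →L[ℂ] X) (-1) - C.adjoint ∘L Q ∘L C) = lambdaOp C Q := by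
    rw [lambdaOp, map_neg, map_one]; abel
  rwa [h5] at h4

theorem lambdaOp_inverse_apply (hQ : Q.IsPositive) (v : X) :
    lambdaOp C Q (Ring.inverse (lambdaOp C Q) v) = v :=
  DFunLike.congr_fun (Ring.mul_inverse_cancel _ (isUnit_lambdaOp (C := C) hQ)) v

theorem inverse_lambdaOp_apply (hQ : Q.IsPositive) (v : X) :
    Ring.inverse (lambdaOp C Q) (lambdaOp C Q v) = v :=
  DFunLike.congr_fun (Ring.inverse_mul_cancel _ (isUnit_lambdaOp (C := C) hQ)) v

theorem lambdaOp_apply (u : X) : lambdaOp C Q u = u + C.adjoint (Q (C u)) := rfl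

theorem norm_le_norm_lambdaOp (hQ : Q.IsPositive) (u : X) : ‖u‖ ≤ ‖lambdaOp C Q u‖ := by
  have h1 : ‖u‖ ^ 2 ≤ RCLike.re (inner ℂ u (lambdaOp C Q u)) := by
    rw [lambdaOp_apply, inner_add_right, map_add, ContinuousLinearMap.adjoint_inner_right,
      inner_self_eq_norm_sq (𝕜 := ℂ)]
    have := hQ.re_inner_nonneg_right (C u)
    linarith
  have h2 : RCLike.re (inner ℂ u (lambdaOp C Q u)) ≤ ‖u‖ * ‖lambdaOp C Q u‖ :=
    re_inner_le_norm u _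
  rcases (norm_nonneg u).eq_or_lt with h | h
  · rw [← h]; exact norm_nonneg _
  · exact le_of_mul_le_mul_left (by nlinarith) h

theorem norm_inverse_lambdaOp_apply_le (hQ : Q.IsPositive) (v : X) :
    ‖Ring.inverse (lambdaOp C Q) v‖ ≤ ‖v‖ :=
  (norm_le_norm_lambdaOp hQ _).trans_eq (by rw [lambdaOp_inverse_apply hQ])

theorem adjoint_costForm_apply (hQ : Q.IsPositive) (y : Y) :
    C.adjoint (costForm C Q y) = Ring.inverse (lambdaOp C Q) (C.adjoint (Q y)) := by
  have h := lambdaOp_inverse_apply (C := C) hQ (C.adjoint (Q y))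
  rw [lambdaOp_apply] at h
  have h2 : costForm C Q y =
      Q y - Q (C (Ring.inverse (lambdaOp C Q) (C.adjoint (Q y)))) := rfl
  rw [h2, map_sub, sub_eq_iff_eq_add]
  exact h.symm

/-- `N y = Q w` for the optimal state `w = y + C u`, where `u = -C^* N y` is the optimal control. -/
theorem costForm_apply_eq (hQ : Q.IsPositive) (y : Y) :
    costForm C Q y = Q (y - C (C.adjoint (costForm C Q y))) := by
  rw [adjoint_costForm_apply hQ, map_sub]
  rfl

theorem eq_adjoint_costForm (hQ : Q.IsPositive) {u : X} {y : Y}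
    (h : u + C.adjoint (Q (C u)) = C.adjoint (Q y)) : u = C.adjoint (costForm C Q y) := by
  rw [adjoint_costForm_apply hQ, ← h, ← lambdaOp_apply, inverse_lambdaOp_apply hQ]

theorem inner_costForm (hQ : Q.IsPositive) (x y : Y) :
    inner ℂ x (costForm C Q y) =
      inner ℂ (C.adjoint (costForm C Q x)) (C.adjoint (costForm C Q y)) +
      inner ℂ (x - C (C.adjoint (costForm C Q x))) (Q (y - C (C.adjoint (costForm C Q y)))) := by
  rw [← costForm_apply_eq hQ y, inner_sub_left, ContinuousLinearMap.adjoint_inner_right]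
  ring

theorem inner_apply_comm_of_isPositive (hQ : Q.IsPositive) (x y : Y) :
    inner ℂ (Q x) y = inner ℂ x (Q y) := by
  rw [← ContinuousLinearMap.adjoint_inner_left, hQ.isSelfAdjoint.adjoint_eq]

theorem inner_costForm_comm (hQ : Q.IsPositive) (x y : Y) :
    inner ℂ (costForm C Q x) y = inner ℂ x (costForm C Q y) := by
  rw [inner_costForm hQ x y, ← inner_conj_symm, inner_costForm hQ y x, map_add, inner_conj_symm,
    inner_conj_symm, inner_apply_comm_of_isPositive hQ]

/-- The comparison of the minimal costs of two problems with the same weight `Q`. The pairing of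
the two optimal states can be evaluated with either optimality condition, so that only
differences of the data and of the maps `C₁^*`, `C₂^*` survive. -/
theorem inner_costForm_sub_inner_costForm {C₁ C₂ : X →L[ℂ] Y} (hQ : Q.IsPositive)
    (y₁ y₁' y₂ y₂' : Y) :
    inner ℂ y₁' (costForm C₁ Q y₁) - inner ℂ y₂' (costForm C₂ Q y₂) =
      inner ℂ (y₁' - y₂') (costForm C₁ Q y₁) + inner ℂ (costForm C₂ Q y₂') (y₁ - y₂) -
      (inner ℂ (C₁.adjoint (costForm C₂ Q y₂')) (C₁.adjoint (costForm C₁ Q y₁)) -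
        inner ℂ (C₂.adjoint (costForm C₂ Q y₂')) (C₂.adjoint (costForm C₁ Q y₁))) := by
  set a := costForm C₁ Q y₁ with ha
  set b := costForm C₂ Q y₂' with hb
  have e1 : inner ℂ y₂' a = inner ℂ (y₂' - C₂ (C₂.adjoint b)) a +
      inner ℂ (C₂.adjoint b) (C₂.adjoint a) := by
    rw [inner_sub_left, ContinuousLinearMap.adjoint_inner_right]; ring
  have e2 : inner ℂ (y₂' - C₂ (C₂.adjoint b)) a = inner ℂ b (y₁ - C₁ (C₁.adjoint a)) := by
    have h1 : a = Q (y₁ - C₁ (C₁.adjoint a)) := costForm_apply_eq hQ y₁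
    have h2 : b = Q (y₂' - C₂ (C₂.adjoint b)) := costForm_apply_eq hQ y₂'
    calc inner ℂ (y₂' - C₂ (C₂.adjoint b)) a
        = inner ℂ (y₂' - C₂ (C₂.adjoint b)) (Q (y₁ - C₁ (C₁.adjoint a))) := by rw [← h1]
      _ = inner ℂ (Q (y₂' - C₂ (C₂.adjoint b))) (y₁ - C₁ (C₁.adjoint a)) := by
          rw [inner_apply_comm_of_isPositive hQ]
      _ = _ := by rw [← h2]
  have e3 : inner ℂ b (y₁ - C₁ (C₁.adjoint a)) = inner ℂ b y₁ -
      inner ℂ (C₁.adjoint b) (C₁.adjoint a) := by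
    rw [inner_sub_right, ContinuousLinearMap.adjoint_inner_left]
  have e4 : inner ℂ y₂' (costForm C₂ Q y₂) = inner ℂ b y₂ := (inner_costForm_comm hQ _ _).symm
  rw [e4, inner_sub_left, inner_sub_right, e1, e2, e3]
  ring

theorem StrCont.inverse_lambdaOp {C : ℝ → X →L[ℂ] Y} (hC : StrCont C)
    (hC' : StrCont fun t => (C t).adjoint) (hQ : Q.IsPositive) :
    StrCont fun t => Ring.inverse (lambdaOp (C t) Q) := by
  have hΛ : StrCont fun t => lambdaOp (C t) Q :=
    (StrCont.const 1).add (hC'.comp (hC.const_comp Q))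
  intro v
  rw [continuous_iff_continuousAt]
  intro s
  rw [ContinuousAt, tendsto_iff_norm_sub_tendsto_zero]
  set w := Ring.inverse (lambdaOp (C s) Q) v with hw
  have h1 : Tendsto (fun t => ‖lambdaOp (C t) Q w - lambdaOp (C s) Q w‖) (𝓝 s) (𝓝 0) :=
    tendsto_iff_norm_sub_tendsto_zero.1 ((hΛ w).tendsto s)
  refine squeeze_zero (fun _ => norm_nonneg _) (fun t => ?_) h1
  have h2 : Ring.inverse (lambdaOp (C t) Q) v - w =
      Ring.inverse (lambdaOp (C t) Q) (lambdaOp (C s) Q w - lambdaOp (C t) Q w) := by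
    rw [map_sub, inverse_lambdaOp_apply hQ, hw, lambdaOp_inverse_apply hQ]
  rw [h2, norm_sub_rev (lambdaOp (C t) Q w)]
  exact norm_inverse_lambdaOp_apply_le hQ _

theorem StrCont.costForm {C : ℝ → X →L[ℂ] Y} (hC : StrCont C)
    (hC' : StrCont fun t => (C t).adjoint) (hQ : Q.IsPositive) :
    StrCont fun t => costForm (C t) Q :=
  (StrCont.const Q).sub (((hC.comp ((StrCont.inverse_lambdaOp hC hC' hQ).comp
    (hC'.comp_const Q))).const_comp Q))

end LinearQuadratic

/-! ### The operators of the control problem on `L²` -/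

section CurveClasses

variable {E F : Type*} [NormedAddCommGroup E] [InnerProductSpace ℂ E] [CompleteSpace E]
  [NormedAddCommGroup F] [InnerProductSpace ℂ F] [CompleteSpace F]

theorem memLp_indicator_of_continuous {f : ℝ → F} (hf : Continuous f) (a b : ℝ) :
    MemLp ((Ioc a b).indicator f) 2 volume := by
  rw [memLp_indicator_iff_restrict measurableSet_Ioc]
  obtain ⟨C, hC⟩ := isCompact_Icc.exists_bound_of_continuousOn hf.continuousOn (s := Icc a b)
  refine MemLp.of_bound hf.aestronglyMeasurable C ?_
  rw [ae_restrict_iff' measurableSet_Ioc]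
  exact ae_of_all _ fun s hs => hC s ⟨hs.1.le, hs.2⟩

/-- The operator `x ↦ 1_{(0,T]} a(·) x` from `E` to `L²(ℝ;F)`. -/
def curveOp (T : ℝ) (a : ℝ → E →L[ℂ] F) (ha : StrCont a) : E →L[ℂ] L2R F :=
  LinearMap.mkContinuousOfExistsBound
    { toFun := fun x => ofFun ((Ioc 0 T).indicator fun p => a p x)
      map_add' := fun x y => by
        refine Lp.ext ?_
        filter_upwards [ofFun_coe (memLp_indicator_of_continuous (ha (x + y)) 0 T),
          ofFun_coe (memLp_indicator_of_continuous (ha x) 0 T),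
          ofFun_coe (memLp_indicator_of_continuous (ha y) 0 T),
          Lp.coeFn_add (ofFun ((Ioc 0 T).indicator fun p => a p x))
            (ofFun ((Ioc 0 T).indicator fun p => a p y))] with p h1 h2 h3 h4
        rw [h1, h4, Pi.add_apply, h2, h3]
        simp only [indicator_apply]
        split_ifs <;> simp
      map_smul' := fun c x => by
        refine Lp.ext ?_
        filter_upwards [ofFun_coe (memLp_indicator_of_continuous (ha (c • x)) 0 T),
          ofFun_coe (memLp_indicator_of_continuous (ha x) 0 T),
          Lp.coeFn_smul c (ofFun ((Ioc 0 T).indicator fun p => a p x))] with p h1 h2 h4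
        rw [h1, RingHom.id_apply, h4, Pi.smul_apply, h2]
        simp only [indicator_apply]
        split_ifs <;> simp }
    (by
      obtain ⟨C, hC0, hC⟩ := ha.exists_bound 0 (max T 0)
      refine ⟨C * √(max T 0), fun x => ?_⟩
      change ‖ofFun ((Ioc 0 T).indicator fun p => a p x)‖ ≤ _
      have h1 := ofFun_coe (memLp_indicator_of_continuous (ha x) 0 T)
      have h2 : restrOp (Ioc 0 (max T 0)) measurableSet_Ioc
          (ofFun ((Ioc 0 T).indicator fun p => a p x)) =
          ofFun ((Ioc 0 T).indicator fun p => a p x) := by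
        refine restrOp_eq_self _ ?_
        filter_upwards [h1] with p hp hp'
        rw [hp, indicator_of_notMem fun h => hp' ⟨h.1, h.2.trans (le_max_left _ _)⟩]
      rw [← h2]
      have h3 := norm_restrOp_Ioc_le (a := 0) (b := max T 0) (c := C * ‖x‖) (le_max_right _ _)
        (by positivity) (f := ofFun ((Ioc 0 T).indicator fun p => a p x)) (by
          rw [ae_restrict_iff' measurableSet_Ioc]
          filter_upwards [h1] with p hp hp'
          rw [hp]
          refine (norm_indicator_le_norm_self _ _).trans ?_
          exact (a p).le_of_opNorm_le (hC p ⟨hp'.1.le, hp'.2⟩) x)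
      rw [sub_zero] at h3
      linarith)

theorem curveOp_coe {a : ℝ → E →L[ℂ] F} (ha : StrCont a) (T : ℝ) (x : E) :
    curveOp T a ha x =ᵐ[volume] (Ioc 0 T).indicator fun p => a p x :=
  ofFun_coe (memLp_indicator_of_continuous (ha x) 0 T)

theorem shiftOp_coe_of_ae {f : L2R F} {g : ℝ → F} (h : f =ᵐ[volume] g) (s : ℝ) :
    shiftOp s f =ᵐ[volume] fun p => g (p - s) :=
  (shiftOp_coe s f).trans
    ((measurePreserving_sub_right volume s).quasiMeasurePreserving.ae_eq_comp h)

/-- The translates of a single `L²`-valued operator, cut off to `(0,T]`. They and their adjoints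
depend strongly continuously on the translation, because the translation group does. -/
def orbitOp (T : ℝ) (L : E →L[ℂ] L2R F) (σ : ℝ) : E →L[ℂ] L2R F :=
  restrOp (Ioc 0 T) measurableSet_Ioc ∘L shiftOp σ ∘L L

theorem strCont_orbitOp (T : ℝ) (L : E →L[ℂ] L2R F) : StrCont (orbitOp T L) :=
  (strCont_shiftOp.comp_const L).const_comp _

theorem strCont_adjoint_orbitOp (T : ℝ) (L : E →L[ℂ] L2R F) :
    StrCont fun σ => (orbitOp T L σ).adjoint := by
  have h : ∀ σ, (orbitOp T L σ).adjoint =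
      L.adjoint ∘L shiftOp (-σ) ∘L (restrOp (Ioc 0 T) measurableSet_Ioc).adjoint := fun σ => by
    rw [orbitOp, ContinuousLinearMap.adjoint_comp, ContinuousLinearMap.adjoint_comp,
      adjoint_shiftOp]
    rfl
  simp only [h]
  exact ((strCont_shiftOp.reparam continuous_neg).comp_const _).const_comp _

theorem strCont_shift_comp (L : E →L[ℂ] L2R F) : StrCont fun σ => shiftOp σ ∘L L :=
  strCont_shiftOp.comp_const L

theorem strCont_adjoint_shift_comp (L : E →L[ℂ] L2R F) :
    StrCont fun σ => (shiftOp σ ∘L L).adjoint := by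
  simp only [ContinuousLinearMap.adjoint_comp, adjoint_shiftOp]
  exact (strCont_shiftOp.reparam continuous_neg).const_comp _

/-- The operator `x ↦ k(·) x` from `E` to `L²(ℝ;E)`, for a scalar function `k ∈ L²(ℝ)`. -/
def tensorOp (k : L2R ℂ) : F →L[ℂ] L2R F :=
  (ContinuousLinearMap.compLpL₂ 2 volume (ContinuousLinearMap.lsmul ℂ ℂ : ℂ →L[ℂ] F →L[ℂ] F).flip).flip k

theorem tensorOp_coe (k : L2R ℂ) (x : F) : tensorOp k x =ᵐ[volume] fun p => k p • x :=
  ContinuousLinearMap.coeFn_compLpL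
    ((ContinuousLinearMap.lsmul ℂ ℂ : ℂ →L[ℂ] F →L[ℂ] F).flip x) k

end CurveClasses

/-- The data of a linear-quadratic problem on `[0,T]` with memory: the fundamental solution `Φ` of
the homogeneous equation (in place of the semigroup), the kernel `K`, the input operator `B` and
the weight `Q`. -/
structure MemorySystem (H U : Type*) [NormedAddCommGroup H] [InnerProductSpace ℂ H]
    [CompleteSpace H] [NormedAddCommGroup U] [InnerProductSpace ℂ U] [CompleteSpace U] where
  T : ℝ
  T_nonneg : 0 ≤ T
  Φ : ℝ → H →L[ℂ] H
  strCont : StrCont Φ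
  K : ℝ → ℝ
  measurable_K : Measurable K
  memLp_K : MemLp K 2 volume
  B : U →L[ℂ] H
  Q : H →L[ℂ] H
  Q_pos : Q.IsPositive

namespace MemorySystem

variable {H U : Type*} [NormedAddCommGroup H] [InnerProductSpace ℂ H]
    [CompleteSpace H] [NormedAddCommGroup U] [InnerProductSpace ℂ U] [CompleteSpace U]
    (sys : MemorySystem H U)

/-- `F(·,σ)` as an operator `H → L²(ℝ;H)`; for `σ ∈ [0,T]` the value at `x` is
`1_{(σ,T]} Φ(· - σ) x`. -/
def freeOp (σ : ℝ) : H →L[ℂ] L2R H := orbitOp sys.T (curveOp sys.T sys.Φ sys.strCont) σ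

theorem strCont_freeOp : StrCont sys.freeOp := strCont_orbitOp _ _

theorem strCont_adjoint_freeOp : StrCont fun σ => (sys.freeOp σ).adjoint :=
  strCont_adjoint_orbitOp _ _

theorem orbit_curveOp_coe {a : ℝ → H →L[ℂ] H} (ha : StrCont a) (T : ℝ) {σ : ℝ} (hσ : 0 ≤ σ)
    (x : H) : orbitOp T (curveOp T a ha) σ x =ᵐ[volume]
      (Ioc σ T).indicator fun p => a (p - σ) x := by
  filter_upwards [restrOp_coe (Ioc 0 T) measurableSet_Ioc (shiftOp σ (curveOp T a ha x)),
    shiftOp_coe_of_ae (curveOp_coe ha T x) σ] with p h1 h2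
  change restrOp (Ioc 0 T) measurableSet_Ioc (shiftOp σ (curveOp T a ha x)) p = _
  rw [h1]
  simp only [indicator_apply, h2, mem_Ioc]
  split_ifs with h3 h4 h5 h6 h7
  · rfl
  · exact absurd ⟨by linarith [h4.1], h3.2⟩ h5
  · exact absurd ⟨by linarith [h6.1], by linarith [h6.2]⟩ h4
  · rfl
  · exact absurd ⟨by linarith [h7.1], h7.2⟩ h3
  · rfl

theorem freeOp_coe {σ : ℝ} (hσ : 0 ≤ σ) (x : H) :
    sys.freeOp σ x =ᵐ[volume] (Ioc σ sys.T).indicator fun p => sys.Φ (p - σ) x :=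
  orbit_curveOp_coe sys.strCont sys.T hσ x

theorem exists_bound_Φ : ∃ C, 0 ≤ C ∧ ∀ t ∈ Icc 0 sys.T, ‖sys.Φ t‖ ≤ C :=
  sys.strCont.exists_bound 0 sys.T

/-- Causality: `F(·,σ)` is supported after `σ`. -/
theorem afterOp_freeOp {t σ : ℝ} (ht : t ≤ σ) (hσ : 0 ≤ σ) (x : H) :
    afterOp t (sys.freeOp σ x) = sys.freeOp σ x := by
  refine restrOp_eq_self _ ?_
  filter_upwards [sys.freeOp_coe hσ x] with p hp hp'
  rw [hp, indicator_of_notMem]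
  exact fun h => hp' (ht.trans_lt h.1)

/-- The convolution `v ↦ ∫ Φ(· - σ) v(σ) dσ` on `L²`, as an integral of the `L²`-valued function
`σ ↦ F(·,σ) v(σ)`. -/
def convOp : L2R H →L[ℂ] L2R H := synthOp volume sys.T sys.freeOp sys.strCont_freeOp

theorem convOp_apply (v : L2R H) :
    sys.convOp v = ∫ σ in Ioc 0 sys.T, sys.freeOp σ (v σ) := rfl

theorem inner_convOp (g v : L2R H) : inner ℂ g (sys.convOp v) =
    ∫ σ in Ioc 0 sys.T, inner ℂ ((sys.freeOp σ).adjoint g) (v σ) :=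
  inner_synthOp sys.strCont_freeOp sys.T v g

theorem afterOp_convOp_afterOp {t : ℝ} (v : L2R H) :
    afterOp t (sys.convOp (afterOp t v)) = sys.convOp (afterOp t v) := by
  rw [convOp_apply, ← ContinuousLinearMap.integral_comp_comm _
    (integrableOn_strCont_apply sys.strCont_freeOp 0 sys.T _)]
  refine setIntegral_congr_ae measurableSet_Ioc ?_
  filter_upwards [restrOp_coe (Ioi t) measurableSet_Ioi v] with σ h1 h2
  by_cases h : t < σ
  · exact sys.afterOp_freeOp h.le h2.1.le _
  · rw [afterOp, h1, indicator_of_notMem (by simpa using h)]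
    simp

/-- Pointwise form of the convolution. -/
theorem convOp_coe (v : L2R H) : sys.convOp v =ᵐ[volume] fun p =>
    ∫ σ in Ioc 0 sys.T, (Ioc σ sys.T).indicator (fun p => sys.Φ (p - σ) (v σ)) p := by
  rw [convOp_apply]
  refine integral_L2R_coe (integrableOn_strCont_apply sys.strCont_freeOp 0 sys.T v)
    (k := fun σ p => (Ioc σ sys.T).indicator (fun p => sys.Φ (p - σ) (v σ)) p) ?_ ?_
  · have h1 : AEStronglyMeasurable (fun q : ℝ × ℝ => v q.1)
        ((volume.restrict (Ioc 0 sys.T)).prod volume) :=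
      (Lp.aestronglyMeasurable v).restrict.comp_fst
    have h2 : AEStronglyMeasurable (fun q : ℝ × ℝ => sys.Φ (q.2 - q.1) (v q.1))
        ((volume.restrict (Ioc 0 sys.T)).prod volume) :=
      sys.strCont.aestronglyMeasurable_apply (by fun_prop) h1
    have h3 : MeasurableSet {q : ℝ × ℝ | q.1 < q.2 ∧ q.2 ≤ sys.T} :=
      (measurableSet_lt measurable_fst measurable_snd).inter
        (measurableSet_le measurable_snd measurable_const)
    refine (h2.indicator h3).congr (ae_of_all _ fun q => ?_)
    simp [Function.uncurry, indicator_apply]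
  · rw [ae_restrict_iff' measurableSet_Ioc]
    exact ae_of_all _ fun σ hσ => sys.freeOp_coe hσ.1.le _

theorem convOp_afterOp_coe {t : ℝ} (ht : 0 ≤ t) (v : L2R H) :
    sys.convOp (afterOp t v) =ᵐ[volume] (Ioc t sys.T).indicator fun p =>
      ∫ σ in t..p, sys.Φ (p - σ) (v σ) := by
  filter_upwards [sys.convOp_coe (afterOp t v)] with p hp
  rw [hp]
  have h1 : ∫ σ in Ioc 0 sys.T, (Ioc σ sys.T).indicator
      (fun p => sys.Φ (p - σ) (afterOp t v σ)) p = ∫ σ in Ioc 0 sys.T,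
      (Ioi t).indicator (fun σ => (Ioc σ sys.T).indicator (fun p => sys.Φ (p - σ) (v σ)) p) σ := by
    refine integral_congr_ae (ae_restrict_of_ae ?_)
    filter_upwards [restrOp_coe (Ioi t) measurableSet_Ioi v] with σ hσ
    rw [afterOp, hσ]
    by_cases h : σ ∈ Ioi t
    · simp only [indicator_of_mem h]
    · simp only [indicator_of_notMem h]
      simp [indicator_apply]
  rw [h1, setIntegral_indicator measurableSet_Ioi]
  by_cases hp' : p ∈ Ioc t sys.T
  · rw [indicator_of_mem hp', intervalIntegral.integral_of_le hp'.1.le]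
    have h2 : ∀ σ, (Ioc σ sys.T).indicator (fun p => sys.Φ (p - σ) (v σ)) p =
        (Iio p).indicator (fun σ => sys.Φ (p - σ) (v σ)) σ := fun σ => by
      simp [indicator_apply, hp'.2]
    simp only [h2]
    rw [setIntegral_indicator measurableSet_Iio, integral_Ioc_eq_integral_Ioo]
    congr 2
    ext σ
    simp only [mem_inter_iff, mem_Ioc, mem_Ioi, mem_Iio, mem_Ioo]
    exact ⟨fun h => ⟨h.1.2, h.2⟩,
      fun h => ⟨⟨⟨ht.trans_lt h.1, (h.2.trans_le hp'.2).le⟩, h.1⟩, h.2⟩⟩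
  · rw [indicator_of_notMem hp']
    refine setIntegral_eq_zero_of_forall_eq_zero fun σ hσ => indicator_of_notMem ?_ _
    exact fun h => hp' ⟨(mem_Ioi.1 hσ.2).trans h.1, h.2⟩

/-- `C_t = L_t`, the input-to-state map for controls acting after the time `t`, extended by `0`
to controls on the line. -/
def inputOp (t : ℝ) : L2R U →L[ℂ] L2R H := sys.convOp ∘L sys.B.compLpL 2 volume ∘L afterOp t

theorem inputOp_apply (t : ℝ) (u : L2R U) :
    sys.inputOp t u = sys.convOp (afterOp t (sys.B.compLpL 2 volume u)) := by
  rw [afterOp, ← compLpL_restrOp]; rfl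

theorem adjoint_inputOp (t : ℝ) : (sys.inputOp t).adjoint =
    afterOp t ∘L sys.B.adjoint.compLpL 2 volume ∘L sys.convOp.adjoint := by
  symm
  rw [ContinuousLinearMap.eq_adjoint_iff]
  intro g u
  change inner ℂ (restrOp (Ioi t) measurableSet_Ioi
    (sys.B.adjoint.compLpL 2 volume (sys.convOp.adjoint g))) u =
    inner ℂ g (sys.convOp (sys.B.compLpL 2 volume (afterOp t u)))
  rw [inner_restrOp_comm, inner_compLpL_comm, ContinuousLinearMap.adjoint_inner_left]
  rfl

theorem strCont_inputOp : StrCont sys.inputOp :=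
  (strCont_afterOp.const_comp _).const_comp _

theorem strCont_adjoint_inputOp : StrCont fun t => (sys.inputOp t).adjoint := by
  simp only [adjoint_inputOp]
  exact strCont_afterOp.comp_const _

/-- Pointwise form of `C_t^*`: the adjoint control map evaluates `B^* F(·,σ)^*`. -/
theorem adjoint_inputOp_coe {t : ℝ} (ht : 0 ≤ t) (g : L2R H) :
    (sys.inputOp t).adjoint g =ᵐ[volume]
      (Ioc t sys.T).indicator fun σ => sys.B.adjoint ((sys.freeOp σ).adjoint g) := by
  have hc : Continuous fun σ => sys.B.adjoint ((sys.freeOp σ).adjoint g) :=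
    sys.B.adjoint.continuous.comp (sys.strCont_adjoint_freeOp g)
  have h1 := ofFun_coe (memLp_indicator_of_continuous hc t sys.T)
  suffices h : (sys.inputOp t).adjoint g = ofFun
      ((Ioc t sys.T).indicator fun σ => sys.B.adjoint ((sys.freeOp σ).adjoint g)) by
    rw [h]; exact h1
  refine ext_inner_right ℂ fun u => ?_
  rw [ContinuousLinearMap.adjoint_inner_left, inputOp_apply, inner_convOp, L2.inner_def]
  have h2 : ∫ σ in Ioc 0 sys.T, inner ℂ ((sys.freeOp σ).adjoint g)
      (afterOp t (sys.B.compLpL 2 volume u) σ) = ∫ σ in Ioc 0 sys.T,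
      (Ioi t).indicator (fun σ => inner ℂ (sys.B.adjoint ((sys.freeOp σ).adjoint g)) (u σ)) σ := by
    refine integral_congr_ae (ae_restrict_of_ae ?_)
    filter_upwards [restrOp_coe (Ioi t) measurableSet_Ioi (sys.B.compLpL 2 volume u),
      sys.B.coeFn_compLpL (p := 2) (μ := volume) u] with σ h3 h4
    rw [afterOp, h3]
    by_cases h : σ ∈ Ioi t
    · simp only [indicator_of_mem h]
      rw [h4, ContinuousLinearMap.adjoint_inner_left, ContinuousLinearMap.adjoint_inner_left,
        ContinuousLinearMap.adjoint_inner_left]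
    · simp only [indicator_of_notMem h, inner_zero_right]
  have h3 : ∫ σ, inner ℂ (ofFun ((Ioc t sys.T).indicator
      fun σ => sys.B.adjoint ((sys.freeOp σ).adjoint g)) σ) (u σ) = ∫ σ,
      (Ioc t sys.T).indicator
        (fun σ => inner ℂ (sys.B.adjoint ((sys.freeOp σ).adjoint g)) (u σ)) σ := by
    refine integral_congr_ae ?_
    filter_upwards [h1] with σ hσ
    rw [hσ]
    simp only [indicator_apply]
    split_ifs <;> simp
  rw [h2, h3, setIntegral_indicator measurableSet_Ioi, integral_indicator measurableSet_Ioc,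
    Ioc_inter_Ioi, sup_eq_right.2 ht]

theorem inner_adjoint_inputOp {t : ℝ} (ht : 0 ≤ t) (f g : L2R H) :
    inner ℂ ((sys.inputOp t).adjoint f) ((sys.inputOp t).adjoint g) =
      ∫ σ in Ioc t sys.T, inner ℂ (sys.B.adjoint ((sys.freeOp σ).adjoint f))
        (sys.B.adjoint ((sys.freeOp σ).adjoint g)) := by
  rw [L2.inner_def, ← integral_indicator measurableSet_Ioc]
  refine integral_congr_ae ?_
  filter_upwards [sys.adjoint_inputOp_coe ht f, sys.adjoint_inputOp_coe ht g] with σ h1 h2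
  rw [h1, h2]
  simp only [indicator_apply]
  split_ifs <;> simp

/-- The weight `Q` acting pointwise. -/
def weightOp : L2R H →L[ℂ] L2R H := sys.Q.compLpL 2 volume

theorem isPositive_weightOp : sys.weightOp.IsPositive := by
  rw [ContinuousLinearMap.isPositive_def]
  refine ⟨fun f g => ?_, fun f => ?_⟩
  · change inner ℂ (sys.Q.compLpL 2 volume f) g = inner ℂ f (sys.Q.compLpL 2 volume g)
    rw [← inner_compLpL_comm, sys.Q_pos.isSelfAdjoint.adjoint_eq]
  · rw [ContinuousLinearMap.reApplyInnerSelf_apply, L2.inner_def]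
    have h1 := L2.integrable_inner (𝕜 := ℂ) (sys.weightOp f) f
    have h2 : RCLike.re (∫ a, inner ℂ (sys.weightOp f a) (f a)) =
        ∫ a, RCLike.re (inner ℂ (sys.weightOp f a) (f a)) := (integral_re h1).symm
    rw [h2]
    refine integral_nonneg_of_ae ?_
    filter_upwards [sys.Q.coeFn_compLpL (p := 2) (μ := volume) f] with x hx
    rw [weightOp, hx]
    exact sys.Q_pos.re_inner_nonneg_left (f x)

/-- The cost operator `N_t` on trajectories of the uncontrolled system after the time `t`. -/
def cost (t : ℝ) : L2R H →L[ℂ] L2R H := costForm (sys.inputOp t) sys.weightOp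

theorem strCont_cost : StrCont sys.cost :=
  StrCont.costForm sys.strCont_inputOp sys.strCont_adjoint_inputOp sys.isPositive_weightOp

/-- The memory kernel as an element of `L²`. -/
def kernelClass : L2R ℂ := ofFun fun p => ((sys.K p : ℝ) : ℂ)

theorem kernelClass_coe : sys.kernelClass =ᵐ[volume] fun p => ((sys.K p : ℝ) : ℂ) :=
  ofFun_coe sys.memLp_K.ofReal

/-- `x ↦ K(· - s) x`. -/
def kernelOp (s : ℝ) : H →L[ℂ] L2R H := shiftOp s ∘L tensorOp sys.kernelClass

theorem strCont_kernelOp : StrCont sys.kernelOp := strCont_shift_comp _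

theorem strCont_adjoint_kernelOp : StrCont fun s => (sys.kernelOp s).adjoint :=
  strCont_adjoint_shift_comp _

theorem kernelOp_coe (s : ℝ) (x : H) :
    sys.kernelOp s x =ᵐ[volume] fun p => ((sys.K (p - s) : ℝ) : ℂ) • x := by
  refine shiftOp_coe_of_ae (f := tensorOp sys.kernelClass x)
    (g := fun p => ((sys.K p : ℝ) : ℂ) • x) ?_ s
  filter_upwards [tensorOp_coe sys.kernelClass x, sys.kernelClass_coe] with p h1 h2
  rw [h1, h2]

/-- `M(·,s,t)` as an operator `H → L²(ℝ;H)`. -/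
def memoryOp (t s : ℝ) : H →L[ℂ] L2R H := sys.convOp ∘L afterOp t ∘L sys.kernelOp s

theorem strCont_memoryOp (t : ℝ) : StrCont (sys.memoryOp t) :=
  (sys.strCont_kernelOp.const_comp _).const_comp _

theorem strCont_memoryOp_diag : StrCont fun σ => sys.memoryOp σ σ :=
  ((strCont_afterOp.comp sys.strCont_kernelOp).const_comp _)

theorem strCont_adjoint_memoryOp (t : ℝ) : StrCont fun s => (sys.memoryOp t s).adjoint := by
  have : ∀ s, (sys.memoryOp t s).adjoint =
      (sys.kernelOp s).adjoint ∘L (sys.convOp ∘L afterOp t).adjoint := fun s => by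
    rw [← ContinuousLinearMap.adjoint_comp]; rfl
  simp only [this]
  exact sys.strCont_adjoint_kernelOp.comp_const _

theorem memoryOp_coe {t : ℝ} (ht : 0 ≤ t) (s : ℝ) (x : H) :
    sys.memoryOp t s x =ᵐ[volume] (Ioc t sys.T).indicator fun p =>
      ∫ r in t..p, ((sys.K (r - s) : ℝ) : ℂ) • sys.Φ (p - r) x := by
  have h := sys.kernelOp_coe s x
  filter_upwards [sys.convOp_afterOp_coe ht (sys.kernelOp s x)] with p hp
  change sys.convOp (afterOp t (sys.kernelOp s x)) p = _
  rw [hp]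
  congr 1
  funext p
  refine intervalIntegral.integral_congr_ae ?_
  filter_upwards [h] with r hr _
  rw [hr, map_smul]

end MemorySystem

/-! ### Identification of the feedback operators and of the cost operators -/

namespace MemorySystem

variable {H U : Type*} [NormedAddCommGroup H] [InnerProductSpace ℂ H]
    [CompleteSpace H] [NormedAddCommGroup U] [InnerProductSpace ℂ U] [CompleteSpace U]
    {sys : MemorySystem H U} {S : ℝ → H →L[ℂ] H} {K : ℝ → ℝ}

/-- The operators `F` and `M` of a semigroup and a memory kernel are those of the system. -/
structure IsModel (sys : MemorySystem H U) (S : ℝ → H →L[ℂ] H) (K : ℝ → ℝ) : Prop where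
  FOp_eq : ∀ t τ, 0 ≤ τ → τ ≤ t → t ≤ sys.T → FOp S K t τ = sys.Φ (t - τ)
  MOp_eq : ∀ t σ τ, 0 ≤ σ → σ ≤ τ → τ ≤ t → t ≤ sys.T → ∀ x,
    MOp S K t σ τ x = ∫ r in τ..t, ((sys.K (r - σ) : ℝ) : ℂ) • sys.Φ (t - r) x

theorem inner_freeOp {σ : ℝ} (hσ : 0 ≤ σ) (x : H) (g : L2R H) :
    inner ℂ (sys.freeOp σ x) g = ∫ p in Ioc σ sys.T, inner ℂ (sys.Φ (p - σ) x) (g p) := by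
  rw [L2.inner_def, ← integral_indicator measurableSet_Ioc]
  refine integral_congr_ae ?_
  filter_upwards [sys.freeOp_coe hσ x] with p hp
  rw [hp]
  simp only [indicator_apply]
  split_ifs <;> simp

theorem IsModel.FOp_coe (h : IsModel sys S K) {t : ℝ} (ht : 0 ≤ t) (x : H) :
    (fun p => FOp S K p t x) =ᵐ[volume.restrict (Ioc t sys.T)] sys.freeOp t x := by
  filter_upwards [ae_restrict_of_ae (sys.freeOp_coe ht x), ae_restrict_mem measurableSet_Ioc]
    with p hp hp'
  rw [hp, indicator_of_mem hp', h.FOp_eq p t ht hp'.1.le hp'.2]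

theorem IsModel.MOp_coe (h : IsModel sys S K) {s t : ℝ} (hs : 0 ≤ s) (hst : s ≤ t) (x : H) :
    (fun p => MOp S K p s t x) =ᵐ[volume.restrict (Ioc t sys.T)] sys.memoryOp t s x := by
  filter_upwards [ae_restrict_of_ae (sys.memoryOp_coe (hs.trans hst) s x),
    ae_restrict_mem measurableSet_Ioc] with p hp hp'
  rw [hp, indicator_of_mem hp', h.MOp_eq p s t hs hst hp'.1.le hp'.2]

theorem IsModel.inputMap_coe (h : IsModel sys S K) {τ : ℝ} (hτ : 0 ≤ τ) {u : ℝ → U} {v : L2R U}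
    (huv : u =ᵐ[volume.restrict (Ioc τ sys.T)] v) :
    (fun p => inputMap S K sys.B τ u p) =ᵐ[volume.restrict (Ioc τ sys.T)] sys.inputOp τ v := by
  have h1 := sys.convOp_afterOp_coe hτ (sys.B.compLpL 2 volume v)
  filter_upwards [ae_restrict_of_ae h1, ae_restrict_mem measurableSet_Ioc] with p hp hp'
  rw [inputOp_apply, hp, indicator_of_mem hp', inputMap]
  refine intervalIntegral.integral_congr_ae ?_
  filter_upwards [(ae_restrict_iff' measurableSet_Ioc).1 huv,
    sys.B.coeFn_compLpL (p := 2) (μ := volume) v] with σ h2 h3 h4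
  rw [uIoc_of_le hp'.1.le] at h4
  rw [h3, h2 ⟨h4.1, h4.2.trans hp'.2⟩, h.FOp_eq p σ (hτ.trans h4.1.le) h4.2 hp'.2]

section Separable

variable [TopologicalSpace.SeparableSpace H]

theorem integrableOn_adjoint {σ : ℝ} (hσ : 0 ≤ σ) (g : L2R H) :
    IntegrableOn (fun p => (sys.Φ (p - σ)).adjoint (g p)) (Ioc σ sys.T) := by
  obtain ⟨C, hC0, hC⟩ := sys.exists_bound_Φ
  have hg := integrableOn_Lp_two g (measure_Ioc_lt_top (a := σ) (b := sys.T)).ne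
  refine Integrable.mono' (hg.norm.const_mul C) (aestronglyMeasurable_of_inner fun x => ?_) ?_
  · simp only [ContinuousLinearMap.adjoint_inner_right]
    exact AEStronglyMeasurable.inner
      (sys.strCont.aestronglyMeasurable_apply (f := fun _ => x) (by fun_prop) (by fun_prop))
      hg.aestronglyMeasurable
  · rw [ae_restrict_iff' measurableSet_Ioc]
    refine ae_of_all _ fun p hp => ContinuousLinearMap.le_of_opNorm_le _ ?_ _
    rw [LinearIsometryEquiv.norm_map]
    exact hC _ ⟨by linarith [hp.1], by linarith [hp.2]⟩

theorem adjoint_freeOp_apply {σ : ℝ} (hσ : 0 ≤ σ) (g : L2R H) :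
    (sys.freeOp σ).adjoint g = ∫ p in Ioc σ sys.T, (sys.Φ (p - σ)).adjoint (g p) := by
  refine ext_inner_left ℂ fun x => ?_
  rw [ContinuousLinearMap.adjoint_inner_right, inner_freeOp hσ,
    ← integral_inner (integrableOn_adjoint hσ g)]
  simp only [ContinuousLinearMap.adjoint_inner_right]

/-- The adjoint input map evaluated at the time `σ` is `B^* F(·,σ)^*`. -/
theorem IsModel.inputMapAdj_eq (h : IsModel sys S K) {σ : ℝ} (hσ : σ ∈ Icc 0 sys.T) {f : ℝ → H}
    {g : L2R H} (hfg : f =ᵐ[volume.restrict (Ioc σ sys.T)] g) :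
    inputMapAdj sys.T S K sys.B f σ = sys.B.adjoint ((sys.freeOp σ).adjoint g) := by
  rw [adjoint_freeOp_apply hσ.1, ← ContinuousLinearMap.integral_comp_comm _
    (integrableOn_adjoint hσ.1 g), inputMapAdj, intervalIntegral.integral_of_le hσ.2]
  refine integral_congr_ae ?_
  filter_upwards [hfg, ae_restrict_mem measurableSet_Ioc] with p hp hp'
  rw [hp, h.FOp_eq p σ hσ.1 hp'.1.le hp'.2]

theorem weight_coe {f : ℝ → H} {g : L2R H} {τ : ℝ}
    (hfg : f =ᵐ[volume.restrict (Ioc τ sys.T)] g) :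
    (fun p => sys.Q (f p)) =ᵐ[volume.restrict (Ioc τ sys.T)] sys.weightOp g := by
  filter_upwards [hfg, ae_restrict_of_ae (sys.Q.coeFn_compLpL (p := 2) (μ := volume) g)]
    with p h1 h2
  rw [h1, weightOp, h2]

theorem ae_restrict_mono_left {p : ℝ → Prop} {τ σ : ℝ} (hσ : τ ≤ σ)
    (h : ∀ᵐ x ∂volume.restrict (Ioc τ sys.T), p x) : ∀ᵐ x ∂volume.restrict (Ioc σ sys.T), p x :=
  ae_restrict_of_ae_restrict_of_subset (Ioc_subset_Ioc_left hσ) h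

/-- The optimality system in pointwise form: `Λ_τ⁻¹ L_τ^* Q y` at the time `σ` is
`B^* F(·,σ)^* N_τ y`. -/
theorem IsModel.lambdaInv_eq (h : IsModel sys S K) {τ : ℝ} (hτ : τ ∈ Icc 0 sys.T) {y : ℝ → H}
    {v : L2R H} (hyv : y =ᵐ[volume.restrict (Ioc τ sys.T)] v) {σ : ℝ} (hσ : σ ∈ Icc τ sys.T) :
    lambdaInv sys.T S K sys.B sys.Q τ (inputMapAdj sys.T S K sys.B fun p => sys.Q (y p)) σ =
      sys.B.adjoint ((sys.freeOp σ).adjoint (sys.cost τ v)) := by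
  have hQ := sys.isPositive_weightOp
  have hg : ∀ σ ∈ Icc τ sys.T, inputMapAdj sys.T S K sys.B (fun p => sys.Q (y p)) σ =
      sys.B.adjoint ((sys.freeOp σ).adjoint (sys.weightOp v)) := fun σ hσ =>
    h.inputMapAdj_eq ⟨hτ.1.trans hσ.1, hσ.2⟩ (ae_restrict_mono_left hσ.1 (weight_coe hyv))
  have hL : ∀ {u : ℝ → U} {w : L2R U}, u =ᵐ[volume.restrict (Ioc τ sys.T)] w →
      ∀ σ ∈ Icc τ sys.T, inputMapAdj sys.T S K sys.B
        (fun p => sys.Q (inputMap S K sys.B τ u p)) σ =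
      sys.B.adjoint ((sys.freeOp σ).adjoint (sys.weightOp (sys.inputOp τ w))) :=
    fun huw σ hσ => h.inputMapAdj_eq ⟨hτ.1.trans hσ.1, hσ.2⟩
      (ae_restrict_mono_left hσ.1 (weight_coe (h.inputMap_coe hτ.1 huw)))
  -- every solution of the equation is the one claimed
  have huniq : ∀ u, IsLambdaSolution sys.T S K sys.B sys.Q τ
      (inputMapAdj sys.T S K sys.B fun p => sys.Q (y p)) u → ∀ σ ∈ Icc τ sys.T,
      u σ = sys.B.adjoint ((sys.freeOp σ).adjoint (sys.cost τ v)) := by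
    rintro u ⟨hu1, hu2, -⟩
    have hmem : MemLp ((Ioc τ sys.T).indicator u) 2 volume :=
      (memLp_indicator_iff_restrict measurableSet_Ioc).2 hu1
    have hw := ofFun_coe hmem
    set w : L2R U := ofFun ((Ioc τ sys.T).indicator u)
    have huw : u =ᵐ[volume.restrict (Ioc τ sys.T)] w := by
      filter_upwards [ae_restrict_of_ae hw, ae_restrict_mem measurableSet_Ioc] with p hp hp'
      rw [hp, indicator_of_mem hp']
    have hu3 : ∀ σ ∈ Icc τ sys.T, u σ = sys.B.adjoint ((sys.freeOp σ).adjoint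
        (sys.weightOp (v - sys.inputOp τ w))) := fun σ hσ => by
      have := hu2 σ hσ
      rw [hg σ hσ, hL huw σ hσ] at this
      rw [map_sub, map_sub, map_sub, ← this, add_sub_cancel_right]
    have hw2 : w = (sys.inputOp τ).adjoint (sys.weightOp (v - sys.inputOp τ w)) := by
      refine Lp.ext ?_
      filter_upwards [hw, sys.adjoint_inputOp_coe hτ.1
        (sys.weightOp (v - sys.inputOp τ w))] with p h1 h2
      rw [h1, h2]
      simp only [indicator_apply]
      split_ifs with hp
      · exact hu3 p ⟨hp.1.le, hp.2⟩
      · rfl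
    have hw3 : w = (sys.inputOp τ).adjoint (sys.cost τ v) := by
      refine eq_adjoint_costForm hQ ?_
      rw [map_sub, map_sub] at hw2
      exact eq_sub_iff_add_eq.1 hw2
    intro σ hσ
    rw [hu3 σ hσ, hw3]
    congr 2
    exact (costForm_apply_eq hQ v).symm
  have hex : ∃ u, IsLambdaSolution sys.T S K sys.B sys.Q τ
      (inputMapAdj sys.T S K sys.B fun p => sys.Q (y p)) u := by
    refine ⟨(Icc τ sys.T).indicator fun σ =>
      sys.B.adjoint ((sys.freeOp σ).adjoint (sys.cost τ v)), ?_, ?_, ?_⟩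
    · have hc : Continuous fun σ => sys.B.adjoint ((sys.freeOp σ).adjoint (sys.cost τ v)) :=
        sys.B.adjoint.continuous.comp (sys.strCont_adjoint_freeOp _)
      refine ((memLp_indicator_iff_restrict measurableSet_Ioc).1
        (memLp_indicator_of_continuous hc τ sys.T)).ae_eq ?_
      filter_upwards [ae_restrict_mem measurableSet_Ioc] with p hp
      rw [indicator_of_mem (Ioc_subset_Icc_self hp)]
    · have huw : ((Icc τ sys.T).indicator fun σ =>
          sys.B.adjoint ((sys.freeOp σ).adjoint (sys.cost τ v)))
          =ᵐ[volume.restrict (Ioc τ sys.T)] (sys.inputOp τ).adjoint (sys.cost τ v) := by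
        filter_upwards [ae_restrict_of_ae (sys.adjoint_inputOp_coe hτ.1 (sys.cost τ v)),
          ae_restrict_mem measurableSet_Ioc] with p h1 h2
        rw [h1, indicator_of_mem h2, indicator_of_mem (Ioc_subset_Icc_self h2)]
      intro σ hσ
      rw [hg σ hσ, hL huw σ hσ, indicator_of_mem hσ, ← map_add, ← map_add]
      congr 2
      have := costForm_apply_eq (C := sys.inputOp τ) hQ v
      rw [map_sub, eq_sub_iff_add_eq] at this
      exact this
    · exact fun σ hσ => indicator_of_notMem hσ _
  rw [lambdaInv, dif_pos hex]
  exact huniq _ hex.choose_spec σ hσ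

/-- The operator `x ↦ -B^* F(·,p)^* N_t (Y x)`: the optimal control at the time `p` if the
uncontrolled trajectory after the time `t` is `Y x`. -/
def feedbackOp (sys : MemorySystem H U) (t : ℝ) (Y : H →L[ℂ] L2R H) (p : ℝ) : H →L[ℂ] U :=
  -(sys.B.adjoint ∘L (sys.freeOp p).adjoint ∘L sys.cost t ∘L Y)

theorem strCont_feedbackOp (t : ℝ) (Y : H →L[ℂ] L2R H) : StrCont (sys.feedbackOp t Y) := by
  intro x
  exact (sys.B.adjoint.continuous.comp (sys.strCont_adjoint_freeOp _)).neg

theorem IsModel.Psi1_eq (h : IsModel sys S K) {t p : ℝ} (ht : 0 ≤ t) (htp : t ≤ p)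
    (hp : p ≤ sys.T) :
    Psi1 sys.T S K sys.B sys.Q p t = sys.feedbackOp t (sys.freeOp t) p :=
  opOf_apply _ fun x => congrArg Neg.neg
    (h.lambdaInv_eq ⟨ht, htp.trans hp⟩ (h.FOp_coe ht x) ⟨htp, hp⟩).symm

theorem IsModel.Psi2_eq (h : IsModel sys S K) {s t p : ℝ} (hs : 0 ≤ s) (hst : s ≤ t)
    (htp : t ≤ p) (hp : p ≤ sys.T) :
    Psi2 sys.T S K sys.B sys.Q p s t = sys.feedbackOp t (sys.memoryOp t s) p :=
  opOf_apply _ fun x => congrArg Neg.neg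
    (h.lambdaInv_eq ⟨hs.trans hst, htp.trans hp⟩ (h.MOp_coe hs hst x) ⟨htp, hp⟩).symm

/-- An optimal pair of operator functions on `[t,T]`: `Ψ` is the optimal control and `Z` the
optimal state for the uncontrolled trajectories `Y x`. -/
structure IsOptimalPair (sys : MemorySystem H U) (t : ℝ) (Y : H →L[ℂ] L2R H)
    (Ψ : ℝ → H →L[ℂ] U) (Z : ℝ → H →L[ℂ] H) : Prop where
  control_eq : ∀ p ∈ Ioc t sys.T, Ψ p = sys.feedbackOp t Y p
  state_eq : ∀ x, (fun p => Z p x) =ᵐ[volume.restrict (Ioc t sys.T)]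
    (Y x - sys.inputOp t ((sys.inputOp t).adjoint (sys.cost t (Y x))) : L2R H)
  support : ∀ x, ∀ᵐ p, p ∉ Ioc t sys.T → Y x p = 0
  bound : ∃ C, ∀ p ∈ Ioc t sys.T, ‖Z p‖ ≤ C

theorem IsModel.isOptimalPair (h : IsModel sys S K) {t : ℝ} (ht : t ∈ Icc 0 sys.T)
    {Y : H →L[ℂ] L2R H} {Ψ : ℝ → H →L[ℂ] U} {Y₀ : ℝ → H →L[ℂ] H}
    (hΨ : ∀ p ∈ Icc t sys.T, Ψ p = sys.feedbackOp t Y p)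
    (hY : ∀ x, (fun p => Y₀ p x) =ᵐ[volume.restrict (Ioc t sys.T)] Y x)
    (hs : ∀ x, ∀ᵐ p, p ∉ Ioc t sys.T → Y x p = 0)
    (hb : ∃ C, ∀ p ∈ Ioc t sys.T, ‖Y₀ p‖ ≤ C) :
    sys.IsOptimalPair t Y Ψ
      (fun p => Y₀ p + strongInt (fun σ => FOp S K p σ ∘L sys.B ∘L Ψ σ) t p) := by
  have hsc : ∀ p, StrCont fun σ => sys.Φ (p - σ) ∘L sys.B ∘L sys.feedbackOp t Y σ := fun p =>
    (sys.strCont.reparam (continuous_const.sub continuous_id)).comp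
      ((strCont_feedbackOp t Y).const_comp sys.B)
  have hint : ∀ p ∈ Ioc t sys.T, strongInt (fun σ => FOp S K p σ ∘L sys.B ∘L Ψ σ) t p =
      strongInt (fun σ => sys.Φ (p - σ) ∘L sys.B ∘L sys.feedbackOp t Y σ) t p := by
    intro p hp
    refine strongInt_congr ?_
    rw [uIoc_of_le hp.1.le, ae_restrict_iff' measurableSet_Ioc]
    refine ae_of_all _ fun σ hσ => ?_
    rw [h.FOp_eq p σ (ht.1.trans hσ.1.le) hσ.2 hp.2, hΨ σ ⟨hσ.1.le, hσ.2.trans hp.2⟩]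
  refine ⟨fun p hp => hΨ p ⟨hp.1.le, hp.2⟩, fun x => ?_, hs, ?_⟩
  · have h1 := sys.convOp_afterOp_coe ht.1 (sys.B.compLpL 2 volume
      ((sys.inputOp t).adjoint (sys.cost t (Y x))))
    rw [← inputOp_apply] at h1
    filter_upwards [hY x, ae_restrict_of_ae h1, ae_restrict_mem measurableSet_Ioc,
      ae_restrict_of_ae (Lp.coeFn_sub (Y x)
        (sys.inputOp t ((sys.inputOp t).adjoint (sys.cost t (Y x)))))] with p h2 h3 h4 h5
    rw [h5, Pi.sub_apply, h3, indicator_of_mem h4, _root_.add_apply, h2, hint p h4,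
      strongInt_apply_of_strCont (hsc p), sub_eq_add_neg, ← intervalIntegral.integral_neg]
    congr 1
    refine intervalIntegral.integral_congr_ae ?_
    filter_upwards [sys.adjoint_inputOp_coe ht.1 (sys.cost t (Y x)),
      sys.B.coeFn_compLpL (p := 2) (μ := volume)
        ((sys.inputOp t).adjoint (sys.cost t (Y x)))] with σ h6 h7 h8
    rw [uIoc_of_le h4.1.le] at h8
    rw [h7, h6, indicator_of_mem (show σ ∈ Ioc t sys.T from ⟨h8.1, h8.2.trans h4.2⟩)]
    simp [feedbackOp]
  · obtain ⟨C, hC⟩ := hb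
    obtain ⟨c₁, hc₁0, hc₁⟩ := sys.exists_bound_Φ
    obtain ⟨c₂, hc₂0, hc₂⟩ := (strCont_feedbackOp (sys := sys) t Y).exists_bound t sys.T
    refine ⟨C + c₁ * (‖sys.B‖ * c₂) * (sys.T - t), fun p hp => ?_⟩
    refine (norm_add_le _ _).trans (add_le_add (hC p hp) ?_)
    rw [hint p hp]
    have hi : ∫ _ in t..p, c₁ * (‖sys.B‖ * c₂) = c₁ * (‖sys.B‖ * c₂) * (p - t) := by
      rw [intervalIntegral.integral_const, smul_eq_mul, mul_comm]
    have h0 : 0 ≤ c₁ * (‖sys.B‖ * c₂) := by positivity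
    refine (norm_strongInt_le (c := fun _ => c₁ * (‖sys.B‖ * c₂)) hp.1.le
      (fun x => (hsc p x).aestronglyMeasurable) intervalIntegrable_const ?_ ?_).trans ?_
    · rw [uIoc_of_le hp.1.le, ae_restrict_iff' measurableSet_Ioc]
      refine ae_of_all _ fun σ hσ => (ContinuousLinearMap.opNorm_comp_le _ _).trans ?_
      refine mul_le_mul (hc₁ _ ⟨by linarith [hσ.2], by linarith [hσ.1, hp.2, ht.1]⟩) ?_
        (norm_nonneg _) hc₁0
      exact (ContinuousLinearMap.opNorm_comp_le _ _).trans (mul_le_mul_of_nonneg_left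
        (hc₂ σ ⟨hσ.1.le, hσ.2.trans hp.2⟩) (norm_nonneg _))
    · rw [hi]
      exact mul_nonneg h0 (by linarith [hp.1])
    · rw [hi]
      exact mul_le_mul_of_nonneg_left (by linarith [hp.2]) h0

theorem IsModel.isOptimalPair_one (h : IsModel sys S K) {t : ℝ} (ht : t ∈ Icc 0 sys.T) :
    sys.IsOptimalPair t (sys.freeOp t) (fun p => Psi1 sys.T S K sys.B sys.Q p t)
      (fun p => Z1 sys.T S K sys.B sys.Q p t) := by
  refine h.isOptimalPair ht (fun p hp => h.Psi1_eq ht.1 hp.1 hp.2) (h.FOp_coe ht.1)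
    (fun x => ?_) ?_
  · filter_upwards [sys.freeOp_coe ht.1 x] with p hp hp'
    rw [hp, indicator_of_notMem hp']
  obtain ⟨C, hC0, hC⟩ := sys.exists_bound_Φ
  refine ⟨C, fun p hp => ?_⟩
  rw [h.FOp_eq p t ht.1 hp.1.le hp.2]
  exact hC _ ⟨by linarith [hp.1], by linarith [hp.2, ht.1]⟩

theorem intervalIntegrable_K (s a b : ℝ) : IntervalIntegrable (fun r => sys.K (r - s)) volume a b := by
  have h1 : MemLp (fun r => sys.K (r - s)) 2 volume :=
    sys.memLp_K.comp_measurePreserving (measurePreserving_sub_right volume s)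
  rw [intervalIntegrable_iff]
  have h2 : MemLp (fun r => sys.K (r - s)) 2 (volume.restrict (uIoc a b)) := h1.restrict _
  have : IsFiniteMeasure (volume.restrict (uIoc a b)) := by
    rw [uIoc]; infer_instance
  exact h2.integrable (by norm_num)

theorem IsModel.isOptimalPair_two (h : IsModel sys S K) {s t : ℝ} (ht : t ∈ Icc 0 sys.T)
    (hs : s ∈ Icc 0 t) :
    sys.IsOptimalPair t (sys.memoryOp t s) (fun p => Psi2 sys.T S K sys.B sys.Q p s t)
      (fun p => Z2 sys.T S K sys.B sys.Q p s t) := by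
  refine h.isOptimalPair ht (fun p hp => h.Psi2_eq hs.1 hs.2 hp.1 hp.2) (h.MOp_coe hs.1 hs.2)
    (fun x => ?_) ?_
  · filter_upwards [sys.memoryOp_coe ht.1 s x] with p hp hp'
    rw [hp, indicator_of_notMem hp']
  obtain ⟨C, hC0, hC⟩ := sys.exists_bound_Φ
  have hKi := (intervalIntegrable_K (sys := sys) s t sys.T).norm.mul_const C
  refine ⟨∫ r in t..sys.T, ‖sys.K (r - s)‖ * C, fun p hp => ?_⟩
  refine ContinuousLinearMap.opNorm_le_bound _ (intervalIntegral.integral_nonneg ht.2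
    fun r _ => by positivity) fun x => ?_
  rw [h.MOp_eq p s t hs.1 hs.2 hp.1.le hp.2, ← intervalIntegral.integral_mul_const]
  have hKi' : IntervalIntegrable (fun r => ‖sys.K (r - s)‖ * C * ‖x‖) volume t sys.T :=
    hKi.mul_const _
  have hKp : IntervalIntegrable (fun r => ‖sys.K (r - s)‖ * C * ‖x‖) volume t p :=
    ((intervalIntegrable_K (sys := sys) s t p).norm.mul_const C).mul_const _
  refine (intervalIntegral.norm_integral_le_of_norm_le hp.1.le (ae_of_all _ fun r hr => ?_)
    hKp).trans ?_
  · rw [norm_smul, Complex.norm_real, mul_assoc]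
    refine mul_le_mul_of_nonneg_left (ContinuousLinearMap.le_of_opNorm_le _ (hC _ ?_) _)
      (norm_nonneg _)
    exact ⟨by linarith [hr.2], by linarith [hr.1, hp.2, ht.1]⟩
  · refine intervalIntegral.integral_mono_interval le_rfl hp.1.le hp.2 ?_ hKi'
    exact ae_of_all _ fun r => by positivity

/-- The cost pairing of two optimal pairs. -/
theorem IsOptimalPair.strongInt_eq {t : ℝ} (ht : t ∈ Icc 0 sys.T) {Ya Yb : H →L[ℂ] L2R H}
    {Ψa Ψb : ℝ → H →L[ℂ] U} {Za Zb : ℝ → H →L[ℂ] H} (ha : sys.IsOptimalPair t Ya Ψa Za)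
    (hb : sys.IsOptimalPair t Yb Ψb Zb) :
    strongInt (fun p => (Ψa p).adjoint ∘L Ψb p + (Za p).adjoint ∘L sys.Q ∘L Zb p) t sys.T =
      Ya.adjoint ∘L sys.cost t ∘L Yb := by
  have hΨ : ∀ {Y : H →L[ℂ] L2R H} {Ψ : ℝ → H →L[ℂ] U} {Z : ℝ → H →L[ℂ] H},
      sys.IsOptimalPair t Y Ψ Z → ∀ x, AEStronglyMeasurable (fun p => Ψ p x)
      (volume.restrict (Ioc t sys.T)) := fun {Y Ψ Z} hp x => by
    refine AEStronglyMeasurable.congr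
      (strCont_feedbackOp (sys := sys) t Y x).aestronglyMeasurable ?_
    filter_upwards [ae_restrict_mem measurableSet_Ioc] with p hp'
    rw [hp.control_eq p hp']
  have hZ : ∀ {Y : H →L[ℂ] L2R H} {Ψ : ℝ → H →L[ℂ] U} {Z : ℝ → H →L[ℂ] H},
      sys.IsOptimalPair t Y Ψ Z → ∀ x, AEStronglyMeasurable (fun p => Z p x)
      (volume.restrict (Ioc t sys.T)) := fun {Y Ψ Z} hp x =>
    ((Lp.aestronglyMeasurable _).restrict).congr (hp.state_eq x).symm
  have hm : ∀ x, AEStronglyMeasurable (fun p =>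
      ((Ψa p).adjoint ∘L Ψb p + (Za p).adjoint ∘L sys.Q ∘L Zb p) x)
      (volume.restrict (uIoc t sys.T)) := fun x => by
    rw [uIoc_of_le ht.2]
    refine aestronglyMeasurable_of_inner fun x' => ?_
    simp only [_root_.add_apply, ContinuousLinearMap.comp_apply, inner_add_right,
      ContinuousLinearMap.adjoint_inner_right]
    exact ((hΨ ha x').inner (hΨ hb x)).add
      ((hZ ha x').inner (sys.Q.continuous.comp_aestronglyMeasurable (hZ hb x)))
  obtain ⟨Ca, hCa⟩ := ha.bound
  obtain ⟨Cb, hCb⟩ := hb.bound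
  obtain ⟨ca, hca0, hca⟩ := (strCont_feedbackOp (sys := sys) t Ya).exists_bound t sys.T
  obtain ⟨cb, hcb0, hcb⟩ := (strCont_feedbackOp (sys := sys) t Yb).exists_bound t sys.T
  have hbd : ∀ p ∈ uIoc t sys.T,
      ‖(Ψa p).adjoint ∘L Ψb p + (Za p).adjoint ∘L sys.Q ∘L Zb p‖ ≤
        ca * cb + Ca * (‖sys.Q‖ * Cb) := by
    intro p hp
    rw [uIoc_of_le ht.2] at hp
    have hp' : p ∈ Icc t sys.T := ⟨hp.1.le, hp.2⟩
    have hCa0 : 0 ≤ Ca := (norm_nonneg _).trans (hCa p hp)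
    have h1 : ‖(Ψa p).adjoint ∘L Ψb p‖ ≤ ca * cb := by
      refine (ContinuousLinearMap.opNorm_comp_le _ _).trans ?_
      rw [LinearIsometryEquiv.norm_map, ha.control_eq p hp, hb.control_eq p hp]
      exact mul_le_mul (hca p hp') (hcb p hp') (norm_nonneg _) hca0
    have h2 : ‖(Za p).adjoint ∘L sys.Q ∘L Zb p‖ ≤ Ca * (‖sys.Q‖ * Cb) := by
      refine (ContinuousLinearMap.opNorm_comp_le _ _).trans ?_
      rw [LinearIsometryEquiv.norm_map]
      refine mul_le_mul (hCa p hp) ((ContinuousLinearMap.opNorm_comp_le _ _).trans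
        (mul_le_mul_of_nonneg_left (hCb p hp) (norm_nonneg _))) (norm_nonneg _) hCa0
    exact (norm_add_le _ _).trans (add_le_add h1 h2)
  ext x
  rw [strongInt_apply_of_bound hm hbd, intervalIntegral.integral_of_le ht.2]
  rw [uIoc_of_le ht.2] at hm hbd
  have hi : IntegrableOn (fun p =>
      ((Ψa p).adjoint ∘L Ψb p + (Za p).adjoint ∘L sys.Q ∘L Zb p) x) (Ioc t sys.T) := by
    refine Integrable.mono' (integrable_const ((ca * cb + Ca * (‖sys.Q‖ * Cb)) * ‖x‖)) (hm x) ?_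
    rw [ae_restrict_iff' measurableSet_Ioc]
    exact ae_of_all _ fun p hp => ContinuousLinearMap.le_of_opNorm_le _ (hbd p hp) x
  refine ext_inner_left ℂ fun x' => ?_
  rw [← integral_inner hi]
  change _ = inner ℂ x' (Ya.adjoint (sys.cost t (Yb x)))
  rw [ContinuousLinearMap.adjoint_inner_right]
  have hform := inner_costForm (C := sys.inputOp t) sys.isPositive_weightOp (Ya x') (Yb x)
  change inner ℂ (Ya x') (sys.cost t (Yb x)) = inner ℂ
    ((sys.inputOp t).adjoint (sys.cost t (Ya x')))
    ((sys.inputOp t).adjoint (sys.cost t (Yb x))) + inner ℂ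
    (Ya x' - sys.inputOp t ((sys.inputOp t).adjoint (sys.cost t (Ya x')))) (sys.weightOp
    (Yb x - sys.inputOp t ((sys.inputOp t).adjoint (sys.cost t (Yb x))))) at hform
  set wa := Ya x' - sys.inputOp t ((sys.inputOp t).adjoint (sys.cost t (Ya x'))) with hwa
  set wb := Yb x - sys.inputOp t ((sys.inputOp t).adjoint (sys.cost t (Yb x))) with hwb
  have hsupp : ∀ᵐ p, p ∉ Ioc t sys.T → wa p = 0 := by
    have h1 := sys.convOp_afterOp_coe ht.1 (sys.B.compLpL 2 volume
      ((sys.inputOp t).adjoint (sys.cost t (Ya x'))))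
    rw [← inputOp_apply] at h1
    filter_upwards [ha.support x', h1, Lp.coeFn_sub (Ya x')
      (sys.inputOp t ((sys.inputOp t).adjoint (sys.cost t (Ya x'))))] with p h2 h3 h4 hp
    rw [hwa, h4, Pi.sub_apply, h2 hp, h3, indicator_of_notMem hp, sub_zero]
  have hint1 : IntegrableOn (fun p => inner ℂ (sys.B.adjoint ((sys.freeOp p).adjoint
      (sys.cost t (Ya x')))) (sys.B.adjoint ((sys.freeOp p).adjoint (sys.cost t (Yb x)))))
      (Ioc t sys.T) := by
    refine Continuous.integrableOn_Ioc (Continuous.inner ?_ ?_) <;>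
    exact sys.B.adjoint.continuous.comp (sys.strCont_adjoint_freeOp _)
  have hint2 : Integrable (fun p => inner ℂ (wa p) (sys.weightOp wb p)) :=
    L2.integrable_inner wa (sys.weightOp wb)
  have hset : ∫ p, inner ℂ (wa p) (sys.weightOp wb p) =
      ∫ p in Ioc t sys.T, inner ℂ (wa p) (sys.weightOp wb p) := by
    symm
    refine setIntegral_eq_integral_of_ae_compl_eq_zero ?_
    filter_upwards [hsupp] with p hp hp'
    rw [hp hp', inner_zero_left]
  rw [hform, sys.inner_adjoint_inputOp ht.1, L2.inner_def, hset,
    ← integral_add hint1 hint2.integrableOn]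
  refine integral_congr_ae ?_
  filter_upwards [ae_restrict_mem measurableSet_Ioc, ha.state_eq x', hb.state_eq x,
    ae_restrict_of_ae (sys.Q.coeFn_compLpL (p := 2) (μ := volume) wb)] with p hp h1 h2 h3
  rw [weightOp, h3, ← hwa, ← hwb] at *
  rw [← h1, ← h2]
  simp only [_root_.add_apply, ContinuousLinearMap.comp_apply, inner_add_right,
    ContinuousLinearMap.adjoint_inner_right, ha.control_eq p hp, hb.control_eq p hp, feedbackOp,
    _root_.neg_apply, inner_neg_neg]

theorem IsModel.P0_eq (h : IsModel sys S K) {t : ℝ} (ht : t ∈ Icc 0 sys.T) :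
    P0 sys.T S K sys.B sys.Q t = (sys.freeOp t).adjoint ∘L sys.cost t ∘L sys.freeOp t :=
  (h.isOptimalPair_one ht).strongInt_eq ht (h.isOptimalPair_one ht)

theorem IsModel.P1_eq (h : IsModel sys S K) {t s : ℝ} (ht : t ∈ Icc 0 sys.T) (hs : s ∈ Icc 0 t) :
    P1 sys.T S K sys.B sys.Q t s = (sys.freeOp t).adjoint ∘L sys.cost t ∘L sys.memoryOp t s :=
  (h.isOptimalPair_one ht).strongInt_eq ht (h.isOptimalPair_two ht hs)

theorem IsModel.P2_eq (h : IsModel sys S K) {t s q : ℝ} (ht : t ∈ Icc 0 sys.T) (hs : s ∈ Icc 0 t) (hq : q ∈ Icc 0 t) :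
    P2 sys.T S K sys.B sys.Q t s q =
      (sys.memoryOp t q).adjoint ∘L sys.cost t ∘L sys.memoryOp t s :=
  (h.isOptimalPair_two ht hq).strongInt_eq ht (h.isOptimalPair_two ht hs)

end Separable

end MemorySystem

/-! ### The cost operator on the product space -/

section ProductSpace

variable {H : Type*} [NormedAddCommGroup H] [InnerProductSpace ℂ H] [CompleteSpace H] {t : ℝ}

theorem toHist_coe {g : ℝ → H} (hg : MemLp g 2 (volume.restrict (Ioc (0 : ℝ) t))) :
    toHist t g =ᵐ[volume.restrict (Ioc (0 : ℝ) t)] g := by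
  rw [toHist, dif_pos hg]
  exact hg.coeFn_toLp

theorem toHist_self (f : HistSpace H t) : toHist t f = f :=
  Lp.ext (toHist_coe (Lp.memLp f))

theorem toHist_congr {g h : ℝ → H} (hgh : g =ᵐ[volume.restrict (Ioc (0 : ℝ) t)] h) :
    toHist t g = toHist t h := by
  by_cases hg : MemLp g 2 (volume.restrict (Ioc (0 : ℝ) t))
  · exact Lp.ext ((toHist_coe hg).trans (hgh.trans (toHist_coe (hg.ae_eq hgh)).symm))
  · have hh : ¬ MemLp h 2 (volume.restrict (Ioc (0 : ℝ) t)) := fun hh => hg (hh.ae_eq hgh.symm)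
    rw [toHist, toHist, dif_neg hg, dif_neg hh]

theorem toHist_zero : toHist t (0 : ℝ → H) = 0 := by
  rw [toHist, dif_pos MemLp.zero]; exact MemLp.toLp_zero _

theorem mkY_fst (x : H) (g : ℝ → H) : (mkY t x g).fst = x := rfl

theorem mkY_snd (x : H) (g : ℝ → H) : (mkY t x g).snd = toHist t g := rfl

theorem ySpace_ext {X Y : YSpace H t} (h1 : X.fst = Y.fst) (h2 : X.snd = Y.snd) : X = Y :=
  WithLp.ofLp_injective 2 (Prod.ext h1 h2)

theorem inner_ySpace (X Y : YSpace H t) :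
    inner ℂ X Y = inner ℂ X.fst Y.fst + inner ℂ X.snd Y.snd := WithLp.prod_inner_apply _ _

theorem memLp_hist_of_continuousOn {g : ℝ → H} (hg : ContinuousOn g (Icc 0 t)) :
    MemLp g 2 (volume.restrict (Ioc (0 : ℝ) t)) := by
  obtain ⟨C, hC⟩ := isCompact_Icc.exists_bound_of_continuousOn hg
  refine MemLp.of_bound
    ((hg.mono Ioc_subset_Icc_self).aestronglyMeasurable measurableSet_Ioc) C ?_
  rw [ae_restrict_iff' measurableSet_Ioc]
  exact ae_of_all _ fun s hs => hC s ⟨hs.1.le, hs.2⟩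

theorem embedY_fst {τ : ℝ} (X : YSpace H τ) : (embedY τ t X).fst = X.fst := by
  rw [embedY, mkY_fst]

theorem embedY_snd_coe {τ : ℝ} (h : τ ≤ t) (X : YSpace H τ) :
    (embedY τ t X).snd =ᵐ[volume.restrict (Ioc (0 : ℝ) t)] (Ioc 0 τ).indicator X.snd := by
  refine toHist_coe ?_
  rw [memLp_indicator_iff_restrict measurableSet_Ioc, Measure.restrict_restrict measurableSet_Ioc,
    inter_eq_left.2 (Ioc_subset_Ioc_right h)]
  exact Lp.memLp X.snd

end ProductSpace

namespace MemorySystem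

variable {H U : Type*} [NormedAddCommGroup H] [InnerProductSpace ℂ H] [CompleteSpace H]
    [NormedAddCommGroup U] [InnerProductSpace ℂ U] [CompleteSpace U]
    (sys : MemorySystem H U) {S : ℝ → H →L[ℂ] H} {K : ℝ → ℝ}

/-- The forcing `p ↦ ∫₀ᵗ K(p - s) f(s) ds` produced by a history `f` on `(0,t]`. -/
def histOp (t : ℝ) : HistSpace H t →L[ℂ] L2R H :=
  synthOp (volume.restrict (Ioc 0 t)) t sys.kernelOp sys.strCont_kernelOp

/-- The uncontrolled trajectory after the time `t` for the initial datum `(x, f)`. -/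
def trajOp (t : ℝ) : YSpace H t →L[ℂ] L2R H :=
  sys.freeOp t ∘L WithLp.fstL 2 ℂ H (HistSpace H t) +
    (sys.convOp ∘L afterOp t ∘L sys.histOp t) ∘L WithLp.sndL 2 ℂ H (HistSpace H t)

theorem histOp_apply (t : ℝ) (f : HistSpace H t) :
    sys.histOp t f = ∫ s in Ioc 0 t, sys.kernelOp s (f s) := by
  rw [histOp, synthOp_apply, Measure.restrict_restrict measurableSet_Ioc, inter_self]
  rfl

theorem trajOp_apply (t : ℝ) (X : YSpace H t) :
    sys.trajOp t X = sys.freeOp t X.fst + sys.convOp (afterOp t (sys.histOp t X.snd)) := rfl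

theorem integrableOn_strCont_hist {F : Type*} [NormedAddCommGroup F] [InnerProductSpace ℂ F]
    {a : ℝ → H →L[ℂ] F} (ha : StrCont a) {t : ℝ} (f : HistSpace H t) :
    IntegrableOn (fun s => a s (f s)) (Ioc 0 t) := by
  have h := integrableOn_strCont_apply ha 0 t f
  rwa [IntegrableOn, Measure.restrict_restrict measurableSet_Ioc, inter_self] at h

theorem convOp_afterOp_histOp (t : ℝ) (f : HistSpace H t) :
    sys.convOp (afterOp t (sys.histOp t f)) = ∫ s in Ioc 0 t, sys.memoryOp t s (f s) := by
  rw [histOp_apply, ← ContinuousLinearMap.integral_comp_comm _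
    (integrableOn_strCont_hist sys.strCont_kernelOp f), ← ContinuousLinearMap.integral_comp_comm _
    (ContinuousLinearMap.integrable_comp _ (integrableOn_strCont_hist sys.strCont_kernelOp f))]
  rfl

theorem histOp_embedY {τ t : ℝ} (h : τ ≤ t) (X : YSpace H τ) :
    sys.histOp t (embedY τ t X).snd = sys.histOp τ X.snd := by
  rw [histOp_apply, histOp_apply]
  have h1 : ∫ s in Ioc 0 t, sys.kernelOp s ((embedY τ t X).snd s) =
      ∫ s in Ioc 0 t, (Ioc 0 τ).indicator (fun s => sys.kernelOp s (X.snd s)) s := by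
    refine integral_congr_ae ?_
    filter_upwards [embedY_snd_coe h X] with s hs
    rw [hs]
    simp only [indicator_apply]
    split_ifs <;> simp
  rw [h1, setIntegral_indicator measurableSet_Ioc, inter_eq_right.2 (Ioc_subset_Ioc_right h)]

/-- The cost operator `P(t)` on `Y_t`. -/
def costMatrix (t : ℝ) : YSpace H t →L[ℂ] YSpace H t :=
  (sys.trajOp t).adjoint ∘L sys.cost t ∘L sys.trajOp t

theorem adjoint_trajOp_fst (t : ℝ) (g : L2R H) :
    ((sys.trajOp t).adjoint g).fst = (sys.freeOp t).adjoint g := by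
  refine ext_inner_left ℂ fun x => ?_
  rw [ContinuousLinearMap.adjoint_inner_right]
  have h1 : inner ℂ x ((sys.trajOp t).adjoint g).fst =
      inner ℂ (WithLp.toLp 2 (x, (0 : HistSpace H t)) : YSpace H t) ((sys.trajOp t).adjoint g) := by
    rw [inner_ySpace]
    change _ = inner ℂ x _ + inner ℂ (0 : HistSpace H t) _
    rw [inner_zero_left, add_zero]
  rw [h1, ContinuousLinearMap.adjoint_inner_right, trajOp_apply]
  change inner ℂ (sys.freeOp t x + sys.convOp (afterOp t (sys.histOp t 0))) g = _
  rw [map_zero, map_zero, map_zero, add_zero]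

theorem adjoint_trajOp_snd (t : ℝ) (g : L2R H) :
    ((sys.trajOp t).adjoint g).snd =ᵐ[volume.restrict (Ioc (0 : ℝ) t)]
      fun q => (sys.memoryOp t q).adjoint g := by
  have hc : Continuous fun q => (sys.memoryOp t q).adjoint g := sys.strCont_adjoint_memoryOp t g
  have hm := toHist_coe (memLp_hist_of_continuousOn (t := t) hc.continuousOn)
  suffices h : ((sys.trajOp t).adjoint g).snd = toHist t fun q => (sys.memoryOp t q).adjoint g by
    rw [h]; exact hm
  refine ext_inner_right ℂ fun f => ?_
  have h1 : inner ℂ ((sys.trajOp t).adjoint g).snd f =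
      inner ℂ ((sys.trajOp t).adjoint g) (WithLp.toLp 2 ((0 : H), f) : YSpace H t) := by
    rw [inner_ySpace]
    change _ = inner ℂ _ (0 : H) + inner ℂ _ f
    rw [inner_zero_right, zero_add]
  rw [h1, ContinuousLinearMap.adjoint_inner_left, trajOp_apply]
  change inner ℂ g (sys.freeOp t 0 + sys.convOp (afterOp t (sys.histOp t f))) = _
  rw [map_zero, zero_add, convOp_afterOp_histOp,
    ← integral_inner (integrableOn_strCont_hist (sys.strCont_memoryOp t) f), L2.inner_def]
  refine integral_congr_ae ?_
  filter_upwards [hm] with q hq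
  rw [hq, ContinuousLinearMap.adjoint_inner_left]

theorem norm_freeOp_le (σ : ℝ) :
    ‖sys.freeOp σ‖ ≤ ‖curveOp sys.T sys.Φ sys.strCont‖ := by
  refine ContinuousLinearMap.opNorm_le_bound _ (ContinuousLinearMap.opNorm_nonneg _) fun x => ?_
  refine (norm_restrOp_apply_le _ measurableSet_Ioc _).trans ?_
  change ‖shiftOp σ (curveOp sys.T sys.Φ sys.strCont x)‖ ≤ _
  rw [norm_shiftOp_apply]
  exact ContinuousLinearMap.le_opNorm _ _

theorem norm_kernelOp_le (s : ℝ) :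
    ‖sys.kernelOp s‖ ≤ ‖(tensorOp sys.kernelClass : H →L[ℂ] L2R H)‖ := by
  refine ContinuousLinearMap.opNorm_le_bound _ (ContinuousLinearMap.opNorm_nonneg _) fun x => ?_
  change ‖shiftOp s (tensorOp sys.kernelClass x)‖ ≤ _
  rw [norm_shiftOp_apply]
  exact ContinuousLinearMap.le_opNorm _ _

theorem norm_afterOp_apply_le (t : ℝ) (f : L2R H) : ‖afterOp t f‖ ≤ ‖f‖ :=
  norm_restrOp_apply_le _ _ f

theorem norm_memoryOp_le (t s : ℝ) :
    ‖sys.memoryOp t s‖ ≤ ‖sys.convOp‖ * ‖(tensorOp sys.kernelClass : H →L[ℂ] L2R H)‖ := by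
  refine ContinuousLinearMap.opNorm_le_bound _ (by positivity) fun x => ?_
  refine (sys.convOp.le_opNorm _).trans ?_
  rw [mul_assoc]
  refine mul_le_mul_of_nonneg_left ((norm_afterOp_apply_le _ _).trans ?_) (ContinuousLinearMap.opNorm_nonneg _)
  exact (sys.kernelOp s).le_of_opNorm_le (sys.norm_kernelOp_le s) x

theorem norm_histOp_apply_le {t : ℝ} (ht : 0 ≤ t) (f : HistSpace H t) :
    ‖sys.histOp t f‖ ≤ ‖(tensorOp sys.kernelClass : H →L[ℂ] L2R H)‖ * (√t * ‖f‖) := by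
  refine (norm_setIntegral_strCont_apply_le (fun s _ => sys.norm_kernelOp_le s)
    (ContinuousLinearMap.opNorm_nonneg _) f).trans_eq ?_
  rw [measureReal_restrict_apply measurableSet_Ioc, inter_self, Real.volume_real_Ioc_of_le ht,
    sub_zero]

theorem norm_fst_le {t : ℝ} (X : YSpace H t) : ‖X.fst‖ ≤ ‖X‖ := by
  rw [WithLp.prod_norm_eq_of_L2]
  exact Real.le_sqrt_of_sq_le (by nlinarith [sq_nonneg ‖X.snd‖])

theorem norm_snd_le {t : ℝ} (X : YSpace H t) : ‖X.snd‖ ≤ ‖X‖ := by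
  rw [WithLp.prod_norm_eq_of_L2]
  exact Real.le_sqrt_of_sq_le (by nlinarith [sq_nonneg ‖X.fst‖])

theorem exists_bound_trajOp : ∃ C, 0 ≤ C ∧ ∀ t ∈ Icc 0 sys.T, ‖sys.trajOp t‖ ≤ C := by
  refine ⟨‖curveOp sys.T sys.Φ sys.strCont‖ + ‖sys.convOp‖ *
    (‖(tensorOp sys.kernelClass : H →L[ℂ] L2R H)‖ * √sys.T), by positivity, fun t ht => ?_⟩
  refine ContinuousLinearMap.opNorm_le_bound _ (by positivity) fun X => ?_
  rw [trajOp_apply, add_mul]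
  refine (norm_add_le _ _).trans (add_le_add ?_ ?_)
  · refine (ContinuousLinearMap.le_of_opNorm_le _ (sys.norm_freeOp_le t) _).trans ?_
    exact mul_le_mul_of_nonneg_left (norm_fst_le X) (ContinuousLinearMap.opNorm_nonneg _)
  · refine (sys.convOp.le_opNorm _).trans ?_
    rw [mul_assoc]
    refine mul_le_mul_of_nonneg_left ((norm_afterOp_apply_le _ _).trans ?_) (ContinuousLinearMap.opNorm_nonneg _)
    refine (sys.norm_histOp_apply_le ht.1 _).trans ?_
    rw [mul_assoc]
    refine mul_le_mul_of_nonneg_left ?_ (ContinuousLinearMap.opNorm_nonneg _)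
    exact mul_le_mul (Real.sqrt_le_sqrt ht.2) (norm_snd_le X) (norm_nonneg _) (by positivity)

theorem norm_adjoint_comp_comp_le {E F G : Type*} [NormedAddCommGroup E] [InnerProductSpace ℂ E]
    [CompleteSpace E] [NormedAddCommGroup F] [InnerProductSpace ℂ F] [CompleteSpace F]
    [NormedAddCommGroup G] [InnerProductSpace ℂ G] [CompleteSpace G]
    {a : E →L[ℂ] F} {b : G →L[ℂ] F} {n : F →L[ℂ] F} {A N : ℝ} (ha : ‖a‖ ≤ A) (hb : ‖b‖ ≤ A)
    (hn : ‖n‖ ≤ N) : ‖a.adjoint ∘L n ∘L b‖ ≤ A * (N * A) := by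
  refine (ContinuousLinearMap.opNorm_comp_le _ _).trans ?_
  rw [LinearIsometryEquiv.norm_map]
  refine mul_le_mul ha ((ContinuousLinearMap.opNorm_comp_le _ _).trans
    (mul_le_mul hn hb (norm_nonneg _) ((norm_nonneg _).trans hn))) (norm_nonneg _)
    ((norm_nonneg _).trans ha)

variable {sys} [TopologicalSpace.SeparableSpace H]

theorem IsModel.costKernel_act0 (h : IsModel sys S K) {t : ℝ} (ht : t ∈ Icc 0 sys.T)
    (X : YSpace H t) : (costKernel sys.T S K sys.B sys.Q t).act0 t X =
      (sys.freeOp t).adjoint (sys.cost t (sys.trajOp t X)) := by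
  rw [trajOp_apply, map_add, map_add, convOp_afterOp_histOp,
    ← ContinuousLinearMap.integral_comp_comm _
      (integrableOn_strCont_hist (sys.strCont_memoryOp t) X.snd),
    ← ContinuousLinearMap.integral_comp_comm _ (ContinuousLinearMap.integrable_comp _
      (integrableOn_strCont_hist (sys.strCont_memoryOp t) X.snd)), BlockKernel.act0,
    intervalIntegral.integral_of_le ht.1]
  congr 1
  · change P0 sys.T S K sys.B sys.Q t _ = _
    rw [h.P0_eq ht]; rfl
  · refine setIntegral_congr_fun measurableSet_Ioc fun s hs => ?_
    change P1 sys.T S K sys.B sys.Q t s _ = _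
    rw [h.P1_eq ht ⟨hs.1.le, hs.2⟩]; rfl

theorem adjoint_cost (sys : MemorySystem H U) (t : ℝ) : (sys.cost t).adjoint = sys.cost t := by
  symm
  rw [ContinuousLinearMap.eq_adjoint_iff]
  exact fun x y => inner_costForm_comm sys.isPositive_weightOp x y

theorem IsModel.adjoint_P1_eq (h : IsModel sys S K) {t s : ℝ} (ht : t ∈ Icc 0 sys.T)
    (hs : s ∈ Icc 0 t) : (P1 sys.T S K sys.B sys.Q t s).adjoint =
      (sys.memoryOp t s).adjoint ∘L sys.cost t ∘L sys.freeOp t := by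
  rw [h.P1_eq ht hs, ContinuousLinearMap.adjoint_comp, ContinuousLinearMap.adjoint_comp,
    ContinuousLinearMap.adjoint_adjoint, adjoint_cost]
  rfl

theorem IsModel.costKernel_act1 (h : IsModel sys S K) {t q : ℝ} (ht : t ∈ Icc 0 sys.T)
    (hq : q ∈ Icc 0 t) (X : YSpace H t) : (costKernel sys.T S K sys.B sys.Q t).act1 t X q =
      (sys.memoryOp t q).adjoint (sys.cost t (sys.trajOp t X)) := by
  rw [trajOp_apply, map_add, map_add, convOp_afterOp_histOp,
    ← ContinuousLinearMap.integral_comp_comm _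
      (integrableOn_strCont_hist (sys.strCont_memoryOp t) X.snd),
    ← ContinuousLinearMap.integral_comp_comm _ (ContinuousLinearMap.integrable_comp _
      (integrableOn_strCont_hist (sys.strCont_memoryOp t) X.snd)), BlockKernel.act1,
    intervalIntegral.integral_of_le ht.1]
  congr 1
  · change (P1 sys.T S K sys.B sys.Q t q).adjoint _ = _
    rw [h.adjoint_P1_eq ht hq]; rfl
  · refine setIntegral_congr_fun measurableSet_Ioc fun s hs => ?_
    change P2 sys.T S K sys.B sys.Q t s q _ = _
    rw [h.P2_eq ht ⟨hs.1.le, hs.2⟩ hq]; rfl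

theorem IsModel.costMatrix_snd (h : IsModel sys S K) {t : ℝ} (ht : t ∈ Icc 0 sys.T)
    (X : YSpace H t) : (sys.costMatrix t X).snd =ᵐ[volume.restrict (Ioc (0 : ℝ) t)]
      (costKernel sys.T S K sys.B sys.Q t).act1 t X := by
  filter_upwards [sys.adjoint_trajOp_snd t (sys.cost t (sys.trajOp t X)),
    ae_restrict_mem measurableSet_Ioc] with q hq hq'
  rw [h.costKernel_act1 ht ⟨hq'.1.le, hq'.2⟩, ← hq]
  rfl

theorem IsModel.costOp_eq (h : IsModel sys S K) {t : ℝ} (ht : t ∈ Icc 0 sys.T) :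
    costOp sys.T S K sys.B sys.Q t = sys.costMatrix t := by
  refine opOf_apply _ fun X => ySpace_ext ?_ ?_
  · rw [mkY_fst, h.costKernel_act0 ht]
    exact sys.adjoint_trajOp_fst t _
  · rw [mkY_snd, ← toHist_congr (h.costMatrix_snd ht X), toHist_self]

theorem IsModel.represents (h : IsModel sys S K) {t : ℝ} (ht : t ∈ Icc 0 sys.T) :
    (costKernel sys.T S K sys.B sys.Q t).Represents t (costOp sys.T S K sys.B sys.Q t) where
  cont01 x := by
    have hc : Continuous fun s => ((sys.freeOp t).adjoint ∘L sys.cost t) (sys.memoryOp t s x) :=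
      ContinuousLinearMap.continuous _ |>.comp (sys.strCont_memoryOp t x)
    refine hc.continuousOn.congr fun s hs => ?_
    change P1 sys.T S K sys.B sys.Q t s x = _
    rw [h.P1_eq ht hs]; rfl
  cont10 x := by
    refine (sys.strCont_adjoint_memoryOp t (sys.cost t (sys.freeOp t x))).continuousOn.congr
      fun q hq => ?_
    change (P1 sys.T S K sys.B sys.Q t q).adjoint x = _
    rw [h.adjoint_P1_eq ht hq]; rfl
  cont11 x := by
    have hc : Continuous fun p : ℝ × ℝ =>
        (sys.memoryOp t p.2).adjoint (sys.cost t (sys.memoryOp t p.1 x)) :=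
      (sys.strCont_adjoint_memoryOp t).continuous_apply continuous_snd
        ((sys.cost t).continuous.comp ((sys.strCont_memoryOp t x).comp continuous_fst))
    refine hc.continuousOn.congr fun p hp => ?_
    change P2 sys.T S K sys.B sys.Q t p.1 p.2 x = _
    rw [h.P2_eq ht hp.1 hp.2]; rfl
  fst_eq X := by
    rw [h.costOp_eq ht, h.costKernel_act0 ht]
    exact sys.adjoint_trajOp_fst t _
  snd_eq X := by
    rw [h.costOp_eq ht]
    exact h.costMatrix_snd ht X

theorem IsModel.exists_bound (h : IsModel sys S K) : ∃ C, ∀ t ∈ Icc 0 sys.T,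
    ‖costOp sys.T S K sys.B sys.Q t‖ ≤ C ∧ (costKernel sys.T S K sys.B sys.Q t).BoundedBy t C := by
  obtain ⟨w, hw0, hw⟩ := sys.exists_bound_trajOp
  obtain ⟨n, hn0, hn⟩ := sys.strCont_cost.exists_bound 0 sys.T
  set c := max w (max ‖curveOp sys.T sys.Φ sys.strCont‖
    (‖sys.convOp‖ * ‖(tensorOp sys.kernelClass : H →L[ℂ] L2R H)‖))
  have hc1 : w ≤ c := le_max_left _ _
  have hc2 : ∀ t, ‖sys.freeOp t‖ ≤ c := fun t =>
    (sys.norm_freeOp_le t).trans ((le_max_left _ _).trans (le_max_right _ _))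
  have hc3 : ∀ t s, ‖sys.memoryOp t s‖ ≤ c := fun t s =>
    (sys.norm_memoryOp_le t s).trans ((le_max_right _ _).trans (le_max_right _ _))
  refine ⟨c * (n * c), fun t ht => ⟨?_, ?_, fun s hs => ?_, fun q hq => ?_, fun s hs q hq => ?_⟩⟩
  · rw [h.costOp_eq ht]
    exact norm_adjoint_comp_comp_le ((hw t ht).trans hc1) ((hw t ht).trans hc1) (hn t ht)
  · change ‖P0 sys.T S K sys.B sys.Q t‖ ≤ _
    rw [h.P0_eq ht]
    exact norm_adjoint_comp_comp_le (hc2 t) (hc2 t) (hn t ht)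
  · change ‖P1 sys.T S K sys.B sys.Q t s‖ ≤ _
    rw [h.P1_eq ht hs]
    exact norm_adjoint_comp_comp_le (hc2 t) (hc3 t s) (hn t ht)
  · change ‖(P1 sys.T S K sys.B sys.Q t q).adjoint‖ ≤ _
    rw [h.adjoint_P1_eq ht hq]
    exact norm_adjoint_comp_comp_le (hc3 t q) (hc2 t) (hn t ht)
  · change ‖P2 sys.T S K sys.B sys.Q t s q‖ ≤ _
    rw [h.P2_eq ht hs hq]
    exact norm_adjoint_comp_comp_le (hc3 t q) (hc3 t s) (hn t ht)

theorem IsModel.costOp_final (h : IsModel sys S K) : costOp sys.T S K sys.B sys.Q sys.T = 0 := by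
  rw [h.costOp_eq ⟨sys.T_nonneg, le_rfl⟩]
  have h0 : sys.trajOp sys.T = 0 := by
    ext1 X
    have h1 : sys.freeOp sys.T X.fst = 0 := by
      refine Lp.ext ?_
      filter_upwards [sys.freeOp_coe sys.T_nonneg X.fst, Lp.coeFn_zero H 2 volume] with p h1 h2
      rw [h1, h2, Ioc_self, indicator_empty]; rfl
    have h2 : sys.convOp (afterOp sys.T (sys.histOp sys.T X.snd)) = 0 := by
      refine Lp.ext ?_
      filter_upwards [sys.convOp_afterOp_coe sys.T_nonneg (sys.histOp sys.T X.snd),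
        Lp.coeFn_zero H 2 volume] with p h1 h2
      rw [h1, h2, Ioc_self, indicator_empty]; rfl
    rw [trajOp_apply, h1, h2, add_zero]; rfl
  rw [costMatrix, h0, ContinuousLinearMap.comp_zero, ContinuousLinearMap.comp_zero]

end MemorySystem

/-! ### The dependence of the optimal cost on the initial time -/

namespace MemorySystem

variable {H U : Type*} [NormedAddCommGroup H] [InnerProductSpace ℂ H] [CompleteSpace H]
    [NormedAddCommGroup U] [InnerProductSpace ℂ U] [CompleteSpace U]
    {sys : MemorySystem H U}

/-- The curve `Φ(·) x` is differentiable, with derivative `Φ(t) a + ∫₀ᵗ K(v) Φ(t - v) x dv`.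
For a Volterra equation with generator `A` this holds if `x ∈ D(A)` and `a = A x`. -/
def IsRegular (sys : MemorySystem H U) (x a : H) : Prop :=
  ∃ r : ℝ → H, Continuous r ∧
    (∀ t ∈ Icc 0 sys.T, r t = ∫ v in 0..t, ((sys.K v : ℝ) : ℂ) • sys.Φ (t - v) x) ∧
    ∀ t ∈ Icc 0 sys.T, sys.Φ t x = x + ∫ v in 0..t, (sys.Φ v a + r v)

/-- The uncontrolled trajectory after the time `t` with initial state `x` and forcing `g`. -/
def traj (sys : MemorySystem H U) (x : H) (g : L2R H) (t : ℝ) : L2R H :=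
  sys.freeOp t x + sys.convOp (afterOp t g)

/-- The negative of the derivative of the trajectory `traj x g t` with respect to `t`, after the
time `t`. -/
def trajRate (sys : MemorySystem H U) (x a : H) (γ : ℝ → H) (σ : ℝ) : L2R H :=
  sys.freeOp σ (a + γ σ) + sys.memoryOp σ σ x

/-- The solution `p ↦ Φ(p-t) x + ∫_t^p Φ(p-σ) h(σ) dσ` of the forced equation. -/
def forcedSol (sys : MemorySystem H U) (x : H) (h : ℝ → H) (t p : ℝ) : H :=
  sys.Φ (p - t) x + ∫ σ in t..p, sys.Φ (p - σ) (h σ)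

theorem continuous_traj (x : H) (g : L2R H) : Continuous (sys.traj x g) :=
  (sys.strCont_freeOp x).add (sys.convOp.continuous.comp (strCont_afterOp g))

theorem continuous_trajRate (x a : H) {γ : ℝ → H} (hγ : Continuous γ) :
    Continuous (sys.trajRate x a γ) :=
  (sys.strCont_freeOp.continuous_apply continuous_id (continuous_const.add hγ)).add
    (sys.strCont_memoryOp_diag x)

theorem continuous_forcedSol (x : H) {h : ℝ → ℝ → H} (hh : Continuous fun q : ℝ × ℝ => h q.1 q.2) :
    Continuous fun q : ℝ × ℝ => sys.forcedSol x (h q.1) q.1 q.2 := by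
  have hF : Continuous (Function.uncurry fun (q : ℝ × ℝ) (σ : ℝ) => sys.Φ (q.2 - σ) (h q.1 σ)) :=
    sys.strCont.continuous_apply
      (f := fun z : (ℝ × ℝ) × ℝ => h z.1.1 z.2) (by fun_prop)
      (hh.comp (f := fun z : (ℝ × ℝ) × ℝ => (z.1.1, z.2)) (by fun_prop))
  have hFi : ∀ (q : ℝ × ℝ) (a b : ℝ),
      IntervalIntegrable (fun σ => sys.Φ (q.2 - σ) (h q.1 σ)) volume a b := fun q a b =>
    (hF.comp (f := fun σ : ℝ => (q, σ)) (by fun_prop)).intervalIntegrable a b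
  have h2 : ∀ q : ℝ × ℝ, ∫ σ in q.1..q.2, sys.Φ (q.2 - σ) (h q.1 σ) =
      (∫ σ in 0..q.2, sys.Φ (q.2 - σ) (h q.1 σ)) - ∫ σ in 0..q.1, sys.Φ (q.2 - σ) (h q.1 σ) :=
    fun q => (intervalIntegral.integral_interval_sub_left (hFi q _ _) (hFi q _ _)).symm
  simp only [forcedSol, h2]
  refine Continuous.add (sys.strCont.continuous_apply (f := fun _ => x) (by fun_prop)
    continuous_const) (Continuous.sub ?_ ?_)
  · exact intervalIntegral.continuous_parametric_intervalIntegral_of_continuous hF continuous_snd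
  · exact intervalIntegral.continuous_parametric_intervalIntegral_of_continuous hF continuous_fst

theorem forcedSol_self (x : H) (h : ℝ → H) (hΦ : sys.Φ 0 x = x) (t : ℝ) :
    sys.forcedSol x h t t = x := by
  rw [forcedSol, sub_self, hΦ, intervalIntegral.integral_same, add_zero]

theorem traj_coe {t : ℝ} (ht : 0 ≤ t) (x : H) {g : L2R H} {h : ℝ → H}
    (hg : g =ᵐ[volume.restrict (Ioc t sys.T)] h) :
    sys.traj x g t =ᵐ[volume] (Ioc t sys.T).indicator (sys.forcedSol x h t) := by
  filter_upwards [Lp.coeFn_add (sys.freeOp t x) (sys.convOp (afterOp t g)), sys.freeOp_coe ht x,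
    sys.convOp_afterOp_coe ht g] with p h1 h2 h3
  rw [traj, h1, Pi.add_apply, h2, h3]
  by_cases hp : p ∈ Ioc t sys.T
  · simp only [indicator_of_mem hp, forcedSol]
    congr 1
    refine intervalIntegral.integral_congr_ae ?_
    filter_upwards [(ae_restrict_iff' measurableSet_Ioc).1 hg] with σ hσ hσ'
    rw [uIoc_of_le hp.1.le] at hσ'
    rw [hσ ⟨hσ'.1, hσ'.2.trans hp.2⟩]
  · simp only [indicator_of_notMem hp, add_zero]

theorem afterOp_traj {t : ℝ} (ht : 0 ≤ t) (x : H) (g : L2R H) :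
    afterOp t (sys.traj x g t) = sys.traj x g t := by
  rw [traj, map_add, sys.afterOp_freeOp le_rfl ht, afterOp_convOp_afterOp]

theorem afterOp_weightOp (t : ℝ) (y : L2R H) :
    afterOp t (sys.weightOp y) = sys.weightOp (afterOp t y) :=
  (compLpL_restrOp sys.Q (Ioi t) measurableSet_Ioi y).symm

theorem afterOp_inputOp (t : ℝ) (u : L2R U) : afterOp t (sys.inputOp t u) = sys.inputOp t u := by
  rw [inputOp_apply, afterOp_convOp_afterOp]

/-- The cost operator maps trajectories after `t` to functions supported after `t`. -/
theorem afterOp_cost {t : ℝ} {y : L2R H} (hy : afterOp t y = y) :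
    afterOp t (sys.cost t y) = sys.cost t y := by
  have h := costForm_apply_eq (C := sys.inputOp t) sys.isPositive_weightOp y
  have h' : sys.cost t y =
      sys.weightOp (y - sys.inputOp t ((sys.inputOp t).adjoint (sys.cost t y))) := h
  rw [h', afterOp_weightOp, map_sub, hy, afterOp_inputOp]

theorem kernelInt_shift (x : H) (σ p : ℝ) :
    ∫ r in σ..p, ((sys.K (r - σ) : ℝ) : ℂ) • sys.Φ (p - r) x =
      ∫ v in 0..p - σ, ((sys.K v : ℝ) : ℂ) • sys.Φ (p - σ - v) x := by
  rw [← sub_self σ, ← intervalIntegral.integral_comp_sub_right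
    (fun v => ((sys.K v : ℝ) : ℂ) • sys.Φ (p - σ - v) x) σ]
  refine intervalIntegral.integral_congr fun r _ => ?_
  simp only [sub_sub_sub_cancel_right]

/-- Moving the initial time of a free trajectory from a regular state. -/
theorem IsRegular.afterOp_freeOp_sub {x a : H} (h : sys.IsRegular x a) {t₁ t₂ : ℝ} (h1 : 0 ≤ t₁)
    (h12 : t₁ ≤ t₂) : afterOp t₂ (sys.freeOp t₁ x - sys.freeOp t₂ x) =
      afterOp t₂ (∫ σ in Ioc t₁ t₂, sys.trajRate x a 0 σ) := by
  obtain ⟨r, hr, hr1, hr2⟩ := h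
  have hφ : Continuous fun v => sys.Φ v a + r v := (sys.strCont a).add hr
  have hrate : ∀ σ, 0 ≤ σ → sys.trajRate x a 0 σ =ᵐ[volume]
      (Ioc σ sys.T).indicator fun p => sys.Φ (p - σ) a + r (p - σ) := by
    intro σ hσ
    filter_upwards [Lp.coeFn_add (sys.freeOp σ (a + (0 : ℝ → H) σ)) (sys.memoryOp σ σ x),
      sys.freeOp_coe hσ (a + (0 : ℝ → H) σ), sys.memoryOp_coe hσ σ x] with p e1 e2 e3
    rw [trajRate, e1, Pi.add_apply, e2, e3]
    simp only [indicator_apply]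
    split_ifs with hp
    · rw [Pi.zero_apply, add_zero, kernelInt_shift,
        hr1 _ ⟨by linarith [hp.1], by linarith [hp.2]⟩]
    · rw [add_zero]
  have hint : IntegrableOn (sys.trajRate x a 0) (Ioc t₁ t₂) :=
    (continuous_trajRate x a continuous_zero).integrableOn_Ioc
  have hcoe := integral_L2R_coe (ν := volume.restrict (Ioc t₁ t₂)) hint
    (k := fun σ p => (Ioc σ sys.T).indicator (fun p => sys.Φ (p - σ) a + r (p - σ)) p) (by
      have h3 : MeasurableSet {q : ℝ × ℝ | q.1 < q.2 ∧ q.2 ≤ sys.T} :=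
        (measurableSet_lt measurable_fst measurable_snd).inter
          (measurableSet_le measurable_snd measurable_const)
      have h4 : Continuous fun q : ℝ × ℝ => sys.Φ (q.2 - q.1) a + r (q.2 - q.1) :=
        hφ.comp (f := fun q : ℝ × ℝ => q.2 - q.1) (by fun_prop)
      refine (h4.aestronglyMeasurable.indicator h3).congr (ae_of_all _ fun q => ?_)
      simp [Function.uncurry, indicator_apply]) (by
      rw [ae_restrict_iff' measurableSet_Ioc]
      exact ae_of_all _ fun σ hσ => hrate σ (h1.trans hσ.1.le))
  refine Lp.ext ?_
  filter_upwards [restrOp_coe (Ioi t₂) measurableSet_Ioi (sys.freeOp t₁ x - sys.freeOp t₂ x),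
    restrOp_coe (Ioi t₂) measurableSet_Ioi (∫ σ in Ioc t₁ t₂, sys.trajRate x a 0 σ), hcoe,
    Lp.coeFn_sub (sys.freeOp t₁ x) (sys.freeOp t₂ x), sys.freeOp_coe h1 x,
    sys.freeOp_coe (h1.trans h12) x] with p e1 e2 e3 e4 e5 e6
  rw [afterOp, e1, e2]
  by_cases hp : p ∈ Ioi t₂
  · rw [indicator_of_mem hp, indicator_of_mem hp, e3, e4, Pi.sub_apply, e5, e6]
    rw [mem_Ioi] at hp
    by_cases hpT : p ≤ sys.T
    · rw [indicator_of_mem (show p ∈ Ioc t₁ sys.T from ⟨h12.trans_lt hp, hpT⟩),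
        indicator_of_mem (show p ∈ Ioc t₂ sys.T from ⟨hp, hpT⟩),
        hr2 _ ⟨by linarith, by linarith⟩, hr2 _ ⟨by linarith, by linarith⟩,
        add_sub_add_left_eq_sub, intervalIntegral.integral_interval_sub_left
          (hφ.intervalIntegrable _ _) (hφ.intervalIntegrable _ _),
        ← intervalIntegral.integral_comp_sub_left (fun v => sys.Φ v a + r v),
        intervalIntegral.integral_of_le h12]
      refine setIntegral_congr_fun measurableSet_Ioc fun σ hσ => ?_
      rw [indicator_of_mem (show p ∈ Ioc σ sys.T from ⟨hσ.2.trans_lt hp, hpT⟩)]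
    · rw [indicator_of_notMem fun h => hpT h.2, indicator_of_notMem fun h => hpT h.2, sub_zero]
      symm
      exact setIntegral_eq_zero_of_forall_eq_zero fun σ _ =>
        indicator_of_notMem (fun h => hpT h.2) _
  · rw [indicator_of_notMem hp, indicator_of_notMem hp]

theorem convOp_restrOp {g : L2R H} {γ : ℝ → H} (hg : g =ᵐ[volume] γ) {a b : ℝ} (ha : 0 ≤ a)
    (hb : b ≤ sys.T) : sys.convOp (restrOp (Ioc a b) measurableSet_Ioc g) =
      ∫ σ in Ioc a b, sys.freeOp σ (γ σ) := by
  rw [convOp_apply]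
  have h1 : ∫ σ in Ioc 0 sys.T, sys.freeOp σ (restrOp (Ioc a b) measurableSet_Ioc g σ) =
      ∫ σ in Ioc 0 sys.T, (Ioc a b).indicator (fun σ => sys.freeOp σ (γ σ)) σ := by
    refine integral_congr_ae (ae_restrict_of_ae ?_)
    filter_upwards [restrOp_coe (Ioc a b) measurableSet_Ioc g, hg] with σ hσ hσ'
    rw [hσ]
    simp only [indicator_apply, hσ']
    split_ifs <;> simp
  rw [h1, setIntegral_indicator measurableSet_Ioc, inter_eq_right.2 (Ioc_subset_Ioc ha hb)]

/-- Moving the initial time of a trajectory from a regular state with a continuous forcing. -/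
theorem IsRegular.afterOp_traj_sub {x a : H} (h : sys.IsRegular x a) {g : L2R H} {γ : ℝ → H}
    (hγ : Continuous γ) (hg : g =ᵐ[volume] γ) {t₁ t₂ : ℝ} (h1 : 0 ≤ t₁)
    (h12 : t₁ ≤ t₂) (h2 : t₂ ≤ sys.T) : afterOp t₂ (sys.traj x g t₁ - sys.traj x g t₂) =
      afterOp t₂ (∫ σ in Ioc t₁ t₂, sys.trajRate x a γ σ) := by
  have e1 : sys.traj x g t₁ - sys.traj x g t₂ = (sys.freeOp t₁ x - sys.freeOp t₂ x) +
      sys.convOp (restrOp (Ioc t₁ t₂) measurableSet_Ioc g) := by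
    rw [← afterOp_sub_afterOp h12, map_sub, traj, traj]
    abel
  have hi : IntegrableOn (fun σ => sys.freeOp σ (γ σ)) (Ioc t₁ t₂) :=
    (sys.strCont_freeOp.continuous_apply continuous_id hγ).integrableOn_Ioc
  have e2 : ∫ σ in Ioc t₁ t₂, sys.trajRate x a γ σ = (∫ σ in Ioc t₁ t₂, sys.trajRate x a 0 σ) +
      ∫ σ in Ioc t₁ t₂, sys.freeOp σ (γ σ) := by
    rw [← integral_add (continuous_trajRate x a continuous_zero).integrableOn_Ioc
      hi]
    refine integral_congr_ae (ae_of_all _ fun σ => ?_)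
    simp only [trajRate, map_add, Pi.zero_apply, add_zero]
    abel
  rw [e1, e2, map_add, map_add, h.afterOp_freeOp_sub h1 h12, convOp_restrOp hg h1 h2]

/-- A function whose increments are integrals of a function jointly continuous in the end points
and the integration variable is differentiable. -/
theorem hasDerivWithinAt_of_integral {G : ℝ → ℂ} {J : ℝ × ℝ × ℝ → ℂ} (hJ : Continuous J)
    {a b : ℝ} (hG : ∀ t₁ t₂, a ≤ t₁ → t₁ ≤ t₂ → t₂ ≤ b →
      G t₁ - G t₂ = ∫ σ in Ioc t₁ t₂, J (t₁, t₂, σ)) {t : ℝ} (ht : t ∈ Icc a b) :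
    HasDerivWithinAt G (-J (t, t, t)) (Icc a b) t := by
  have key : ∀ ε > 0, ∃ δ > 0, ∀ t₁ t₂, a ≤ t₁ → t₁ ≤ t₂ → t₂ ≤ b → |t₁ - t| < δ → |t₂ - t| < δ →
      ‖G t₁ - G t₂ - (t₂ - t₁) • J (t, t, t)‖ ≤ ε * (t₂ - t₁) := by
    intro ε hε
    obtain ⟨δ, hδ, h⟩ := Metric.continuousAt_iff.1 (hJ.continuousAt (x := (t, t, t))) ε hε
    refine ⟨δ, hδ, fun t₁ t₂ h1 h12 h2 h3 h4 => ?_⟩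
    have hi : IntegrableOn (fun σ => J (t₁, t₂, σ)) (Ioc t₁ t₂) :=
      (hJ.comp (f := fun σ : ℝ => (t₁, t₂, σ)) (by fun_prop)).integrableOn_Ioc
    have e1 : (t₂ - t₁) • J (t, t, t) = ∫ _ in Ioc t₁ t₂, J (t, t, t) := by
      rw [setIntegral_const, Real.volume_real_Ioc_of_le h12]
    rw [hG t₁ t₂ h1 h12 h2, e1, ← integral_sub hi (integrable_const _)]
    refine (norm_setIntegral_le_of_norm_le_const (C := ε) measure_Ioc_lt_top
      fun σ hσ => ?_).trans_eq ?_
    · rw [← dist_eq_norm]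
      refine (h ?_).le
      simp only [Prod.dist_eq, Real.dist_eq, max_lt_iff]
      refine ⟨h3, h4, ?_⟩
      rw [abs_lt] at *
      exact ⟨by linarith [hσ.1], by linarith [hσ.2]⟩
    · rw [Real.volume_real_Ioc_of_le h12]
  rw [hasDerivWithinAt_iff_isLittleO, Asymptotics.isLittleO_iff]
  intro ε hε
  obtain ⟨δ, hδ, h⟩ := key ε hε
  filter_upwards [self_mem_nhdsWithin, mem_nhdsWithin_of_mem_nhds (Metric.ball_mem_nhds t hδ)]
    with s hs hs'
  rw [Metric.mem_ball, Real.dist_eq] at hs'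
  rcases le_total s t with hst | hst
  · have := h s t hs.1 hst ht.2 hs' (by simpa using hδ)
    have e : G s - G t - (s - t) • -J (t, t, t) = G s - G t - (t - s) • J (t, t, t) := by module
    rwa [Real.norm_eq_abs, abs_of_nonpos (by linarith), neg_sub, e]
  · have := h t s ht.1 hst hs.2 (by simpa using hδ) hs'
    have e : -(G s - G t - (s - t) • -J (t, t, t)) = G t - G s - (s - t) • J (t, t, t) := by module
    rwa [Real.norm_eq_abs, abs_of_nonneg (by linarith), ← norm_neg, e]

end MemorySystem

/-! ### The derivative of the optimal cost -/

namespace MemorySystem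

variable {H U : Type*} [NormedAddCommGroup H] [InnerProductSpace ℂ H] [CompleteSpace H]
    [NormedAddCommGroup U] [InnerProductSpace ℂ U] [CompleteSpace U]
    {sys : MemorySystem H U}

/-- The optimal control at the time `σ` for the trajectory `traj x g t`, up to its sign. -/
def optControl (sys : MemorySystem H U) (x : H) (g : L2R H) (t σ : ℝ) : U :=
  sys.B.adjoint ((sys.freeOp σ).adjoint (sys.cost t (sys.traj x g t)))

theorem continuous_cost_traj (x : H) (g : L2R H) :
    Continuous fun t => sys.cost t (sys.traj x g t) :=
  sys.strCont_cost.continuous_apply continuous_id (continuous_traj x g)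

theorem continuous_optControl (x : H) (g : L2R H) :
    Continuous fun q : ℝ × ℝ => sys.optControl x g q.1 q.2 :=
  sys.B.adjoint.continuous.comp (sys.strCont_adjoint_freeOp.continuous_apply continuous_snd
    ((continuous_cost_traj x g).comp continuous_fst))

/-- The optimal state for the trajectory `traj x g t`. -/
def optState (sys : MemorySystem H U) (x : H) (g : L2R H) (γ : ℝ → H) (t p : ℝ) : H :=
  sys.forcedSol x (fun σ => γ σ - sys.B (sys.optControl x g t σ)) t p

theorem continuous_optState (x : H) (g : L2R H) {γ : ℝ → H} (hγ : Continuous γ) :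
    Continuous fun q : ℝ × ℝ => sys.optState x g γ q.1 q.2 :=
  continuous_forcedSol (h := fun t σ => γ σ - sys.B (sys.optControl x g t σ)) x
    ((hγ.comp continuous_snd).sub (sys.B.continuous.comp (continuous_optControl x g)))

theorem optState_coe {t : ℝ} (ht : 0 ≤ t) (x : H) {g : L2R H} {γ : ℝ → H}
    (hg : g =ᵐ[volume] γ) : (sys.traj x g t -
      sys.inputOp t ((sys.inputOp t).adjoint (sys.cost t (sys.traj x g t))) : L2R H) =ᵐ[volume]
      (Ioc t sys.T).indicator (sys.optState x g γ t) := by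
  have h1 : sys.traj x g t -
      sys.inputOp t ((sys.inputOp t).adjoint (sys.cost t (sys.traj x g t))) =
      sys.traj x (g - sys.B.compLpL 2 volume
        ((sys.inputOp t).adjoint (sys.cost t (sys.traj x g t)))) t := by
    rw [inputOp_apply]
    conv_rhs => rw [traj, map_sub, map_sub]
    rw [← add_sub_assoc]
    rfl
  rw [h1]
  refine traj_coe ht x ?_
  filter_upwards [ae_restrict_of_ae hg, ae_restrict_mem measurableSet_Ioc,
    ae_restrict_of_ae (Lp.coeFn_sub g (sys.B.compLpL 2 volume
        ((sys.inputOp t).adjoint (sys.cost t (sys.traj x g t))))),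
    ae_restrict_of_ae (sys.B.coeFn_compLpL (p := 2) (μ := volume)
      ((sys.inputOp t).adjoint (sys.cost t (sys.traj x g t)))),
    ae_restrict_of_ae (sys.adjoint_inputOp_coe ht (sys.cost t (sys.traj x g t)))]
    with p e1 e2 e3 e4 e5
  rw [e3, Pi.sub_apply, e1, e4, e5, indicator_of_mem e2]
  rfl

/-- The cost accumulated over a short interval after the initial time. -/
theorem inner_restrOp_traj_cost {t₁ t₂ : ℝ} (h1 : 0 ≤ t₁) (h2 : t₂ ≤ sys.T)
    (x x' : H) {g g' : L2R H} {γ γ' : ℝ → H} (hg : g =ᵐ[volume] γ) (hg' : g' =ᵐ[volume] γ') :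
    inner ℂ (restrOp (Ioc t₁ t₂) measurableSet_Ioc (sys.traj x' g' t₁))
      (sys.cost t₁ (sys.traj x g t₁)) = ∫ p in Ioc t₁ t₂,
        inner ℂ (sys.forcedSol x' γ' t₁ p) (sys.Q (sys.optState x g γ t₁ p)) := by
  have h := costForm_apply_eq (C := sys.inputOp t₁) sys.isPositive_weightOp (sys.traj x g t₁)
  have h' : sys.cost t₁ (sys.traj x g t₁) = sys.weightOp (sys.traj x g t₁ -
    sys.inputOp t₁ ((sys.inputOp t₁).adjoint (sys.cost t₁ (sys.traj x g t₁)))) := h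
  rw [h', inner_restrOp_left]
  refine integral_congr_ae ?_
  filter_upwards [ae_restrict_of_ae (traj_coe (sys := sys) h1 x' (ae_restrict_of_ae hg')),
    ae_restrict_of_ae (optState_coe (sys := sys) h1 x hg), ae_restrict_mem measurableSet_Ioc,
    ae_restrict_of_ae (sys.Q.coeFn_compLpL (p := 2) (μ := volume) (sys.traj x g t₁ -
    sys.inputOp t₁ ((sys.inputOp t₁).adjoint (sys.cost t₁ (sys.traj x g t₁)))))]
    with p e1 e2 e3 e4
  have e5 : p ∈ Ioc t₁ sys.T := ⟨e3.1, e3.2.trans h2⟩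
  rw [weightOp, e4, e1, e2, indicator_of_mem e5, indicator_of_mem e5]

theorem inner_afterOp_left (t : ℝ) (f g : L2R H) :
    inner ℂ (afterOp t f) g = inner ℂ f (afterOp t g) := inner_restrOp_comm _ _ f g

/-- The integrand of the increments of the minimal cost. -/
def costRate (sys : MemorySystem H U) (x a x' a' : H) (g g' : L2R H) (γ γ' : ℝ → H)
    (q : ℝ × ℝ × ℝ) : ℂ :=
  inner ℂ (sys.trajRate x' a' γ' q.2.2) (afterOp q.2.1 (sys.cost q.1 (sys.traj x g q.1))) +
    inner ℂ (sys.cost q.2.1 (sys.traj x' g' q.2.1)) (sys.trajRate x a γ q.2.2) -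
    inner ℂ (sys.optControl x' g' q.2.1 q.2.2) (sys.optControl x g q.1 q.2.2) +
    inner ℂ (sys.forcedSol x' γ' q.1 q.2.2) (sys.Q (sys.optState x g γ q.1 q.2.2))

theorem continuous_costRate (x a x' a' : H) (g g' : L2R H) {γ γ' : ℝ → H} (hγ : Continuous γ)
    (hγ' : Continuous γ') : Continuous (sys.costRate x a x' a' g g' γ γ') := by
  have c1 : Continuous fun q : ℝ × ℝ × ℝ => q.1 := continuous_fst
  have c2 : Continuous fun q : ℝ × ℝ × ℝ => q.2.1 := by fun_prop
  have c3 : Continuous fun q : ℝ × ℝ × ℝ => q.2.2 := by fun_prop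
  have hη : Continuous fun q : ℝ × ℝ => sys.forcedSol x' γ' q.1 q.2 :=
    continuous_forcedSol (h := fun _ => γ') x' (hγ'.comp continuous_snd)
  refine Continuous.add (Continuous.sub (Continuous.add ?_ ?_) ?_) ?_
  · have d1 : Continuous fun q : ℝ × ℝ × ℝ => sys.trajRate x' a' γ' q.2.2 :=
      (continuous_trajRate x' a' hγ').comp c3
    have d2 : Continuous fun q : ℝ × ℝ × ℝ => sys.cost q.1 (sys.traj x g q.1) :=
      (continuous_cost_traj x g).comp c1
    have d3 : Continuous fun q : ℝ × ℝ × ℝ =>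
        afterOp q.2.1 (sys.cost q.1 (sys.traj x g q.1)) :=
      (strCont_afterOp (E := H)).continuous_apply c2 d2
    exact d1.inner d3
  · have d1 : Continuous fun q : ℝ × ℝ × ℝ => sys.cost q.2.1 (sys.traj x' g' q.2.1) :=
      (continuous_cost_traj x' g').comp c2
    have d2 : Continuous fun q : ℝ × ℝ × ℝ => sys.trajRate x a γ q.2.2 :=
      (continuous_trajRate x a hγ).comp c3
    exact d1.inner d2
  · have d1 : Continuous fun q : ℝ × ℝ × ℝ => sys.optControl x' g' q.2.1 q.2.2 :=
      (continuous_optControl (sys := sys) x' g').comp (f := fun q : ℝ × ℝ × ℝ => (q.2.1, q.2.2))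
        (c2.prodMk c3)
    have d2 : Continuous fun q : ℝ × ℝ × ℝ => sys.optControl x g q.1 q.2.2 :=
      (continuous_optControl (sys := sys) x g).comp (f := fun q : ℝ × ℝ × ℝ => (q.1, q.2.2))
        (c1.prodMk c3)
    exact d1.inner d2
  · have d1 : Continuous fun q : ℝ × ℝ × ℝ => sys.forcedSol x' γ' q.1 q.2.2 :=
      hη.comp (f := fun q : ℝ × ℝ × ℝ => (q.1, q.2.2)) (c1.prodMk c3)
    have d2 : Continuous fun q : ℝ × ℝ × ℝ => sys.optState x g γ q.1 q.2.2 :=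
      (continuous_optState (sys := sys) x g hγ).comp (f := fun q : ℝ × ℝ × ℝ => (q.1, q.2.2))
        (c1.prodMk c3)
    exact d1.inner (sys.Q.continuous.comp d2)

/-- The increments of the minimal cost as a function of the initial time. -/
theorem IsRegular.inner_cost_sub {x a x' a' : H} (h : sys.IsRegular x a)
    (h' : sys.IsRegular x' a') {g g' : L2R H} {γ γ' : ℝ → H} (hγ : Continuous γ)
    (hγ' : Continuous γ') (hg : g =ᵐ[volume] γ) (hg' : g' =ᵐ[volume] γ') {t₁ t₂ : ℝ}
    (h1 : 0 ≤ t₁) (h12 : t₁ ≤ t₂) (h2 : t₂ ≤ sys.T) :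
    inner ℂ (sys.traj x' g' t₁) (sys.cost t₁ (sys.traj x g t₁)) -
      inner ℂ (sys.traj x' g' t₂) (sys.cost t₂ (sys.traj x g t₂)) =
    ∫ σ in Ioc t₁ t₂, sys.costRate x a x' a' g g' γ γ' (t₁, t₂, σ) := by
  set y₁ := sys.traj x g t₁ with hy₁
  set y₂ := sys.traj x g t₂ with hy₂
  set y₁' := sys.traj x' g' t₁ with hy₁'
  set y₂' := sys.traj x' g' t₂ with hy₂'
  have h02 := h1.trans h12
  have hz : IntegrableOn (sys.trajRate x a γ) (Ioc t₁ t₂) :=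
    (continuous_trajRate x a hγ).integrableOn_Ioc
  have hz' : IntegrableOn (sys.trajRate x' a' γ') (Ioc t₁ t₂) :=
    (continuous_trajRate x' a' hγ').integrableOn_Ioc
  have hkey := inner_costForm_sub_inner_costForm (C₁ := sys.inputOp t₁) (C₂ := sys.inputOp t₂)
    sys.isPositive_weightOp y₁ y₁' y₂ y₂'
  change inner ℂ y₁' (sys.cost t₁ y₁) - inner ℂ y₂' (sys.cost t₂ y₂) =
    inner ℂ (y₁' - y₂') (sys.cost t₁ y₁) + inner ℂ (sys.cost t₂ y₂') (y₁ - y₂) -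
    (inner ℂ ((sys.inputOp t₁).adjoint (sys.cost t₂ y₂'))
      ((sys.inputOp t₁).adjoint (sys.cost t₁ y₁)) -
    inner ℂ ((sys.inputOp t₂).adjoint (sys.cost t₂ y₂'))
      ((sys.inputOp t₂).adjoint (sys.cost t₁ y₁))) at hkey
  have hcost2 : afterOp t₂ (sys.cost t₂ y₂') = sys.cost t₂ y₂' :=
    afterOp_cost (afterOp_traj h02 x' g')
  have e1 : inner ℂ (y₁' - y₂') (sys.cost t₁ y₁) =
      (∫ σ in Ioc t₁ t₂, inner ℂ (sys.trajRate x' a' γ' σ) (afterOp t₂ (sys.cost t₁ y₁))) +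
      ∫ p in Ioc t₁ t₂,
        inner ℂ (sys.forcedSol x' γ' t₁ p) (sys.Q (sys.optState x g γ t₁ p)) := by
    have e2 : y₁' - y₂' = afterOp t₂ (∫ σ in Ioc t₁ t₂, sys.trajRate x' a' γ' σ) +
        restrOp (Ioc t₁ t₂) measurableSet_Ioc y₁' := by
      rw [← h'.afterOp_traj_sub hγ' hg' h1 h12 h2, map_sub, afterOp_traj h02,
        ← afterOp_sub_afterOp h12, afterOp_traj h1]
      abel
    rw [e2, inner_add_left, inner_restrOp_traj_cost h1 h2 x x' hg hg', inner_afterOp_left,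
      ← inner_conj_symm, ← integral_inner hz', ← integral_conj]
    simp only [inner_conj_symm]
  have e3 : inner ℂ (sys.cost t₂ y₂') (y₁ - y₂) =
      ∫ σ in Ioc t₁ t₂, inner ℂ (sys.cost t₂ y₂') (sys.trajRate x a γ σ) := by
    rw [← hcost2, inner_afterOp_left, h.afterOp_traj_sub hγ hg h1 h12 h2, ← inner_afterOp_left,
      hcost2, ← integral_inner hz]
  have hb : ∀ a b : ℝ, IntegrableOn (fun σ => inner ℂ (sys.optControl x' g' t₂ σ)
      (sys.optControl x g t₁ σ)) (Ioc a b) := fun a b =>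
    (((continuous_optControl x' g').comp (f := fun σ : ℝ => (t₂, σ)) (by fun_prop)).inner
      ((continuous_optControl x g).comp (f := fun σ : ℝ => (t₁, σ)) (by fun_prop))).integrableOn_Ioc
  have e4 : inner ℂ ((sys.inputOp t₁).adjoint (sys.cost t₂ y₂'))
      ((sys.inputOp t₁).adjoint (sys.cost t₁ y₁)) -
      inner ℂ ((sys.inputOp t₂).adjoint (sys.cost t₂ y₂'))
      ((sys.inputOp t₂).adjoint (sys.cost t₁ y₁)) =
      ∫ σ in Ioc t₁ t₂, inner ℂ (sys.optControl x' g' t₂ σ) (sys.optControl x g t₁ σ) := by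
    rw [sys.inner_adjoint_inputOp h1, sys.inner_adjoint_inputOp h02]
    change (∫ σ in Ioc t₁ sys.T, inner ℂ (sys.optControl x' g' t₂ σ) (sys.optControl x g t₁ σ)) -
      ∫ σ in Ioc t₂ sys.T, inner ℂ (sys.optControl x' g' t₂ σ) (sys.optControl x g t₁ σ) = _
    rw [← Ioc_union_Ioc_eq_Ioc h12 h2, setIntegral_union
        (Ioc_disjoint_Ioc_of_le le_rfl) measurableSet_Ioc (hb _ _) (hb _ _)]
    exact add_sub_cancel_right _ _
  have i1 : IntegrableOn (fun σ => inner ℂ (sys.trajRate x' a' γ' σ)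
      (afterOp t₂ (sys.cost t₁ y₁))) (Ioc t₁ t₂) :=
    ((continuous_trajRate x' a' hγ').inner continuous_const).integrableOn_Ioc
  have i2 : IntegrableOn (fun σ => inner ℂ (sys.cost t₂ y₂') (sys.trajRate x a γ σ))
      (Ioc t₁ t₂) := (continuous_const.inner (continuous_trajRate x a hγ)).integrableOn_Ioc
  have i3 : IntegrableOn (fun p => inner ℂ (sys.forcedSol x' γ' t₁ p)
      (sys.Q (sys.optState x g γ t₁ p))) (Ioc t₁ t₂) := by
    have hη : Continuous fun q : ℝ × ℝ => sys.forcedSol x' γ' q.1 q.2 :=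
      continuous_forcedSol (h := fun _ => γ') x' (hγ'.comp continuous_snd)
    exact ((hη.comp (f := fun σ : ℝ => (t₁, σ)) (by fun_prop)).inner (sys.Q.continuous.comp
      ((continuous_optState x g hγ).comp (f := fun σ : ℝ => (t₁, σ))
        (by fun_prop)))).integrableOn_Ioc
  have i4 : IntegrableOn (fun σ => inner ℂ (sys.trajRate x' a' γ' σ)
      (afterOp t₂ (sys.cost t₁ y₁)) + inner ℂ (sys.cost t₂ y₂') (sys.trajRate x a γ σ))
      (Ioc t₁ t₂) := i1.add i2
  have i5 : IntegrableOn (fun σ => inner ℂ (sys.trajRate x' a' γ' σ)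
      (afterOp t₂ (sys.cost t₁ y₁)) + inner ℂ (sys.cost t₂ y₂') (sys.trajRate x a γ σ) -
      inner ℂ (sys.optControl x' g' t₂ σ) (sys.optControl x g t₁ σ))
      (Ioc t₁ t₂) := i4.sub (hb _ _)
  rw [hkey, e1, e3, e4]
  simp only [costRate]
  rw [← hy₁, ← hy₂', integral_add i5 i3, integral_sub i4 (hb _ _), integral_add i1 i2]
  ring

/-- The derivative of the minimal cost with respect to the initial time. -/
theorem IsRegular.hasDerivWithinAt_inner_cost {x a x' a' : H} (h : sys.IsRegular x a)
    (h' : sys.IsRegular x' a') (hΦ : ∀ x, sys.Φ 0 x = x) {g g' : L2R H} {γ γ' : ℝ → H}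
    (hγ : Continuous γ) (hγ' : Continuous γ') (hg : g =ᵐ[volume] γ) (hg' : g' =ᵐ[volume] γ')
    {τ t : ℝ} (hτ : 0 ≤ τ) (ht : t ∈ Icc τ sys.T) :
    HasDerivWithinAt (fun t => inner ℂ (sys.traj x' g' t) (sys.cost t (sys.traj x g t)))
      (-(inner ℂ (sys.cost t (sys.traj x' g' t)) (sys.trajRate x a γ t) +
        inner ℂ (sys.trajRate x' a' γ' t) (sys.cost t (sys.traj x g t)) -
        inner ℂ (sys.optControl x' g' t t) (sys.optControl x g t t) + inner ℂ x' (sys.Q x)))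
      (Icc τ sys.T) t := by
  have h1 := hasDerivWithinAt_of_integral (continuous_costRate x a x' a' g g' hγ hγ') (a := τ)
    (b := sys.T) (G := fun t => inner ℂ (sys.traj x' g' t) (sys.cost t (sys.traj x g t)))
    (fun t₁ t₂ h1 h12 h2 => h.inner_cost_sub h' hγ hγ' hg hg' (hτ.trans h1) h12 h2) ht
  have h2 : afterOp t (sys.cost t (sys.traj x g t)) = sys.cost t (sys.traj x g t) :=
    afterOp_cost (afterOp_traj (hτ.trans ht.1) x g)
  rw [costRate] at h1
  simp only [h2, optState, forcedSol_self _ _ (hΦ _)] at h1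
  rwa [add_comm (inner ℂ (sys.trajRate x' a' γ' t) _)] at h1

end MemorySystem

/-! ### The cost operator solves the Riccati equation -/

namespace MemorySystem

variable {H U : Type*} [NormedAddCommGroup H] [InnerProductSpace ℂ H] [CompleteSpace H]
    [NormedAddCommGroup U] [InnerProductSpace ℂ U] [CompleteSpace U]
    {sys : MemorySystem H U} {S : ℝ → H →L[ℂ] H} {K : ℝ → ℝ}

theorem memLp_K_sub_left (r : ℝ) : MemLp (fun s => ((sys.K (r - s) : ℝ) : ℂ)) 2 volume :=
  (sys.memLp_K.comp_measurePreserving (Measure.measurePreserving_sub_left volume r)).ofReal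

theorem memLp_K_smul_const (r : ℝ) (h : H) :
    MemLp (fun s => ((sys.K (r - s) : ℝ) : ℂ) • h) 2 volume :=
  (ContinuousLinearMap.toSpanSingleton ℂ h).comp_memLp' (memLp_K_sub_left r)

theorem integrableOn_K_smul {t : ℝ} (f : HistSpace H t) (r : ℝ) :
    IntegrableOn (fun s => ((sys.K (r - s) : ℝ) : ℂ) • f s) (Ioc 0 t) :=
  memLp_one_iff_integrable.1 ((Lp.memLp f).smul ((memLp_K_sub_left r).restrict _))

/-- The continuous representative `r ↦ ∫₀ᵗ K(r - s) f(s) ds` of the forcing produced by a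
history. -/
def histFun (sys : MemorySystem H U) (t : ℝ) (f : HistSpace H t) (r : ℝ) : H :=
  ∫ s in Ioc 0 t, ((sys.K (r - s) : ℝ) : ℂ) • f s

theorem histOp_coe (t : ℝ) (f : HistSpace H t) : sys.histOp t f =ᵐ[volume] sys.histFun t f := by
  rw [histOp_apply]
  refine integral_L2R_coe (integrableOn_strCont_hist sys.strCont_kernelOp f)
    (k := fun s p => ((sys.K (p - s) : ℝ) : ℂ) • f s) ?_ ?_
  · have hm := sys.measurable_K
    have h1 : Measurable fun q : ℝ × ℝ => ((sys.K (q.2 - q.1) : ℝ) : ℂ) := by fun_prop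
    exact h1.aestronglyMeasurable.smul (Lp.aestronglyMeasurable f).comp_fst
  · exact ae_of_all _ fun s => sys.kernelOp_coe s (f s)

theorem continuous_histFun (t : ℝ) (f : HistSpace H t) : Continuous (sys.histFun t f) := by
  have hf : MemLp ((Ioc 0 t).indicator f) 2 volume :=
    (memLp_indicator_iff_restrict measurableSet_Ioc).2 (Lp.memLp f)
  have hk : MemLp (fun s => ((sys.K (-s) : ℝ) : ℂ)) 2 volume := by
    simpa using memLp_K_sub_left (sys := sys) 0
  let P := (ContinuousLinearMap.lsmul ℂ ℂ : ℂ →L[ℂ] H →L[ℂ] H).lpPairing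
    (volume : Measure ℝ) 2 2
  have h1 : sys.histFun t f = fun r => P (shiftOp r (ofFun fun s => ((sys.K (-s) : ℝ) : ℂ)))
      (ofFun ((Ioc 0 t).indicator f)) := by
    funext r
    rw [ContinuousLinearMap.lpPairing_eq_integral, histFun, ← integral_indicator measurableSet_Ioc]
    refine integral_congr_ae ?_
    filter_upwards [shiftOp_coe_of_ae (F := ℂ) (ofFun_coe hk) r, ofFun_coe hf] with s h2 h3
    rw [h2, h3, ContinuousLinearMap.lsmul_apply, neg_sub]
    simp only [indicator_apply]
    split_ifs <;> simp
  rw [h1]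
  exact (P.continuous.comp (strCont_shiftOp _)).clm_apply continuous_const

theorem histFun_embedY {τ t : ℝ} (h : τ ≤ t) (X : YSpace H τ) (r : ℝ) :
    sys.histFun t (embedY τ t X).snd r = sys.histFun τ X.snd r := by
  have h1 : sys.histFun t (embedY τ t X).snd r = ∫ s in Ioc 0 t,
      (Ioc 0 τ).indicator (fun s => ((sys.K (r - s) : ℝ) : ℂ) • X.snd s) s := by
    refine integral_congr_ae ?_
    filter_upwards [embedY_snd_coe h X] with s hs
    rw [hs]
    simp only [indicator_apply]
    split_ifs <;> simp
  rw [h1, setIntegral_indicator measurableSet_Ioc, inter_eq_right.2 (Ioc_subset_Ioc_right h)]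
  rfl

theorem trajOp_embedY {τ t : ℝ} (h : τ ≤ t) (X : YSpace H τ) :
    sys.trajOp t (embedY τ t X) = sys.traj X.fst (sys.histOp τ X.snd) t := by
  rw [trajOp_apply, histOp_embedY sys h, embedY_fst]
  rfl

theorem trajOp_mkY_zero (t : ℝ) (x : H) : sys.trajOp t (mkY t x 0) = sys.freeOp t x := by
  rw [trajOp_apply, mkY_fst, mkY_snd, toHist_zero, map_zero, map_zero, map_zero, add_zero]

/-- The kernels `K` and `sys.K` agree at almost all `t - s`, `s ∈ (0,t]`. -/
theorem ae_K_sub_left (hK : ∀ᵐ s, s ∈ Ioc 0 sys.T → K s = sys.K s) {t : ℝ} (ht : t ≤ sys.T) :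
    ∀ᵐ s ∂volume.restrict (Ioc 0 t), K (t - s) = sys.K (t - s) := by
  have h1 := (Measure.measurePreserving_sub_left volume t).quasiMeasurePreserving.ae hK
  rw [ae_restrict_iff' measurableSet_Ioc]
  filter_upwards [h1, compl_mem_ae_iff.2 (measure_singleton t)] with s h2 h3 h4
  exact h2 ⟨sub_pos.2 (lt_of_le_of_ne h4.2 h3), by linarith [h4.1]⟩

theorem memK1_eq (hK : ∀ᵐ s, s ∈ Ioc 0 sys.T → K s = sys.K s) {t : ℝ} (ht : t ∈ Icc 0 sys.T)
    (Y : YSpace H t) : memK1 K t Y = mkY t (sys.histFun t Y.snd t) 0 := by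
  rw [memK1, histFun, intervalIntegral.integral_of_le ht.1]
  congr 1
  refine integral_congr_ae ?_
  filter_upwards [ae_K_sub_left hK ht.2] with s hs
  rw [hs]

theorem inner_memK2 (hK : ∀ᵐ s, s ∈ Ioc 0 sys.T → K s = sys.K s) {t : ℝ} (ht : t ∈ Icc 0 sys.T)
    (Y Z : YSpace H t) : inner ℂ Y (memK2 K t Z) = inner ℂ (sys.histFun t Y.snd t) Z.fst := by
  have h1 : (fun q => ((K (t - q) : ℝ) : ℂ) • Z.fst) =ᵐ[volume.restrict (Ioc (0 : ℝ) t)]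
      fun q => ((sys.K (t - q) : ℝ) : ℂ) • Z.fst := by
    filter_upwards [ae_K_sub_left hK ht.2] with s hs
    rw [hs]
  have h2 := toHist_coe (t := t) ((memLp_K_smul_const (sys := sys) t Z.fst).restrict _)
  rw [memK2, toHist_congr h1 |> fun h => (by rw [mkY, h]; rfl :
    mkY t (0 : H) (fun q => ((K (t - q) : ℝ) : ℂ) • Z.fst) =
      mkY t 0 fun q => ((sys.K (t - q) : ℝ) : ℂ) • Z.fst), inner_ySpace, mkY_fst, mkY_snd,
    inner_zero_right, zero_add, L2.inner_def, histFun, ← inner_conj_symm,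
    ← integral_inner (integrableOn_K_smul Y.snd t), ← integral_conj]
  refine integral_congr_ae ?_
  filter_upwards [h2] with q hq
  rw [hq, inner_conj_symm, inner_smul_left, inner_smul_right, Complex.conj_ofReal]

section Separable

variable [TopologicalSpace.SeparableSpace H]

theorem IsModel.compDirac1_eq (h : IsModel sys S K) {t : ℝ} (ht : t ∈ Icc 0 sys.T)
    (Y : YSpace H t) : (costKernel sys.T S K sys.B sys.Q t).compDirac1 t Y =
      (sys.trajOp t).adjoint (sys.cost t (sys.memoryOp t t Y.fst)) := by
  refine ySpace_ext ?_ ?_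
  · rw [adjoint_trajOp_fst]
    change P1 sys.T S K sys.B sys.Q t t Y.fst = _
    rw [h.P1_eq ht ⟨ht.1, le_rfl⟩]
    rfl
  · change toHist t (fun q => P2 sys.T S K sys.B sys.Q t t q Y.fst) = _
    rw [← toHist_self ((sys.trajOp t).adjoint (sys.cost t (sys.memoryOp t t Y.fst))).snd]
    refine toHist_congr ?_
    filter_upwards [sys.adjoint_trajOp_snd t (sys.cost t (sys.memoryOp t t Y.fst)),
      ae_restrict_mem measurableSet_Ioc] with q hq hq'
    rw [hq, h.P2_eq ht ⟨ht.1, le_rfl⟩ ⟨hq'.1.le, hq'.2⟩]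
    rfl

theorem inner_cost_comm (t : ℝ) (f g : L2R H) :
    inner ℂ (sys.cost t f) g = inner ℂ f (sys.cost t g) :=
  inner_costForm_comm sys.isPositive_weightOp f g

theorem IsModel.inner_costOp (h : IsModel sys S K) {t : ℝ} (ht : t ∈ Icc 0 sys.T)
    (Y Y' : YSpace H t) : inner ℂ Y' (costOp sys.T S K sys.B sys.Q t Y) =
      inner ℂ (sys.trajOp t Y') (sys.cost t (sys.trajOp t Y)) := by
  rw [h.costOp_eq ht, costMatrix, ContinuousLinearMap.comp_apply,
    ContinuousLinearMap.adjoint_inner_right, ContinuousLinearMap.comp_apply]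

theorem IsModel.riccatiForm_eq (h : IsModel sys S K)
    (hK : ∀ᵐ s, s ∈ Ioc 0 sys.T → K s = sys.K s) {t : ℝ} (ht : t ∈ Icc 0 sys.T)
    (Y Y' : YSpace H t) (a a' : H) :
    riccatiForm K sys.B sys.Q t (costOp sys.T S K sys.B sys.Q t)
      (costKernel sys.T S K sys.B sys.Q t) Y Y' a a' =
    inner ℂ (sys.cost t (sys.trajOp t Y')) (sys.trajRate Y.fst a (sys.histFun t Y.snd) t) +
      inner ℂ (sys.trajRate Y'.fst a' (sys.histFun t Y'.snd) t) (sys.cost t (sys.trajOp t Y)) -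
      inner ℂ (sys.B.adjoint ((sys.freeOp t).adjoint (sys.cost t (sys.trajOp t Y'))))
        (sys.B.adjoint ((sys.freeOp t).adjoint (sys.cost t (sys.trajOp t Y)))) +
      inner ℂ Y'.fst (sys.Q Y.fst) := by
  have hfst : (costOp sys.T S K sys.B sys.Q t Y).fst =
      (sys.freeOp t).adjoint (sys.cost t (sys.trajOp t Y)) := by
    rw [h.costOp_eq ht]
    exact sys.adjoint_trajOp_fst t _
  have e1 : inner ℂ Y' (costOp sys.T S K sys.B sys.Q t (mkY t a 0 + memK1 K t Y) +
      (costKernel sys.T S K sys.B sys.Q t).compDirac1 t Y) =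
      inner ℂ (sys.cost t (sys.trajOp t Y'))
        (sys.trajRate Y.fst a (sys.histFun t Y.snd) t) := by
    rw [inner_add_right, h.inner_costOp ht, h.compDirac1_eq ht,
      ContinuousLinearMap.adjoint_inner_right, ← inner_cost_comm, ← inner_cost_comm,
      ← inner_add_right, memK1_eq hK ht, map_add, trajOp_mkY_zero, trajOp_mkY_zero, trajRate,
      map_add]
  have e2 : inner ℂ (mkY t a' 0) (costOp sys.T S K sys.B sys.Q t Y) +
      inner ℂ Y' (memK2 K t (costOp sys.T S K sys.B sys.Q t Y) +
        (costKernel sys.T S K sys.B sys.Q t).dirac2Comp t Y) =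
      inner ℂ (sys.trajRate Y'.fst a' (sys.histFun t Y'.snd) t)
        (sys.cost t (sys.trajOp t Y)) := by
    rw [inner_add_right, inner_memK2 hK ht, hfst, h.inner_costOp ht, trajOp_mkY_zero,
      BlockKernel.dirac2Comp, h.costKernel_act1 ht ⟨ht.1, le_rfl⟩, inner_ySpace Y', mkY_fst,
      mkY_snd, toHist_zero, inner_zero_right, add_zero, ContinuousLinearMap.adjoint_inner_right,
      ContinuousLinearMap.adjoint_inner_right, trajRate, map_add, inner_add_left, inner_add_left]
    ring
  have e3 : inner ℂ Y' (costOp sys.T S K sys.B sys.Q t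
      (blockBB sys.B t (costOp sys.T S K sys.B sys.Q t Y))) =
      inner ℂ (sys.B.adjoint ((sys.freeOp t).adjoint (sys.cost t (sys.trajOp t Y'))))
        (sys.B.adjoint ((sys.freeOp t).adjoint (sys.cost t (sys.trajOp t Y)))) := by
    rw [h.inner_costOp ht, blockBB, hfst, trajOp_mkY_zero, ← inner_cost_comm,
      ContinuousLinearMap.adjoint_inner_left, ContinuousLinearMap.adjoint_inner_left]
  have e4 : inner ℂ Y' (blockQ sys.Q t Y) = inner ℂ Y'.fst (sys.Q Y.fst) := by
    rw [blockQ, inner_ySpace, mkY_fst, mkY_snd, toHist_zero, inner_zero_right, add_zero]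
  rw [riccatiForm, e1, e2, e3, e4]

theorem IsModel.riccatiForm_embedY (h : IsModel sys S K)
    (hK : ∀ᵐ s, s ∈ Ioc 0 sys.T → K s = sys.K s) {τ t : ℝ} (hτ : 0 ≤ τ) (ht : t ∈ Icc τ sys.T)
    (X X' : YSpace H τ) (a a' : H) :
    riccatiForm K sys.B sys.Q t (costOp sys.T S K sys.B sys.Q t)
      (costKernel sys.T S K sys.B sys.Q t) (embedY τ t X) (embedY τ t X') a a' =
    inner ℂ (sys.cost t (sys.traj X'.fst (sys.histOp τ X'.snd) t))
        (sys.trajRate X.fst a (sys.histFun τ X.snd) t) +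
      inner ℂ (sys.trajRate X'.fst a' (sys.histFun τ X'.snd) t)
        (sys.cost t (sys.traj X.fst (sys.histOp τ X.snd) t)) -
      inner ℂ (sys.optControl X'.fst (sys.histOp τ X'.snd) t t)
        (sys.optControl X.fst (sys.histOp τ X.snd) t t) +
      inner ℂ X'.fst (sys.Q X.fst) := by
  have h2 : ∀ X : YSpace H τ, sys.histFun t (embedY τ t X).snd = sys.histFun τ X.snd := fun X =>
    funext fun r => histFun_embedY ht.1 X r
  rw [h.riccatiForm_eq hK ⟨hτ.trans ht.1, ht.2⟩, trajOp_embedY ht.1, trajOp_embedY ht.1, h2, h2,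
    embedY_fst, embedY_fst, optControl, optControl]

theorem IsModel.hasDerivWithinAt_costOp (h : IsModel sys S K)
    (hK : ∀ᵐ s, s ∈ Ioc 0 sys.T → K s = sys.K s) (hΦ : ∀ x, sys.Φ 0 x = x) {τ t : ℝ}
    (hτ : 0 ≤ τ) (ht : t ∈ Icc τ sys.T) (X X' : YSpace H τ) {a a' : H}
    (hX : sys.IsRegular X.fst a) (hX' : sys.IsRegular X'.fst a') :
    HasDerivWithinAt
      (fun r => inner ℂ (embedY τ r X') (costOp sys.T S K sys.B sys.Q r (embedY τ r X)))
      (-riccatiForm K sys.B sys.Q t (costOp sys.T S K sys.B sys.Q t)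
        (costKernel sys.T S K sys.B sys.Q t) (embedY τ t X) (embedY τ t X') a a')
      (Icc τ sys.T) t := by
  have h3 : ∀ r ∈ Icc τ sys.T,
      inner ℂ (embedY τ r X') (costOp sys.T S K sys.B sys.Q r (embedY τ r X)) =
      inner ℂ (sys.traj X'.fst (sys.histOp τ X'.snd) r)
        (sys.cost r (sys.traj X.fst (sys.histOp τ X.snd) r)) := fun r hr => by
    rw [h.inner_costOp ⟨hτ.trans hr.1, hr.2⟩, trajOp_embedY hr.1, trajOp_embedY hr.1]
  rw [h.riccatiForm_embedY hK hτ ht]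
  exact (hX.hasDerivWithinAt_inner_cost hX' hΦ (continuous_histFun (sys := sys) τ X.snd)
    (continuous_histFun (sys := sys) τ X'.snd) (histOp_coe (sys := sys) τ X.snd)
    (histOp_coe (sys := sys) τ X'.snd) hτ ht).congr h3 (h3 t ht)

/-- The cost operators solve the Riccati equation. -/
theorem IsModel.solvesRiccatiWith (h : IsModel sys S K)
    (hK : ∀ᵐ s, s ∈ Ioc 0 sys.T → K s = sys.K s) (hΦ : ∀ x, sys.Φ 0 x = x) {A : H →ₗ.[ℂ] H}
    (hA : ∀ x a, (x, a) ∈ A.graph → sys.IsRegular x a) :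
    SolvesRiccatiWith sys.T A K sys.B sys.Q (costOp sys.T S K sys.B sys.Q)
      (costKernel sys.T S K sys.B sys.Q) := by
  obtain ⟨C, hC⟩ := h.exists_bound
  exact ⟨fun t ht => h.represents ⟨ht.1.le, ht.2⟩, ⟨C, fun t ht => hC t ⟨ht.1.le, ht.2⟩⟩,
    h.costOp_final, fun τ hτ X X' hX hX' t ht => h.hasDerivWithinAt_costOp hK hΦ hτ.1.le ht X X'
      (hA _ _ (A.mem_graph ⟨X.fst, hX.fst_mem⟩)) (hA _ _ (A.mem_graph ⟨X'.fst, hX'.fst_mem⟩))⟩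

end Separable

end MemorySystem

/-! ### Estimates for operator matrices by means of their entries -/

section BlockEstimates

variable {H U : Type*} [NormedAddCommGroup H] [InnerProductSpace ℂ H] [CompleteSpace H]
    [NormedAddCommGroup U] [InnerProductSpace ℂ U] [CompleteSpace U]

theorem strCont_clamp {E F : Type*} [NormedAddCommGroup E] [NormedSpace ℂ E]
    [NormedAddCommGroup F] [NormedSpace ℂ F] {a : ℝ → E →L[ℂ] F} {t : ℝ} (ht : 0 ≤ t)
    (ha : ∀ x, ContinuousOn (fun s => a s x) (Icc 0 t)) : StrCont fun s => a (max 0 (min s t)) :=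
  fun x => (ha x).comp_continuous (f := fun s => max 0 (min s t)) (by fun_prop) fun _ =>
    ⟨le_max_left _ _, max_le ht (min_le_right _ _)⟩

theorem clamp_of_mem {s t : ℝ} (hs : s ∈ Icc 0 t) : max 0 (min s t) = s := by
  rw [min_eq_left hs.2, max_eq_right hs.1]

theorem integrableOn_apply_hist {F : Type*} [NormedAddCommGroup F] [InnerProductSpace ℂ F]
    {a : ℝ → H →L[ℂ] F} {t : ℝ} (ht : 0 ≤ t)
    (ha : ∀ x, ContinuousOn (fun s => a s x) (Icc 0 t)) (f : HistSpace H t) :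
    IntegrableOn (fun s => a s (f s)) (Ioc 0 t) := by
  refine (MemorySystem.integrableOn_strCont_hist (strCont_clamp ht ha) f).congr_fun
    (fun s hs => ?_) measurableSet_Ioc
  simp only [clamp_of_mem (Ioc_subset_Icc_self hs)]

theorem integrableOn_hist {t : ℝ} (f : HistSpace H t) : IntegrableOn f (Ioc 0 t) volume :=
  MemorySystem.integrableOn_strCont_hist (StrCont.const (1 : H →L[ℂ] H)) f

variable {t : ℝ}

/-- The size of an element of `Y_t`, the history being measured in `L¹`. -/
def ySize (Y : YSpace H t) : ℝ := ‖Y.fst‖ + ∫ s in Ioc 0 t, ‖Y.snd s‖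

theorem ySize_nonneg (Y : YSpace H t) : 0 ≤ ySize Y :=
  add_nonneg (norm_nonneg _) (integral_nonneg fun _ => norm_nonneg _)

theorem norm_fst_le_ySize (Y : YSpace H t) : ‖Y.fst‖ ≤ ySize Y :=
  le_add_of_nonneg_right (integral_nonneg fun _ => norm_nonneg _)

theorem ySize_mkY_zero (x : H) : ySize (mkY t x 0) = ‖x‖ := by
  have h : ∫ s in Ioc 0 t, ‖(mkY t x 0).snd s‖ = 0 := by
    rw [mkY_snd, toHist_zero]
    refine (integral_congr_ae ?_).trans (integral_zero ℝ ℝ)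
    filter_upwards [Lp.coeFn_zero H 2 (volume.restrict (Ioc (0 : ℝ) t))] with s hs
    rw [hs, Pi.zero_apply, norm_zero]
  rw [ySize, h, mkY_fst, add_zero]

theorem ySize_embedY {τ : ℝ} (h : τ ≤ t) (X : YSpace H τ) : ySize (embedY τ t X) = ySize X := by
  have h1 : ∫ s in Ioc 0 t, ‖(embedY τ t X).snd s‖ =
      ∫ s in Ioc 0 t, (Ioc 0 τ).indicator (fun s => ‖X.snd s‖) s := by
    refine integral_congr_ae ?_
    filter_upwards [embedY_snd_coe h X] with s hs
    rw [hs, norm_indicator_eq_indicator_norm]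
  rw [ySize, h1, setIntegral_indicator measurableSet_Ioc,
    inter_eq_right.2 (Ioc_subset_Ioc_right h), embedY_fst]
  rfl

theorem norm_inner_hist_le {f g : HistSpace H t} {c : ℝ}
    (hg : ∀ᵐ q ∂volume.restrict (Ioc (0 : ℝ) t), ‖g q‖ ≤ c) :
    ‖(inner ℂ f g : ℂ)‖ ≤ c * ∫ s in Ioc 0 t, ‖f s‖ := by
  rw [L2.inner_def, ← integral_const_mul]
  refine norm_integral_le_of_norm_le ((integrableOn_hist f).norm.const_mul c) ?_
  filter_upwards [hg] with q hq
  rw [mul_comm]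
  exact (norm_inner_le_norm _ _).trans (mul_le_mul_of_nonneg_left hq (norm_nonneg _))

theorem norm_inner_ySpace_le {Y Z : YSpace H t} {c : ℝ} (h1 : ‖Z.fst‖ ≤ c)
    (h2 : ∀ᵐ q ∂volume.restrict (Ioc (0 : ℝ) t), ‖Z.snd q‖ ≤ c) :
    ‖(inner ℂ Y Z : ℂ)‖ ≤ c * ySize Y := by
  rw [inner_ySpace, ySize, mul_add, mul_comm c]
  exact (norm_add_le _ _).trans (add_le_add ((norm_inner_le_norm _ _).trans
    (mul_le_mul_of_nonneg_left h1 (norm_nonneg _))) (norm_inner_hist_le h2))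

namespace BlockKernel

variable {k k₁ k₂ : BlockKernel H} {V V₁ V₂ : YSpace H t →L[ℂ] YSpace H t} {N : ℝ}

/-- The difference of two systems of matrix entries. -/
def sub (k₁ k₂ : BlockKernel H) : BlockKernel H where
  k00 := k₁.k00 - k₂.k00
  k01 := fun s => k₁.k01 s - k₂.k01 s
  k10 := fun q => k₁.k10 q - k₂.k10 q
  k11 := fun s q => k₁.k11 s q - k₂.k11 s q

theorem Represents.continuousOn_k11 (h : k.Represents t V) {q : ℝ} (hq : q ∈ Icc 0 t) (x : H) :
    ContinuousOn (fun s => k.k11 s q x) (Icc 0 t) :=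
  (h.cont11 x).comp (f := fun s => (s, q)) (by fun_prop) fun _ hs => ⟨hs, hq⟩

theorem Represents.act0_sub (ht : 0 ≤ t) (h₁ : k₁.Represents t V₁) (h₂ : k₂.Represents t V₂)
    (Y : YSpace H t) : (k₁.sub k₂).act0 t Y = k₁.act0 t Y - k₂.act0 t Y := by
  simp only [act0, sub, _root_.sub_apply, intervalIntegral.integral_of_le ht]
  rw [integral_sub (integrableOn_apply_hist ht h₁.cont01 Y.snd)
    (integrableOn_apply_hist ht h₂.cont01 Y.snd)]
  abel

theorem Represents.act1_sub (ht : 0 ≤ t) (h₁ : k₁.Represents t V₁) (h₂ : k₂.Represents t V₂)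
    (Y : YSpace H t) {q : ℝ} (hq : q ∈ Icc 0 t) :
    (k₁.sub k₂).act1 t Y q = k₁.act1 t Y q - k₂.act1 t Y q := by
  simp only [act1, sub, _root_.sub_apply, intervalIntegral.integral_of_le ht]
  rw [integral_sub (integrableOn_apply_hist ht (h₁.continuousOn_k11 hq) Y.snd)
    (integrableOn_apply_hist ht (h₂.continuousOn_k11 hq) Y.snd)]
  abel

theorem Represents.sub (ht : 0 ≤ t) (h₁ : k₁.Represents t V₁) (h₂ : k₂.Represents t V₂) :
    (k₁.sub k₂).Represents t (V₁ - V₂) where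
  cont01 x := (h₁.cont01 x).sub (h₂.cont01 x)
  cont10 x := (h₁.cont10 x).sub (h₂.cont10 x)
  cont11 x := (h₁.cont11 x).sub (h₂.cont11 x)
  fst_eq Y := by
    rw [Represents.act0_sub ht h₁ h₂, ← h₁.fst_eq, ← h₂.fst_eq]
    rfl
  snd_eq Y := by
    have h3 : ((V₁ - V₂) Y).snd = (V₁ Y).snd - (V₂ Y).snd := rfl
    rw [h3]
    filter_upwards [Lp.coeFn_sub (V₁ Y).snd (V₂ Y).snd, h₁.snd_eq Y, h₂.snd_eq Y,
      ae_restrict_mem measurableSet_Ioc] with q e1 e2 e3 hq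
    rw [e1, Pi.sub_apply, e2, e3, Represents.act1_sub ht h₁ h₂ Y (Ioc_subset_Icc_self hq)]

theorem BoundedBy.sub {N₁ N₂ : ℝ} (h₁ : k₁.BoundedBy t N₁) (h₂ : k₂.BoundedBy t N₂) :
    (k₁.sub k₂).BoundedBy t (N₁ + N₂) where
  bound00 := (norm_sub_le _ _).trans (add_le_add h₁.bound00 h₂.bound00)
  bound01 s hs := (norm_sub_le _ _).trans (add_le_add (h₁.bound01 s hs) (h₂.bound01 s hs))
  bound10 s hs := (norm_sub_le _ _).trans (add_le_add (h₁.bound10 s hs) (h₂.bound10 s hs))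
  bound11 s hs q hq :=
    (norm_sub_le _ _).trans (add_le_add (h₁.bound11 s hs q hq) (h₂.bound11 s hs q hq))

theorem BoundedBy.nonneg (h : k.BoundedBy t N) : 0 ≤ N :=
  (ContinuousLinearMap.opNorm_nonneg _).trans h.bound00

theorem norm_integral_apply_hist_le {a : ℝ → H →L[ℂ] H} (ha : ∀ s ∈ Icc 0 t, ‖a s‖ ≤ N)
    (ht : 0 ≤ t) (f : HistSpace H t) :
    ‖∫ s in (0 : ℝ)..t, a s (f s)‖ ≤ N * ∫ s in Ioc 0 t, ‖f s‖ := by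
  rw [intervalIntegral.integral_of_le ht, ← integral_const_mul]
  refine norm_integral_le_of_norm_le ((integrableOn_hist f).norm.const_mul N) ?_
  rw [ae_restrict_iff' measurableSet_Ioc]
  exact ae_of_all _ fun s hs =>
    ContinuousLinearMap.le_of_opNorm_le _ (ha s (Ioc_subset_Icc_self hs)) _

theorem BoundedBy.norm_act0_le (h : k.BoundedBy t N) (ht : 0 ≤ t) (Y : YSpace H t) :
    ‖k.act0 t Y‖ ≤ N * ySize Y := by
  rw [act0, ySize, mul_add]
  exact (norm_add_le _ _).trans (add_le_add (ContinuousLinearMap.le_of_opNorm_le _ h.bound00 _)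
    (norm_integral_apply_hist_le h.bound01 ht _))

theorem BoundedBy.norm_act1_le (h : k.BoundedBy t N) (ht : 0 ≤ t) (Y : YSpace H t) {q : ℝ}
    (hq : q ∈ Icc 0 t) : ‖k.act1 t Y q‖ ≤ N * ySize Y := by
  rw [act1, ySize, mul_add]
  exact (norm_add_le _ _).trans (add_le_add
    (ContinuousLinearMap.le_of_opNorm_le _ (h.bound10 q hq) _)
    (norm_integral_apply_hist_le (fun s hs => h.bound11 s hs q hq) ht _))

theorem Represents.norm_fst_le (hV : k.Represents t V) (h : k.BoundedBy t N) (ht : 0 ≤ t)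
    (Y : YSpace H t) : ‖(V Y).fst‖ ≤ N * ySize Y := by
  rw [hV.fst_eq]
  exact h.norm_act0_le ht Y

theorem Represents.norm_inner_le (hV : k.Represents t V) (h : k.BoundedBy t N) (ht : 0 ≤ t)
    (Y Y' : YSpace H t) : ‖(inner ℂ Y' (V Y) : ℂ)‖ ≤ N * ySize Y * ySize Y' := by
  refine norm_inner_ySpace_le (hV.norm_fst_le h ht Y) ?_
  filter_upwards [hV.snd_eq Y, ae_restrict_mem measurableSet_Ioc] with q hq hq'
  rw [hq]
  exact h.norm_act1_le ht Y (Ioc_subset_Icc_self hq')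

theorem Represents.norm_inner_compDirac1_le (hV : k.Represents t V) (h : k.BoundedBy t N)
    (ht : 0 ≤ t) (Y Y' : YSpace H t) :
    ‖(inner ℂ Y' (k.compDirac1 t Y) : ℂ)‖ ≤ N * ‖Y.fst‖ * ySize Y' := by
  have htt : t ∈ Icc 0 t := ⟨ht, le_rfl⟩
  refine norm_inner_ySpace_le ?_ ?_
  · exact ContinuousLinearMap.le_of_opNorm_le _ (h.bound01 t htt) _
  · have hc : ContinuousOn (fun q => k.k11 t q Y.fst) (Icc 0 t) :=
      (hV.cont11 Y.fst).comp (f := fun q => (t, q)) (by fun_prop) fun _ hq => ⟨htt, hq⟩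
    filter_upwards [toHist_coe (memLp_hist_of_continuousOn hc),
      ae_restrict_mem measurableSet_Ioc] with q hq hq'
    rw [compDirac1, mkY_snd, hq]
    exact ContinuousLinearMap.le_of_opNorm_le _ (h.bound11 t htt q (Ioc_subset_Icc_self hq')) _

theorem BoundedBy.norm_inner_dirac2Comp_le (h : k.BoundedBy t N) (ht : 0 ≤ t)
    (Y Y' : YSpace H t) : ‖(inner ℂ Y' (k.dirac2Comp t Y) : ℂ)‖ ≤ N * ySize Y * ‖Y'.fst‖ := by
  rw [dirac2Comp, inner_ySpace, mkY_fst, mkY_snd, toHist_zero, inner_zero_right, add_zero,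
    mul_comm _ ‖Y'.fst‖]
  exact (norm_inner_le_norm _ _).trans
    (mul_le_mul_of_nonneg_left (h.norm_act1_le ht Y ⟨ht, le_rfl⟩) (norm_nonneg _))

theorem Represents.compDirac1_sub (ht : 0 ≤ t) (h₁ : k₁.Represents t V₁)
    (h₂ : k₂.Represents t V₂) (Y : YSpace H t) :
    (k₁.sub k₂).compDirac1 t Y = k₁.compDirac1 t Y - k₂.compDirac1 t Y := by
  have htt : t ∈ Icc 0 t := ⟨ht, le_rfl⟩
  have hc : ∀ {k : BlockKernel H} {V : YSpace H t →L[ℂ] YSpace H t}, k.Represents t V →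
      MemLp (fun q => k.k11 t q Y.fst) 2 (volume.restrict (Ioc (0 : ℝ) t)) := fun hV =>
    memLp_hist_of_continuousOn
      ((hV.cont11 Y.fst).comp (f := fun q => (t, q)) (by fun_prop) fun _ hq => ⟨htt, hq⟩)
  refine ySpace_ext rfl ?_
  change toHist t (fun q => (k₁.k11 t q - k₂.k11 t q) Y.fst) =
    toHist t (fun q => k₁.k11 t q Y.fst) - toHist t (fun q => k₂.k11 t q Y.fst)
  refine Lp.ext ?_
  filter_upwards [toHist_coe (hc (Represents.sub ht h₁ h₂)), toHist_coe (hc h₁), toHist_coe (hc h₂),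
    Lp.coeFn_sub (toHist t fun q => k₁.k11 t q Y.fst) (toHist t fun q => k₂.k11 t q Y.fst)]
    with q e1 e2 e3 e4
  rw [e4, Pi.sub_apply, e2, e3]
  exact e1

theorem Represents.dirac2Comp_sub (ht : 0 ≤ t) (h₁ : k₁.Represents t V₁)
    (h₂ : k₂.Represents t V₂) (Y : YSpace H t) :
    (k₁.sub k₂).dirac2Comp t Y = k₁.dirac2Comp t Y - k₂.dirac2Comp t Y := by
  refine ySpace_ext ?_ ?_
  · exact Represents.act1_sub ht h₁ h₂ Y ⟨ht, le_rfl⟩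
  · change toHist t (0 : ℝ → H) = toHist t (0 : ℝ → H) - toHist t (0 : ℝ → H)
    rw [toHist_zero, sub_zero]

end BlockKernel

end BlockEstimates

/-! ### The equation for the difference of two solutions -/

section Difference

variable {H U : Type*} [NormedAddCommGroup H] [InnerProductSpace ℂ H] [CompleteSpace H]
    [NormedAddCommGroup U] [InnerProductSpace ℂ U] [CompleteSpace U]
    {sys : MemorySystem H U} {K : ℝ → ℝ} {t : ℝ}

theorem norm_comp_adjoint_apply_le (B : U →L[ℂ] H) (x : H) {c : ℝ} (hx : ‖x‖ ≤ c) :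
    ‖B (B.adjoint x)‖ ≤ ‖B‖ * (‖B‖ * c) := by
  refine B.le_opNorm_of_le (ContinuousLinearMap.le_of_opNorm_le_of_le _ ?_ hx)
  rw [LinearIsometryEquiv.norm_map]

/-- Up to the terms with the generator, the difference of the two Riccati forms is of first order
in the difference of the solutions, with the entries of this difference as coefficients. -/
theorem norm_riccatiForm_sub_le (hK : ∀ᵐ s, s ∈ Ioc 0 sys.T → K s = sys.K s)
    (ht : t ∈ Icc 0 sys.T) {k₁ k₂ : BlockKernel H} {V₁ V₂ : YSpace H t →L[ℂ] YSpace H t}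
    {N C : ℝ} (h₁ : k₁.Represents t V₁) (h₂ : k₂.Represents t V₂) (hC₁ : k₁.BoundedBy t C)
    (hC₂ : k₂.BoundedBy t C) (hN : (k₁.sub k₂).BoundedBy t N) (Q : H →L[ℂ] H) (B : U →L[ℂ] H)
    (Y Y' : YSpace H t) (a a' : H) :
    ‖riccatiForm K B Q t V₁ k₁ Y Y' a a' - riccatiForm K B Q t V₂ k₂ Y Y' a a' -
      (inner ℂ Y' ((V₁ - V₂) (mkY t a 0)) + inner ℂ (mkY t a' 0) ((V₁ - V₂) Y))‖ ≤
    N * (2 * (1 + ‖B‖ * (‖B‖ * C)) * (ySize Y * ySize Y') +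
      ‖sys.histFun t Y.snd t‖ * ySize Y' + ySize Y * ‖sys.histFun t Y'.snd t‖) := by
  have hD := BlockKernel.Represents.sub ht.1 h₁ h₂
  have hN0 := hN.nonneg
  have hC0 := hC₁.nonneg
  set D := V₁ - V₂ with hDdef
  have hDY : ∀ Z, D Z = V₁ Z - V₂ Z := fun Z => rfl
  have e1 : ‖(inner ℂ Y' (D (memK1 K t Y)) : ℂ)‖ ≤
      N * ‖sys.histFun t Y.snd t‖ * ySize Y' := by
    have := hD.norm_inner_le hN ht.1 (memK1 K t Y) Y'
    rwa [MemorySystem.memK1_eq hK ht, ySize_mkY_zero, ← MemorySystem.memK1_eq hK ht] at this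
  have e2 : ‖(inner ℂ Y' ((k₁.sub k₂).compDirac1 t Y) : ℂ)‖ ≤ N * (ySize Y * ySize Y') := by
    refine (hD.norm_inner_compDirac1_le hN ht.1 Y Y').trans ?_
    rw [mul_assoc]
    exact mul_le_mul_of_nonneg_left (mul_le_mul_of_nonneg_right (norm_fst_le_ySize Y)
      (ySize_nonneg Y')) hN0
  have e3 : ‖(inner ℂ (sys.histFun t Y'.snd t) (D Y).fst : ℂ)‖ ≤
      N * (ySize Y * ‖sys.histFun t Y'.snd t‖) := by
    refine (norm_inner_le_norm _ _).trans ?_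
    rw [mul_comm, ← mul_assoc]
    exact mul_le_mul_of_nonneg_right (hD.norm_fst_le hN ht.1 Y) (norm_nonneg _)
  have e4 : ‖(inner ℂ Y' ((k₁.sub k₂).dirac2Comp t Y) : ℂ)‖ ≤ N * (ySize Y * ySize Y') := by
    refine (hN.norm_inner_dirac2Comp_le ht.1 Y Y').trans ?_
    rw [mul_assoc]
    exact mul_le_mul_of_nonneg_left (mul_le_mul_of_nonneg_left (norm_fst_le_ySize Y')
      (ySize_nonneg Y)) hN0
  have e5 : ‖(inner ℂ Y' (D (blockBB B t (V₁ Y))) : ℂ)‖ ≤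
      N * (‖B‖ * (‖B‖ * C)) * (ySize Y * ySize Y') := by
    refine (hD.norm_inner_le hN ht.1 _ Y').trans ?_
    rw [blockBB, ySize_mkY_zero]
    have := norm_comp_adjoint_apply_le B _ (h₁.norm_fst_le hC₁ ht.1 Y)
    calc N * ‖B (B.adjoint (V₁ Y).fst)‖ * ySize Y'
        ≤ N * (‖B‖ * (‖B‖ * (C * ySize Y))) * ySize Y' := by
          gcongr
          exact ySize_nonneg Y'
      _ = _ := by ring
  have e6 : ‖(inner ℂ Y' (V₂ (blockBB B t (D Y))) : ℂ)‖ ≤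
      N * (‖B‖ * (‖B‖ * C)) * (ySize Y * ySize Y') := by
    refine (h₂.norm_inner_le hC₂ ht.1 _ Y').trans ?_
    rw [blockBB, ySize_mkY_zero]
    have := norm_comp_adjoint_apply_le B _ (hD.norm_fst_le hN ht.1 Y)
    calc C * ‖B (B.adjoint (D Y).fst)‖ * ySize Y'
        ≤ C * (‖B‖ * (‖B‖ * (N * ySize Y))) * ySize Y' := by
          gcongr
          exact ySize_nonneg Y'
      _ = _ := by ring
  have hbb : blockBB B t (V₁ Y) - blockBB B t (V₂ Y) = blockBB B t (D Y) := by
    refine ySpace_ext ?_ ?_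
    · change B (B.adjoint (V₁ Y).fst) - B (B.adjoint (V₂ Y).fst) =
        B (B.adjoint ((V₁ Y).fst - (V₂ Y).fst))
      rw [map_sub, map_sub]
    · change toHist t (0 : ℝ → H) - toHist t (0 : ℝ → H) = toHist t (0 : ℝ → H)
      rw [toHist_zero, sub_zero]
  have e7 : riccatiForm K B Q t V₁ k₁ Y Y' a a' - riccatiForm K B Q t V₂ k₂ Y Y' a a' -
      (inner ℂ Y' (D (mkY t a 0)) + inner ℂ (mkY t a' 0) (D Y)) =
      inner ℂ Y' (D (memK1 K t Y)) + inner ℂ Y' ((k₁.sub k₂).compDirac1 t Y) +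
      inner ℂ (sys.histFun t Y'.snd t) (D Y).fst + inner ℂ Y' ((k₁.sub k₂).dirac2Comp t Y) -
      inner ℂ Y' (D (blockBB B t (V₁ Y))) - inner ℂ Y' (V₂ (blockBB B t (D Y))) := by
    have hf : (D Y).fst = (V₁ Y).fst - (V₂ Y).fst := rfl
    rw [BlockKernel.Represents.compDirac1_sub ht.1 h₁ h₂,
      BlockKernel.Represents.dirac2Comp_sub ht.1 h₁ h₂, ← hbb, hf]
    simp only [riccatiForm, hDY, map_add, map_sub, inner_add_right, inner_sub_right,
      MemorySystem.inner_memK2 hK ht]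
    ring
  rw [e7]
  refine (norm_sub_le _ _).trans ((add_le_add ((norm_sub_le _ _).trans (add_le_add
    ((norm_add_le _ _).trans (add_le_add ((norm_add_le _ _).trans (add_le_add
    ((norm_add_le _ _).trans (add_le_add e1 e2)) e3)) e4)) e5)) e6).trans_eq ?_)
  ring

theorem toHist_indicator_coe (τ t : ℝ) (f : HistSpace H τ) :
    toHist t ((Ioc 0 τ).indicator f) =ᵐ[volume.restrict (Ioc (0 : ℝ) t)]
      (Ioc 0 τ).indicator f := by
  refine toHist_coe ?_
  rw [memLp_indicator_iff_restrict measurableSet_Ioc,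
    Measure.restrict_restrict measurableSet_Ioc]
  exact (Lp.memLp f).mono_measure (Measure.restrict_mono_set _ inter_subset_left)

/-- Extension of histories by `0`, as a bounded operator. -/
def histEmbedL (τ t : ℝ) : HistSpace H τ →L[ℂ] HistSpace H t :=
  LinearMap.mkContinuous
    { toFun := fun f => toHist t ((Ioc 0 τ).indicator f)
      map_add' := fun f g => by
        refine Lp.ext ?_
        have h1 := (ae_restrict_iff' measurableSet_Ioc).1 (Lp.coeFn_add f g)
        filter_upwards [toHist_indicator_coe τ t f, toHist_indicator_coe τ t g,
          toHist_indicator_coe τ t (f + g), Lp.coeFn_add (toHist t ((Ioc 0 τ).indicator f))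
            (toHist t ((Ioc 0 τ).indicator g)), ae_restrict_of_ae h1] with s e1 e2 e3 e4 e5
        rw [e3, e4, Pi.add_apply, e1, e2]
        by_cases hs : s ∈ Ioc 0 τ
        · rw [indicator_of_mem hs, indicator_of_mem hs, indicator_of_mem hs]
          exact e5 hs
        · rw [indicator_of_notMem hs, indicator_of_notMem hs, indicator_of_notMem hs, add_zero]
      map_smul' := fun c f => by
        refine Lp.ext ?_
        have h1 := (ae_restrict_iff' measurableSet_Ioc).1 (Lp.coeFn_smul c f)
        filter_upwards [toHist_indicator_coe τ t f, toHist_indicator_coe τ t (c • f),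
          Lp.coeFn_smul c (toHist t ((Ioc 0 τ).indicator f)), ae_restrict_of_ae h1]
          with s e1 e3 e4 e5
        rw [e3, RingHom.id_apply, e4, Pi.smul_apply, e1]
        by_cases hs : s ∈ Ioc 0 τ
        · rw [indicator_of_mem hs, indicator_of_mem hs]
          exact e5 hs
        · rw [indicator_of_notMem hs, indicator_of_notMem hs, smul_zero] } 1
    (fun f => by
      change ‖toHist t ((Ioc 0 τ).indicator f)‖ ≤ _
      rw [one_mul, Lp.norm_def, Lp.norm_def]
      refine ENNReal.toReal_mono (Lp.eLpNorm_ne_top _) ?_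
      rw [eLpNorm_congr_ae (toHist_indicator_coe τ t f),
        eLpNorm_indicator_eq_eLpNorm_restrict measurableSet_Ioc,
        Measure.restrict_restrict measurableSet_Ioc]
      exact eLpNorm_mono_measure _ (Measure.restrict_mono_set _ inter_subset_left))

theorem histEmbedL_apply (τ t : ℝ) (f : HistSpace H τ) :
    histEmbedL τ t f = toHist t ((Ioc 0 τ).indicator f) := rfl

theorem norm_histEmbedL_le (τ t : ℝ) :
    ‖(histEmbedL τ t : HistSpace H τ →L[ℂ] HistSpace H t)‖ ≤ 1 :=
  LinearMap.mkContinuous_norm_le _ zero_le_one _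

/-- The inclusion of `Y_τ` in `Y_t` as a bounded operator. -/
def embedL (τ t : ℝ) : YSpace H τ →L[ℂ] YSpace H t :=
  (WithLp.prodContinuousLinearEquiv 2 ℂ H (HistSpace H t)).symm.toContinuousLinearMap ∘L
    (WithLp.fstL 2 ℂ H (HistSpace H τ)).prod
      (histEmbedL τ t ∘L WithLp.sndL 2 ℂ H (HistSpace H τ))

theorem embedL_apply (τ t : ℝ) (X : YSpace H τ) : embedL τ t X = embedY τ t X :=
  ySpace_ext rfl rfl

theorem norm_embedY_le (τ t : ℝ) (X : YSpace H τ) : ‖embedY τ t X‖ ≤ ‖X‖ := by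
  have h0 := norm_histEmbedL_le (H := H) τ t
  have h : ‖histEmbedL τ t X.snd‖ ≤ 1 * ‖X.snd‖ := ContinuousLinearMap.le_of_opNorm_le _ h0 _
  rw [one_mul, histEmbedL_apply] at h
  have h2 : (embedY τ t X).snd = toHist t ((Ioc 0 τ).indicator X.snd) := by
    rw [embedY, mkY_snd]
  rw [← h2] at h
  rw [WithLp.prod_norm_eq_of_L2, WithLp.prod_norm_eq_of_L2, embedY_fst]
  refine Real.sqrt_le_sqrt ?_
  nlinarith [norm_nonneg (embedY τ t X).snd]

theorem norm_embedL_le (τ t : ℝ) : ‖(embedL τ t : YSpace H τ →L[ℂ] YSpace H t)‖ ≤ 1 :=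
  ContinuousLinearMap.opNorm_le_bound _ zero_le_one fun X => by
    rw [one_mul, embedL_apply]
    exact norm_embedY_le τ t X

/-- The operator on `Y_τ` compressed from an operator on `Y_t`. -/
def compress (τ : ℝ) (V : (t : ℝ) → YSpace H t →L[ℂ] YSpace H t) (t : ℝ) :
    YSpace H τ →L[ℂ] YSpace H τ :=
  (embedL τ t).adjoint ∘L V t ∘L embedL τ t

theorem inner_compress (τ : ℝ) (V : (t : ℝ) → YSpace H t →L[ℂ] YSpace H t) (t : ℝ)
    (X X' : YSpace H τ) :
    inner ℂ X' (compress τ V t X) = inner ℂ (embedY τ t X') (V t (embedY τ t X)) := by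
  rw [compress, ContinuousLinearMap.comp_apply, ContinuousLinearMap.adjoint_inner_right,
    ContinuousLinearMap.comp_apply, embedL_apply, embedL_apply]

theorem norm_compress_le (τ : ℝ) (V : (t : ℝ) → YSpace H t →L[ℂ] YSpace H t) (t : ℝ) {C : ℝ}
    (hC : ‖V t‖ ≤ C) : ‖compress τ V t‖ ≤ C := by
  have := MemorySystem.norm_adjoint_comp_comp_le (norm_embedL_le (H := H) τ t)
    (norm_embedL_le τ t) hC
  rwa [one_mul, mul_one] at this

theorem embedY_self (X : YSpace H t) : embedY t t X = X := by
  refine ySpace_ext (embedY_fst X) (Lp.ext ?_)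
  filter_upwards [embedY_snd_coe le_rfl X, ae_restrict_mem measurableSet_Ioc] with s h1 h2
  rw [h1, indicator_of_mem h2]

theorem embedY_mkY_zero (τ t : ℝ) (x : H) : embedY τ t (mkY τ x 0) = mkY t x 0 := by
  refine ySpace_ext (by rw [embedY_fst, mkY_fst, mkY_fst]) ?_
  rw [embedY, mkY_snd, mkY_snd, mkY_snd]
  refine toHist_congr (ae_restrict_of_ae ?_)
  have h := (ae_restrict_iff' measurableSet_Ioc).1
    (toHist_coe (t := τ) (MemLp.zero : MemLp (0 : ℝ → H) 2 _))
  filter_upwards [h] with s hs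
  by_cases h' : s ∈ Ioc 0 τ
  · rw [indicator_of_mem h']
    exact hs h'
  · rw [indicator_of_notMem h']
    rfl

end Difference

/-! ### The difference of two solutions along moving test elements -/

section MovingTest

/-- A product rule for the pairing `⟨X'(s), D(s) X(s)⟩` of differentiable curves with bounded
operators that are only differentiable in a weak sense. -/
theorem hasDerivWithinAt_inner_apply {E : Type*} [NormedAddCommGroup E] [InnerProductSpace ℂ E]
    {D : ℝ → E →L[ℂ] E} {X X' : ℝ → E} {v v' : E} {l : ℂ} {I : Set ℝ} {r C : ℝ}
    (hC : ∀ s ∈ I, ‖D s‖ ≤ C) (hX : HasDerivWithinAt X v I r) (hX' : HasDerivWithinAt X' v' I r)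
    (h0 : HasDerivWithinAt (fun s => (inner ℂ (X' r) (D s (X r)) : ℂ)) l I r)
    (h1 : ContinuousWithinAt (fun s => (inner ℂ (X' r) (D s v) : ℂ)) I r)
    (h2 : ContinuousWithinAt (fun s => (inner ℂ v' (D s (X r)) : ℂ)) I r) :
    HasDerivWithinAt (fun s => (inner ℂ (X' s) (D s (X s)) : ℂ))
      (inner ℂ v' (D r (X r)) + inner ℂ (X' r) (D r v) + l) I r := by
  have hXc := hX'.continuousWithinAt
  rw [hasDerivWithinAt_iff_tendsto_slope] at hX hX' h0 ⊢
  have hle : 𝓝[I \ {r}] r ≤ 𝓝[I] r := nhdsWithin_mono _ sdiff_subset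
  have hbd : ∀ {w u : ℝ → E} {w₀ : E}, Tendsto w (𝓝[I \ {r}] r) (𝓝 w₀) →
      Tendsto u (𝓝[I \ {r}] r) (𝓝 0) →
      Tendsto (fun s => (inner ℂ (w s) (D s (u s)) : ℂ)) (𝓝[I \ {r}] r) (𝓝 0) := by
    intro w u w₀ hw hu
    have h3 : Tendsto (fun s => ‖w s‖ * (C * ‖u s‖)) (𝓝[I \ {r}] r) (𝓝 (‖w₀‖ * (C * ‖(0 : E)‖))) :=
      hw.norm.mul (hu.norm.const_mul C)
    rw [norm_zero, mul_zero, mul_zero] at h3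
    refine squeeze_zero_norm' ?_ h3
    filter_upwards [self_mem_nhdsWithin] with s hs
    exact (norm_inner_le_norm _ _).trans (mul_le_mul_of_nonneg_left
      (ContinuousLinearMap.le_of_opNorm_le _ (hC s hs.1) _) (norm_nonneg _))
  have hbd' : ∀ {w : ℝ → E} {u : E}, Tendsto w (𝓝[I \ {r}] r) (𝓝 0) →
      Tendsto (fun s => (inner ℂ (w s) (D s u) : ℂ)) (𝓝[I \ {r}] r) (𝓝 0) := by
    intro w u hw
    have h3 : Tendsto (fun s => ‖w s‖ * (C * ‖u‖)) (𝓝[I \ {r}] r) (𝓝 (‖(0 : E)‖ * (C * ‖u‖))) :=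
      hw.norm.mul_const _
    rw [norm_zero, zero_mul] at h3
    refine squeeze_zero_norm' ?_ h3
    filter_upwards [self_mem_nhdsWithin] with s hs
    exact (norm_inner_le_norm _ _).trans (mul_le_mul_of_nonneg_left
      (ContinuousLinearMap.le_of_opNorm_le _ (hC s hs.1) _) (norm_nonneg _))
  have hXr : Tendsto X' (𝓝[I \ {r}] r) (𝓝 (X' r)) := hXc.mono_left hle
  have t1 := hbd hXr (tendsto_sub_nhds_zero_iff.2 hX)
  have t2 := hbd' (u := v) (tendsto_sub_nhds_zero_iff.2 hXr)
  have t3 := h1.tendsto.mono_left hle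
  have t4 := hbd' (u := X r) (tendsto_sub_nhds_zero_iff.2 hX')
  have t5 := h2.tendsto.mono_left hle
  have hsum := ((((t4.add t5).add t1).add t2).add t3).add h0
  simp only [zero_add, add_zero] at hsum
  refine hsum.congr fun s => ?_
  have hs : ∀ (c : ℝ) (y z : E) , inner ℂ y (D s (c • z)) = (c : ℂ) * inner ℂ y (D s z) :=
    fun c y z => by rw [← Complex.coe_smul, map_smul, inner_smul_right]
  have hs' : ∀ (c : ℝ) (y z : E), inner ℂ (c • y) z = (c : ℂ) * inner ℂ y z :=
    fun c y z => by rw [← Complex.coe_smul, inner_smul_left, Complex.conj_ofReal]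
  simp only [slope_def_module, map_sub, inner_sub_left, inner_sub_right, hs, hs', Complex.real_smul]
  ring

variable {H U : Type*} [NormedAddCommGroup H] [InnerProductSpace ℂ H] [CompleteSpace H]
    [NormedAddCommGroup U] [InnerProductSpace ℂ U] [CompleteSpace U]

/-- The inclusion of `H` in `Y_t`. -/
def stateL (t : ℝ) : H →L[ℂ] YSpace H t :=
  (WithLp.prodContinuousLinearEquiv 2 ℂ H (HistSpace H t)).symm.toContinuousLinearMap ∘L
    ContinuousLinearMap.inl ℂ H (HistSpace H t)

theorem stateL_apply (t : ℝ) (x : H) : stateL t x = mkY t x 0 :=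
  ySpace_ext rfl toHist_zero.symm

theorem mkY_eq_add {t : ℝ} (x : H) (f : HistSpace H t) :
    mkY t x f = stateL t x + mkY t (0 : H) f := by
  refine ySpace_ext ?_ ?_
  · change x = x + 0
    rw [add_zero]
  · change toHist t f = 0 + toHist t f
    rw [zero_add]

theorem norm_mkY_zero (t : ℝ) (x : H) : ‖(mkY t x 0 : YSpace H t)‖ = ‖x‖ := by
  rw [WithLp.prod_norm_eq_of_L2, mkY_fst, mkY_snd, toHist_zero, norm_zero]
  simp

variable {A : H →ₗ.[ℂ] H} {S : ℝ → H →L[ℂ] H} {t : ℝ}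

theorem inTestDomain_mkY_zero {x a : H} (h : (x, a) ∈ A.graph) :
    InTestDomain A t (mkY t x 0) := by
  refine ⟨LinearPMap.mem_domain_of_mem_graph h, 0, ?_⟩
  rw [mkY_snd, toHist_zero]
  filter_upwards [Lp.coeFn_zero H 2 (volume.restrict (Ioc (0 : ℝ) t))] with s hs
  rw [hs]
  exact A.graph.zero_mem

/-- The element `(e^{(r-t)A} x, f)`. -/
def evolve (S : ℝ → H →L[ℂ] H) (t : ℝ) (X : YSpace H t) (r : ℝ) : YSpace H t :=
  mkY t (semigroupExt S (r - t) X.fst) X.snd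

theorem evolve_fst (X : YSpace H t) (r : ℝ) :
    (evolve S t X r).fst = semigroupExt S (r - t) X.fst := by rw [evolve, mkY_fst]

theorem evolve_snd (X : YSpace H t) (r : ℝ) : (evolve S t X r).snd = X.snd := by
  rw [evolve, mkY_snd, toHist_self]

theorem evolve_self (hS : IsC0Semigroup S) (X : YSpace H t) : evolve S t X t = X := by
  refine ySpace_ext ?_ (evolve_snd X t)
  rw [evolve_fst, sub_self, hS.semigroupExt_zero]

theorem inTestDomain_evolve (hS : IsC0Semigroup S) (hA : IsGenerator S A) {X : YSpace H t}
    (hX : InTestDomain A t X) {r : ℝ} (hr : t ≤ r) : InTestDomain A t (evolve S t X r) := by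
  refine ⟨?_, ?_⟩
  · rw [evolve_fst]
    exact LinearPMap.mem_domain_of_mem_graph
      (hA.map_graph hS (A.mem_graph ⟨X.fst, hX.fst_mem⟩) (sub_nonneg.2 hr))
  · rw [evolve_snd]
    exact hX.snd_mem

theorem hasDerivWithinAt_evolve (hS : IsC0Semigroup S) (hA : IsGenerator S A) {X : YSpace H t}
    {a : H} (ha : (X.fst, a) ∈ A.graph) {r T : ℝ} (hr : t ≤ r) :
    HasDerivWithinAt (evolve S t X) (mkY t (semigroupExt S (r - t) a) 0) (Icc t T) r := by
  have h1 : HasDerivWithinAt (fun s => semigroupExt S (s - t) X.fst)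
      (semigroupExt S (r - t) a) (Icc t T) r := by
    have h2 := hA.hasDerivWithinAt hS ha (sub_nonneg.2 hr)
    have h3 := h2.scomp (h := fun s => s - t) (s := Icc t T) r
      ((hasDerivWithinAt_id r (Icc t T)).sub_const t) fun s hs => sub_nonneg.2 hs.1
    rwa [one_smul] at h3
  have h4 := (((stateL t).restrictScalars ℝ).hasFDerivAt.comp_hasDerivWithinAt r h1).add_const
    (mkY t (0 : H) X.snd)
  have h5 : evolve S t X = fun s => (stateL t) (semigroupExt S (s - t) X.fst) +
      mkY t (0 : H) X.snd := funext fun s => mkY_eq_add _ _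
  rw [h5, ← stateL_apply]
  exact h4

variable {T : ℝ} {K : ℝ → ℝ} {B : U →L[ℂ] H} {Q : H →L[ℂ] H}
  {V V₁ V₂ : (t : ℝ) → YSpace H t →L[ℂ] YSpace H t} {k k₁ k₂ : ℝ → BlockKernel H}

theorem SolvesRiccatiWith.continuousOn_pairing (h : SolvesRiccatiWith T A K B Q V k)
    (ht : t ∈ Ioo 0 T) {X X' : YSpace H t} (hX : InTestDomain A t X)
    (hX' : InTestDomain A t X') :
    ContinuousOn (fun r => (inner ℂ X' (compress t V r X) : ℂ)) (Icc t T) := by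
  simp only [inner_compress]
  exact fun r hr => (h.equation t ht X X' hX hX' r hr).continuousWithinAt

theorem SolvesRiccatiWith.exists_norm_compress_le (h : SolvesRiccatiWith T A K B Q V k)
    (ht : 0 < t) : ∃ C, 0 ≤ C ∧ ∀ r ∈ Icc t T, ‖compress t V r‖ ≤ C := by
  obtain ⟨C, hC⟩ := h.bounded
  exact ⟨max C 0, le_max_right _ _, fun r hr => norm_compress_le t V r
    ((hC r ⟨ht.trans_le hr.1, hr.2⟩).1.trans (le_max_left _ _))⟩

/-- The pairings are continuous in time also when the state of one test element is arbitrary. -/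
theorem SolvesRiccatiWith.continuousOn_pairing_right (h : SolvesRiccatiWith T A K B Q V k)
    (hS : IsC0Semigroup S) (hA : IsGenerator S A)
    (ht : t ∈ Ioo 0 T) (x : H) {X' : YSpace H t} (hX' : InTestDomain A t X') :
    ContinuousOn (fun r => (inner ℂ X' (compress t V r (mkY t x 0)) : ℂ)) (Icc t T) := by
  obtain ⟨C, hC0, hC⟩ := h.exists_norm_compress_le ht.1
  refine continuousOn_of_uniform_approx_of_continuousOn fun u hu => ?_
  obtain ⟨ε, hε, hu⟩ := Metric.mem_uniformity_dist.1 hu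
  have hp : 0 < ‖X'‖ * C + 1 := by positivity
  obtain ⟨y, hy, hxy⟩ := Metric.dense_iff.1 (hA.dense_domain hS) x (ε / (‖X'‖ * C + 1))
    (by positivity)
  refine ⟨_, h.continuousOn_pairing ht (inTestDomain_mkY_zero (A.mem_graph ⟨y, hxy⟩)) hX',
    fun r hr => hu ?_⟩
  rw [dist_eq_norm, ← inner_sub_right, ← map_sub, ← stateL_apply, ← stateL_apply, ← map_sub,
    stateL_apply]
  rw [Metric.mem_ball, dist_comm, dist_eq_norm] at hy
  calc _ ≤ ‖X'‖ * (C * ‖x - y‖) := by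
        refine (norm_inner_le_norm _ _).trans (mul_le_mul_of_nonneg_left ?_ (norm_nonneg _))
        rw [← norm_mkY_zero t (x - y)]
        exact ContinuousLinearMap.le_of_opNorm_le _ (hC r hr) _
    _ = (‖X'‖ * C) * ‖x - y‖ := by ring
    _ ≤ (‖X'‖ * C + 1) * ‖x - y‖ := by nlinarith [norm_nonneg (x - y)]
    _ < (‖X'‖ * C + 1) * (ε / (‖X'‖ * C + 1)) := mul_lt_mul_of_pos_left hy hp
    _ = ε := mul_div_cancel₀ _ hp.ne'

theorem SolvesRiccatiWith.continuousOn_pairing_left (h : SolvesRiccatiWith T A K B Q V k)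
    (hS : IsC0Semigroup S) (hA : IsGenerator S A)
    (ht : t ∈ Ioo 0 T) (x : H) {X : YSpace H t} (hX : InTestDomain A t X) :
    ContinuousOn (fun r => (inner ℂ (mkY t x 0) (compress t V r X) : ℂ)) (Icc t T) := by
  obtain ⟨C, hC0, hC⟩ := h.exists_norm_compress_le ht.1
  refine continuousOn_of_uniform_approx_of_continuousOn fun u hu => ?_
  obtain ⟨ε, hε, hu⟩ := Metric.mem_uniformity_dist.1 hu
  have hp : 0 < C * ‖X‖ + 1 := by positivity
  obtain ⟨y, hy, hxy⟩ := Metric.dense_iff.1 (hA.dense_domain hS) x (ε / (C * ‖X‖ + 1))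
    (by positivity)
  refine ⟨_, h.continuousOn_pairing ht hX (inTestDomain_mkY_zero (A.mem_graph ⟨y, hxy⟩)),
    fun r hr => hu ?_⟩
  rw [dist_eq_norm, ← inner_sub_left, ← stateL_apply, ← stateL_apply, ← map_sub,
    stateL_apply]
  rw [Metric.mem_ball, dist_comm, dist_eq_norm] at hy
  calc _ ≤ ‖x - y‖ * (C * ‖X‖) := by
        refine (norm_inner_le_norm _ _).trans ?_
        rw [norm_mkY_zero]
        exact mul_le_mul_of_nonneg_left (ContinuousLinearMap.le_of_opNorm_le _ (hC r hr) _)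
          (norm_nonneg _)
    _ ≤ (C * ‖X‖ + 1) * ‖x - y‖ := by nlinarith [norm_nonneg (x - y)]
    _ < (C * ‖X‖ + 1) * (ε / (C * ‖X‖ + 1)) := mul_lt_mul_of_pos_left hy hp
    _ = ε := mul_div_cancel₀ _ hp.ne'

theorem LinearPMap.apply_eq_of_mem_graph {x a : H} (hx : x ∈ A.domain) (h : (x, a) ∈ A.graph) :
    A ⟨x, hx⟩ = a :=
  A.mem_graph_snd_inj (A.mem_graph ⟨x, hx⟩) h rfl

theorem compress_sub (τ : ℝ) (V₁ V₂ : (t : ℝ) → YSpace H t →L[ℂ] YSpace H t) (t : ℝ) :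
    compress τ (fun t => V₁ t - V₂ t) t = compress τ V₁ t - compress τ V₂ t := by
  rw [compress, compress, compress, ContinuousLinearMap.sub_comp, ContinuousLinearMap.comp_sub]

/-- Along test elements moved by the semigroup the terms with the generator cancel, and the
pairings of the difference of two solutions have a derivative of first order in the entries of
this difference. -/
theorem SolvesRiccatiWith.exists_hasDerivWithinAt_sub {sys : MemorySystem H U}
    (h₁ : SolvesRiccatiWith sys.T A K B Q V₁ k₁) (h₂ : SolvesRiccatiWith sys.T A K B Q V₂ k₂)
    (hK : ∀ᵐ s, s ∈ Ioc 0 sys.T → K s = sys.K s) (hS : IsC0Semigroup S) (hA : IsGenerator S A)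
    (ht : t ∈ Ioo 0 sys.T) {X X' : YSpace H t} (hX : InTestDomain A t X)
    (hX' : InTestDomain A t X') {r : ℝ} (hr : r ∈ Icc t sys.T) {C N : ℝ}
    (hC₁ : (k₁ r).BoundedBy r C) (hC₂ : (k₂ r).BoundedBy r C) :
    ∃ b' : ℂ, HasDerivWithinAt (fun s => (inner ℂ (evolve S t X' s)
      (compress t (fun s => V₁ s - V₂ s) s (evolve S t X s)) : ℂ)) b' (Icc t sys.T) r ∧
      (((k₁ r).sub (k₂ r)).BoundedBy r N → ‖b'‖ ≤ N * (2 * (1 + ‖B‖ * (‖B‖ * C)) *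
        (ySize (evolve S t X r) * ySize (evolve S t X' r)) +
        ‖sys.histFun t X.snd r‖ * ySize (evolve S t X' r) +
        ySize (evolve S t X r) * ‖sys.histFun t X'.snd r‖)) := by
  obtain ⟨C₁, hC₁0, hD₁⟩ := h₁.exists_norm_compress_le ht.1
  obtain ⟨C₂, hC₂0, hD₂⟩ := h₂.exists_norm_compress_le ht.1
  have hr0 : r ∈ Ioc 0 sys.T := ⟨ht.1.trans_le hr.1, hr.2⟩
  set Z := evolve S t X r with hZ
  set Z' := evolve S t X' r with hZ'
  have gX : (X.fst, A ⟨X.fst, hX.fst_mem⟩) ∈ A.graph := A.mem_graph ⟨X.fst, hX.fst_mem⟩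
  have gX' : (X'.fst, A ⟨X'.fst, hX'.fst_mem⟩) ∈ A.graph := A.mem_graph ⟨X'.fst, hX'.fst_mem⟩
  set a := semigroupExt S (r - t) (A ⟨X.fst, hX.fst_mem⟩) with ha
  set a' := semigroupExt S (r - t) (A ⟨X'.fst, hX'.fst_mem⟩) with ha'
  have hTZ : InTestDomain A t Z := inTestDomain_evolve hS hA hX hr.1
  have hTZ' : InTestDomain A t Z' := inTestDomain_evolve hS hA hX' hr.1
  have hAZ : A ⟨Z.fst, hTZ.fst_mem⟩ = a := LinearPMap.apply_eq_of_mem_graph _ (by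
    rw [hZ, evolve_fst]
    exact hA.map_graph hS gX (sub_nonneg.2 hr.1))
  have hAZ' : A ⟨Z'.fst, hTZ'.fst_mem⟩ = a' := LinearPMap.apply_eq_of_mem_graph _ (by
    rw [hZ', evolve_fst]
    exact hA.map_graph hS gX' (sub_nonneg.2 hr.1))
  have e₁ := h₁.equation t ht Z Z' hTZ hTZ' r hr
  have e₂ := h₂.equation t ht Z Z' hTZ hTZ' r hr
  rw [hAZ, hAZ'] at e₁ e₂
  have hsub : ∀ (W W' : YSpace H t) (s : ℝ),
      (inner ℂ W' (compress t (fun s => V₁ s - V₂ s) s W) : ℂ) =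
      inner ℂ W' (compress t V₁ s W) - inner ℂ W' (compress t V₂ s W) := fun W W' s => by
    rw [compress_sub, _root_.sub_apply, inner_sub_right]
  have h0 := e₁.sub e₂
  simp only [← inner_compress] at h0
  have hprod := hasDerivWithinAt_inner_apply (D := compress t fun s => V₁ s - V₂ s)
    (X := evolve S t X) (X' := evolve S t X') (I := Icc t sys.T) (r := r) (C := C₁ + C₂)
    (v := mkY t a 0) (v' := mkY t a' 0) (fun s hs => by
      rw [compress_sub]
      exact (norm_sub_le _ _).trans (add_le_add (hD₁ s hs) (hD₂ s hs)))
    (hasDerivWithinAt_evolve hS hA gX hr.1) (hasDerivWithinAt_evolve hS hA gX' hr.1)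
    (h0.congr (fun s _ => hsub Z Z' s) (hsub Z Z' r))
    (((h₁.continuousOn_pairing_right hS hA ht a hTZ' r hr).sub
      (h₂.continuousOn_pairing_right hS hA ht a hTZ' r hr)).congr
      (fun s _ => hsub _ Z' s) (hsub _ Z' r))
    (((h₁.continuousOn_pairing_left hS hA ht a' hTZ r hr).sub
      (h₂.continuousOn_pairing_left hS hA ht a' hTZ r hr)).congr
      (fun s _ => hsub Z _ s) (hsub Z _ r))
  refine ⟨_, hprod, fun hN => ?_⟩
  have hkey := norm_riccatiForm_sub_le hK ⟨hr0.1.le, hr0.2⟩ (h₁.represents r hr0)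
    (h₂.represents r hr0) hC₁ hC₂ hN Q B (embedY t r Z) (embedY t r Z') a a'
  have hγ : ∀ (W : YSpace H t), sys.histFun r (embedY t r W).snd r = sys.histFun t W.snd r :=
    fun W => MemorySystem.histFun_embedY hr.1 W r
  rw [ySize_embedY hr.1, ySize_embedY hr.1, hγ, hγ, hZ, hZ', evolve_snd, evolve_snd, ← hZ, ← hZ']
    at hkey
  refine le_trans (le_of_eq ?_) hkey
  rw [← norm_neg, inner_compress, inner_compress, embedY_mkY_zero, embedY_mkY_zero, ← hZ, ← hZ']
  congr 1
  ring

end MovingTest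

/-! ### Contraction in a weighted norm -/

section Contraction

variable {H U : Type*} [NormedAddCommGroup H] [InnerProductSpace ℂ H] [CompleteSpace H]
    [NormedAddCommGroup U] [InnerProductSpace ℂ U] [CompleteSpace U]

theorem MemorySystem.norm_histOp_le_integral (sys : MemorySystem H U) (t : ℝ)
    (f : HistSpace H t) : ‖sys.histOp t f‖ ≤
      ‖(tensorOp sys.kernelClass : H →L[ℂ] L2R H)‖ * ∫ s in Ioc 0 t, ‖f s‖ := by
  rw [sys.histOp_apply, ← integral_const_mul]
  refine norm_integral_le_of_norm_le ((integrableOn_hist f).norm.const_mul _) ?_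
  exact ae_of_all _ fun s => (sys.kernelOp s).le_of_opNorm_le (sys.norm_kernelOp_le s) _

theorem norm_sq_eq_integral {α F : Type*} [MeasurableSpace α] {μ : Measure α}
    [NormedAddCommGroup F] [InnerProductSpace ℂ F] (f : Lp F 2 μ) :
    ‖f‖ ^ 2 = ∫ s, ‖f s‖ ^ 2 ∂μ := by
  have h1 : ((‖f‖ : ℂ)) ^ 2 = ∫ s, ((‖f s‖ ^ 2 : ℝ) : ℂ) ∂μ := by
    rw [← Complex.coe_algebraMap, ← inner_self_eq_norm_sq_to_K (𝕜 := ℂ) f, L2.inner_def]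
    refine integral_congr_ae (ae_of_all _ fun s => ?_)
    simp only [inner_self_eq_norm_sq_to_K, Complex.coe_algebraMap, Complex.ofReal_pow]
  rw [integral_complex_ofReal] at h1
  exact_mod_cast h1

theorem intervalIntegral_exp_le {l t T : ℝ} (hl : 0 < l) :
    ∫ r in t..T, Real.exp (l * (T - r)) ≤ Real.exp (l * (T - t)) / l := by
  have h1 : ∀ r ∈ uIcc t T, HasDerivAt (fun r => -(Real.exp (l * (T - r)) / l))
      (Real.exp (l * (T - r))) r := fun r _ => by
    have h2 := ((((hasDerivAt_id r).const_sub T).const_mul l).exp.div_const l).neg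
    refine h2.congr_deriv ?_
    field_simp
    simp
  rw [intervalIntegral.integral_eq_sub_of_hasDerivAt h1
    (Continuous.intervalIntegrable (by fun_prop) _ _)]
  have : 0 ≤ Real.exp (l * (T - T)) / l := by positivity
  linarith

/-- The weighted integral of the forcing produced by a history is small if the weight decays
rapidly; the history is measured in `L¹`. -/
theorem MemorySystem.integral_exp_mul_norm_histFun_le (sys : MemorySystem H U) {t T l : ℝ}
    (hl : 0 < l) (ht : t ≤ T) (f : HistSpace H t) :
    ∫ r in t..T, Real.exp (l * (T - r)) * ‖sys.histFun t f r‖ ≤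
      Real.exp (l * (T - t)) * (√(1 / (2 * l)) *
        (‖(tensorOp sys.kernelClass : H →L[ℂ] L2R H)‖ * ∫ s in Ioc 0 t, ‖f s‖)) := by
  have hc := continuous_histFun (sys := sys) t f
  have hm : ∀ {g : ℝ → ℝ}, Continuous g →
      MemLp g (ENNReal.ofReal 2) (volume.restrict (Ioc t T)) := fun hg => by
    obtain ⟨C, hC⟩ := isCompact_Icc.exists_bound_of_continuousOn (s := Icc t T) hg.continuousOn
    refine MemLp.of_bound hg.aestronglyMeasurable C ?_
    rw [ae_restrict_iff' measurableSet_Ioc]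
    exact ae_of_all _ fun s hs => hC s ⟨hs.1.le, hs.2⟩
  have h1 := integral_mul_le_Lp_mul_Lq_of_nonneg (μ := volume.restrict (Ioc t T))
    Real.HolderConjugate.two_two (f := fun r => Real.exp (l * (T - r)))
    (g := fun r => ‖sys.histFun t f r‖) (ae_of_all _ fun r => (Real.exp_pos _).le)
    (ae_of_all _ fun r => norm_nonneg _) (hm (by fun_prop)) (hm hc.norm)
  simp only [Real.rpow_two, ← Real.sqrt_eq_rpow] at h1
  rw [intervalIntegral.integral_of_le ht]
  refine h1.trans ?_
  have h2 : √(∫ r in Ioc t T, Real.exp (l * (T - r)) ^ 2) ≤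
      Real.exp (l * (T - t)) * √(1 / (2 * l)) := by
    rw [← Real.sqrt_sq (Real.exp_pos (l * (T - t))).le, ← Real.sqrt_mul (sq_nonneg _)]
    refine Real.sqrt_le_sqrt ?_
    have h3 := intervalIntegral_exp_le (t := t) (T := T) (l := 2 * l) (by positivity)
    rw [intervalIntegral.integral_of_le ht] at h3
    have h4 : ∀ r, Real.exp (l * (T - r)) ^ 2 = Real.exp (2 * l * (T - r)) := fun r => by
      rw [← Real.exp_nat_mul]
      congr 1
      push_cast
      ring
    simp only [h4]
    rwa [mul_one_div]
  have h5 : √(∫ r in Ioc t T, ‖sys.histFun t f r‖ ^ 2) ≤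
      ‖(tensorOp sys.kernelClass : H →L[ℂ] L2R H)‖ * ∫ s in Ioc 0 t, ‖f s‖ := by
    refine le_trans ?_ (sys.norm_histOp_le_integral t f)
    refine Real.sqrt_le_iff.2 ⟨norm_nonneg _, ?_⟩
    rw [norm_sq_eq_integral]
    have h6 : (fun r => ‖sys.histOp t f r‖ ^ 2) =ᵐ[volume]
        fun r => ‖sys.histFun t f r‖ ^ 2 := by
      filter_upwards [histOp_coe (sys := sys) t f] with r hr
      rw [hr]
    have h7 : Integrable (fun r => ‖sys.histOp t f r‖ ^ 2) volume :=
      (Lp.memLp (sys.histOp t f)).norm.integrable_sq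
    rw [integral_congr_ae h6]
    exact setIntegral_le_integral (h7.congr h6) (ae_of_all _ fun r => sq_nonneg _)
  calc _ ≤ Real.exp (l * (T - t)) * √(1 / (2 * l)) *
        (‖(tensorOp sys.kernelClass : H →L[ℂ] L2R H)‖ * ∫ s in Ioc 0 t, ‖f s‖) :=
        mul_le_mul h2 h5 (Real.sqrt_nonneg _) (by positivity)
    _ = _ := by ring

variable {A : H →ₗ.[ℂ] H} {S : ℝ → H →L[ℂ] H} {t : ℝ} {K : ℝ → ℝ} {B : U →L[ℂ] H}
  {Q : H →L[ℂ] H} {V₁ V₂ : (t : ℝ) → YSpace H t →L[ℂ] YSpace H t} {k₁ k₂ : ℝ → BlockKernel H}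

theorem ySize_evolve_le {M r : ℝ} (hM1 : 1 ≤ M) (hM : ‖semigroupExt S (r - t)‖ ≤ M)
    (X : YSpace H t) : ySize (evolve S t X r) ≤ M * ySize X := by
  rw [ySize, ySize, evolve_fst, evolve_snd, mul_add]
  refine add_le_add (ContinuousLinearMap.le_of_opNorm_le _ hM _) (le_mul_of_one_le_left ?_ hM1)
  exact integral_nonneg fun _ => norm_nonneg _

/-- If the entries of the difference of two solutions are bounded by `c e^{l(T-r)}`, then its
pairings with test elements obey a similar bound with a constant that is small for large `l`. -/
theorem SolvesRiccatiWith.norm_inner_sub_le {sys : MemorySystem H U}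
    (h₁ : SolvesRiccatiWith sys.T A K B Q V₁ k₁) (h₂ : SolvesRiccatiWith sys.T A K B Q V₂ k₂)
    (hK : ∀ᵐ s, s ∈ Ioc 0 sys.T → K s = sys.K s) (hS : IsC0Semigroup S) (hA : IsGenerator S A)
    {C M c l : ℝ} (hl : 0 < l) (hM1 : 1 ≤ M) (hM : ∀ s ∈ Icc 0 sys.T, ‖semigroupExt S s‖ ≤ M)
    (hC : ∀ r ∈ Ioc 0 sys.T, (k₁ r).BoundedBy r C ∧ (k₂ r).BoundedBy r C)
    (hc : ∀ r ∈ Ioo 0 sys.T,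
      ((k₁ r).sub (k₂ r)).BoundedBy r (c * Real.exp (l * (sys.T - r))))
    (ht : t ∈ Ioo 0 sys.T) {X X' : YSpace H t} (hX : InTestDomain A t X)
    (hX' : InTestDomain A t X') :
    ‖(inner ℂ X' ((V₁ t - V₂ t) X) : ℂ)‖ ≤ (2 * (1 + ‖B‖ * (‖B‖ * C)) * (M * M) / l +
        2 * M * ‖(tensorOp sys.kernelClass : H →L[ℂ] L2R H)‖ * √(1 / (2 * l))) *
      (c * Real.exp (l * (sys.T - t))) * ySize X * ySize X' := by
  have hC0 : 0 ≤ C := (hC t ⟨ht.1, ht.2.le⟩).1.nonneg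
  have hc0 : 0 ≤ c := nonneg_of_mul_nonneg_left (hc t ht).nonneg (Real.exp_pos _)
  have hM0 : 0 ≤ M := zero_le_one.trans hM1
  have hn := ySize_nonneg X
  have hn' := ySize_nonneg X'
  set n := ySize X with hn_def
  set n' := ySize X' with hn'_def
  set κ := ‖(tensorOp sys.kernelClass : H →L[ℂ] L2R H)‖ with hκ
  have hκ0 : 0 ≤ κ := ContinuousLinearMap.opNorm_nonneg _
  set c0 := 2 * (1 + ‖B‖ * (‖B‖ * C)) with hc0_def
  have hc00 : 0 ≤ c0 := by positivity
  set b : ℝ → ℂ := fun s => inner ℂ (evolve S t X' s)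
      (compress t (fun s => V₁ s - V₂ s) s (evolve S t X s)) with hb
  have hder : ∀ r : ℝ, ∃ b' : ℂ, r ∈ Icc t sys.T → HasDerivWithinAt b b' (Icc t sys.T) r ∧
      (((k₁ r).sub (k₂ r)).BoundedBy r (c * Real.exp (l * (sys.T - r))) →
        ‖b'‖ ≤ c * Real.exp (l * (sys.T - r)) * (c0 *
        (ySize (evolve S t X r) * ySize (evolve S t X' r)) +
        ‖sys.histFun t X.snd r‖ * ySize (evolve S t X' r) +
        ySize (evolve S t X r) * ‖sys.histFun t X'.snd r‖)) := by
    intro r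
    by_cases hr : r ∈ Icc t sys.T
    · have hr0 : r ∈ Ioc 0 sys.T := ⟨ht.1.trans_le hr.1, hr.2⟩
      obtain ⟨b', hb'⟩ := h₁.exists_hasDerivWithinAt_sub (N := c * Real.exp (l * (sys.T - r)))
        h₂ hK hS hA ht hX hX' hr (hC r hr0).1 (hC r hr0).2
      exact ⟨b', fun _ => hb'⟩
    · exact ⟨0, fun h => absurd h hr⟩
  choose b' hb' using hder
  set γ : ℝ → ℝ := fun r => ‖sys.histFun t X.snd r‖ with hγ
  set γ' : ℝ → ℝ := fun r => ‖sys.histFun t X'.snd r‖ with hγ'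
  have hγc : Continuous γ := (MemorySystem.continuous_histFun t X.snd).norm
  have hγc' : Continuous γ' := (MemorySystem.continuous_histFun t X'.snd).norm
  set g : ℝ → ℝ := fun r => c * Real.exp (l * (sys.T - r)) *
    (c0 * (M * n * (M * n')) + γ r * (M * n') + M * n * γ' r) with hg
  have hgc : Continuous g := by fun_prop
  have hbound : ∀ r ∈ Ico t sys.T, ‖b' r‖ ≤ g r := by
    intro r hr
    have hr1 : r ∈ Icc t sys.T := Ico_subset_Icc_self hr
    refine ((hb' r hr1).2 (hc r ⟨ht.1.trans_le hr.1, hr.2⟩)).trans ?_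
    have hMr := hM (r - t) ⟨sub_nonneg.2 hr.1, by linarith [ht.1, hr.2]⟩
    have hs := ySize_evolve_le hM1 hMr X
    have hs' := ySize_evolve_le hM1 hMr X'
    have := ySize_nonneg (evolve S t X r)
    have := ySize_nonneg (evolve S t X' r)
    simp only [hg, hγ, hγ']
    gcongr
  -- both solutions vanish at the final time, so the pairing at `t` is an increment of `b`
  have hmain := image_norm_le_of_norm_deriv_right_le_deriv_boundary' (a := t) (b := sys.T)
    (f := fun s => b s - b t) (f' := b') (B := fun x => ∫ r in t..x, g r) (B' := g)
    (fun r hr => ((hb' r hr).1.continuousWithinAt).sub continuousWithinAt_const)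
    (fun r hr => ((hb' r (Ico_subset_Icc_self hr)).1.mono_of_mem_nhdsWithin
      (mem_of_superset (Icc_mem_nhdsGE hr.2) (Icc_subset_Icc_left hr.1))).sub_const _)
    (by simp)
    (fun r _ => (hgc.integral_hasStrictDerivAt t r).hasDerivAt.continuousAt.continuousWithinAt)
    (fun r _ => (hgc.integral_hasStrictDerivAt t r).hasDerivAt.hasDerivWithinAt)
    hbound (right_mem_Icc.2 ht.2.le)
  have hbT : b sys.T = 0 := by
    simp only [hb]
    rw [inner_compress, h₁.final, h₂.final, sub_self, _root_.zero_apply, inner_zero_right]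
  have hbt : b t = inner ℂ X' ((V₁ t - V₂ t) X) := by
    simp only [hb]
    rw [inner_compress, evolve_self hS, evolve_self hS, embedY_self, embedY_self]
  simp only [hbT, zero_sub, norm_neg, hbt] at hmain
  refine hmain.trans ?_
  have hi : ∀ {φ : ℝ → ℝ}, Continuous φ → IntervalIntegrable φ volume t sys.T :=
    fun h => h.intervalIntegrable _ _
  have hsplit : ∫ r in t..sys.T, g r = c * (c0 * (M * n * (M * n'))) *
      (∫ r in t..sys.T, Real.exp (l * (sys.T - r))) +
      c * (M * n') * (∫ r in t..sys.T, Real.exp (l * (sys.T - r)) * γ r) +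
      c * (M * n) * (∫ r in t..sys.T, Real.exp (l * (sys.T - r)) * γ' r) := by
    rw [← intervalIntegral.integral_const_mul, ← intervalIntegral.integral_const_mul,
      ← intervalIntegral.integral_const_mul, ← intervalIntegral.integral_add (hi (by fun_prop))
      (hi (by fun_prop)), ← intervalIntegral.integral_add (hi (by fun_prop)) (hi (by fun_prop))]
    refine intervalIntegral.integral_congr fun r _ => ?_
    simp only [hg]
    ring
  have i1 := intervalIntegral_exp_le (t := t) (T := sys.T) hl
  have hle : ∀ Z : YSpace H t, ∫ r in t..sys.T, Real.exp (l * (sys.T - r)) *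
      ‖sys.histFun t Z.snd r‖ ≤ Real.exp (l * (sys.T - t)) * (√(1 / (2 * l)) * (κ * ySize Z)) := by
    intro Z
    refine (sys.integral_exp_mul_norm_histFun_le hl ht.2.le Z.snd).trans ?_
    gcongr
    exact le_add_of_nonneg_left (norm_nonneg _)
  have i2 := hle X
  have i3 := hle X'
  rw [hsplit]
  calc _ ≤ c * (c0 * (M * n * (M * n'))) * (Real.exp (l * (sys.T - t)) / l) +
      c * (M * n') * (Real.exp (l * (sys.T - t)) * (√(1 / (2 * l)) * (κ * n))) +
      c * (M * n) * (Real.exp (l * (sys.T - t)) * (√(1 / (2 * l)) * (κ * n'))) := by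
        gcongr
    _ = _ := by ring

end Contraction

/-! ### The entries of an operator matrix from its pairings with test elements -/

section Entries

/-- A bound for the averages of a continuous function over all intervals is a bound for its values,
end points included. -/
theorem norm_le_of_norm_integral_le {φ : ℝ → ℂ} {t q : ℝ} (ht : 0 < t)
    (hφ : ContinuousOn φ (Icc 0 t))
    (h : ∀ a b, 0 ≤ a → a ≤ b → b ≤ t → ‖∫ s in a..b, φ s‖ ≤ q * (b - a)) {s : ℝ}
    (hs : s ∈ Icc 0 t) : ‖φ s‖ ≤ q := by
  have hi : ∀ a b, a ∈ Icc 0 t → b ∈ Icc 0 t → IntervalIntegrable φ volume a b :=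
    fun a b ha hb => (hφ.mono (OrdConnected.uIcc_subset ordConnected_Icc ha hb)).intervalIntegrable
  have h0 : (0 : ℝ) ∈ Icc 0 t := ⟨le_rfl, ht.le⟩
  have hd : HasDerivWithinAt (fun u => ∫ v in (0 : ℝ)..u, φ v) (φ s) (Icc 0 t) s := by
    have : Fact (s ∈ Icc 0 t) := ⟨hs⟩
    exact intervalIntegral.integral_hasDerivWithinAt_right (hi 0 s h0 hs)
      (hφ.stronglyMeasurableAtFilter_nhdsWithin measurableSet_Icc s) (hφ s hs)
  rw [hasDerivWithinAt_iff_tendsto_slope] at hd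
  have : (𝓝[Icc 0 t \ {s}] s).NeBot := by
    have := (uniqueDiffOn_Icc ht) s hs
    rwa [uniqueDiffWithinAt_iff_accPt, accPt_principal_iff_nhdsWithin] at this
  refine le_of_tendsto hd.norm ?_
  filter_upwards [self_mem_nhdsWithin] with u hu
  have hus : u - s ≠ 0 := sub_ne_zero.2 hu.2
  rw [slope_def_module, intervalIntegral.integral_interval_sub_left (hi 0 u h0 hu.1)
    (hi 0 s h0 hs), norm_smul, norm_inv, Real.norm_eq_abs, inv_mul_le_iff₀ (abs_pos.2 hus),
    mul_comm]
  rcases le_total s u with hsu | hsu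
  · rw [abs_of_nonneg (sub_nonneg.2 hsu)]
    exact h s u hs.1 hsu hu.1.2
  · rw [abs_of_nonpos (sub_nonpos.2 hsu), intervalIntegral.integral_symm, norm_neg, neg_sub]
    exact h u s hu.1.1 hsu hs.2

variable {H : Type*} [NormedAddCommGroup H] [InnerProductSpace ℂ H] [CompleteSpace H]
  {A : H →ₗ.[ℂ] H} {t q : ℝ}

theorem norm_le_of_forall_inner_le {D : Submodule ℂ H} (hD : Dense (D : Set H)) {L : H →L[ℂ] H}
    (hq : 0 ≤ q) (h : ∀ x ∈ D, ∀ e ∈ D, ‖(inner ℂ e (L x) : ℂ)‖ ≤ q * (‖x‖ * ‖e‖)) : ‖L‖ ≤ q := by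
  have h1 : ∀ x e : H, ‖(inner ℂ e (L x) : ℂ)‖ ≤ q * (‖x‖ * ‖e‖) := by
    intro x
    refine hD.induction (P := fun e => ‖(inner ℂ e (L x) : ℂ)‖ ≤ q * (‖x‖ * ‖e‖)) ?_
      (isClosed_le (by fun_prop) (by fun_prop))
    intro e he
    exact hD.induction (P := fun x => ‖(inner ℂ e (L x) : ℂ)‖ ≤ q * (‖x‖ * ‖e‖))
      (fun x hx => h x hx e he) (isClosed_le (by fun_prop) (by fun_prop)) x
  refine L.opNorm_le_bound hq fun x => ?_
  have h2 := h1 x (L x)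
  rw [inner_self_eq_norm_sq_to_K, norm_pow, RCLike.norm_ofReal, abs_norm, sq,
    ← mul_assoc] at h2
  rcases (norm_nonneg (L x)).eq_or_lt with h3 | h3
  · rw [← h3]
    positivity
  · exact le_of_mul_le_mul_right h2 h3

/-- The element `(0, f)` of `Y_t` with `f` equal to `x` on `(a,b]` and to `0` elsewhere. -/
def stepY (t a b : ℝ) (x : H) : YSpace H t := mkY t 0 ((Ioc a b).indicator fun _ => x)

theorem stepY_snd_coe (t a b : ℝ) (x : H) : (stepY t a b x).snd
    =ᵐ[volume.restrict (Ioc (0 : ℝ) t)] (Ioc a b).indicator fun _ => x :=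
  toHist_coe ((memLp_const x).indicator measurableSet_Ioc)

theorem stepY_fst (t a b : ℝ) (x : H) : (stepY t a b x).fst = 0 := mkY_fst _ _

theorem inTestDomain_stepY {a b : ℝ} {x y : H} (h : (x, y) ∈ A.graph) :
    InTestDomain A t (stepY t a b x) := by
  refine ⟨by rw [stepY_fst]; exact A.domain.zero_mem, (stepY t a b y).snd, ?_⟩
  filter_upwards [stepY_snd_coe t a b x, stepY_snd_coe t a b y] with s h1 h2
  rw [h1, h2]
  by_cases hs : s ∈ Ioc a b
  · rwa [indicator_of_mem hs, indicator_of_mem hs]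
  · rw [indicator_of_notMem hs, indicator_of_notMem hs]
    exact A.graph.zero_mem

section Step

variable {a b : ℝ} (ha : 0 ≤ a) (hab : a ≤ b) (hb : b ≤ t)
include ha hab hb

theorem integral_stepY {F : Type*} [NormedAddCommGroup F] [NormedSpace ℝ F] {x : H}
    {ψ : ℝ → H → F} (hψ : ∀ s, ψ s 0 = 0) :
    ∫ s in Ioc 0 t, ψ s ((stepY t a b x).snd s) = ∫ s in a..b, ψ s x := by
  have h1 : ∫ s in Ioc 0 t, ψ s ((stepY t a b x).snd s) =
      ∫ s in Ioc 0 t, (Ioc a b).indicator (fun s => ψ s x) s := by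
    refine integral_congr_ae ?_
    filter_upwards [stepY_snd_coe t a b x] with s hs
    rw [hs]
    by_cases h : s ∈ Ioc a b
    · rw [indicator_of_mem h, indicator_of_mem h]
    · rw [indicator_of_notMem h, indicator_of_notMem h, hψ]
  rw [h1, setIntegral_indicator measurableSet_Ioc, inter_eq_right.2 (Ioc_subset_Ioc ha hb),
    intervalIntegral.integral_of_le hab]

theorem ySize_stepY (x : H) : ySize (stepY t a b x) = ‖x‖ * (b - a) := by
  rw [ySize, stepY_fst, norm_zero, zero_add,
    integral_stepY ha hab hb (ψ := fun _ y => ‖y‖) fun _ => norm_zero,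
    intervalIntegral.integral_const, smul_eq_mul, mul_comm]

end Step

namespace BlockKernel

variable {k : BlockKernel H} {V : YSpace H t →L[ℂ] YSpace H t}

theorem act0_mkY_zero (ht : 0 ≤ t) (x : H) : k.act0 t (mkY t x 0) = k.k00 x := by
  have h1 : ∫ s in (0 : ℝ)..t, k.k01 s ((mkY t x 0).snd s) = 0 := by
    rw [intervalIntegral.integral_of_le ht, mkY_snd, toHist_zero]
    refine (integral_congr_ae ?_).trans (integral_zero ℝ H)
    filter_upwards [Lp.coeFn_zero H 2 (volume.restrict (Ioc (0 : ℝ) t))] with s hs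
    rw [hs, Pi.zero_apply, map_zero]
  rw [act0, h1, mkY_fst, add_zero]

theorem act1_mkY_zero (ht : 0 ≤ t) (x : H) (q : ℝ) : k.act1 t (mkY t x 0) q = k.k10 q x := by
  have h1 : ∫ s in (0 : ℝ)..t, k.k11 s q ((mkY t x 0).snd s) = 0 := by
    rw [intervalIntegral.integral_of_le ht, mkY_snd, toHist_zero]
    refine (integral_congr_ae ?_).trans (integral_zero ℝ H)
    filter_upwards [Lp.coeFn_zero H 2 (volume.restrict (Ioc (0 : ℝ) t))] with s hs
    rw [hs, Pi.zero_apply, map_zero]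
  rw [act1, h1, mkY_fst, add_zero]

theorem inner_mkY_zero_eq (hV : k.Represents t V) (e : H) (X : YSpace H t) :
    inner ℂ (mkY t e 0) (V X) = inner ℂ e (k.act0 t X) := by
  rw [inner_ySpace, mkY_fst, mkY_snd, toHist_zero, inner_zero_left, add_zero, hV.fst_eq]

section Step

variable {a b : ℝ} (ha : 0 ≤ a) (hab : a ≤ b) (hb : b ≤ t)
include ha hab hb

theorem act0_stepY (x : H) : k.act0 t (stepY t a b x) = ∫ s in a..b, k.k01 s x := by
  rw [act0, stepY_fst, map_zero, zero_add, intervalIntegral.integral_of_le (ha.trans (hab.trans hb)),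
    integral_stepY ha hab hb (ψ := fun s y => k.k01 s y) fun _ => map_zero _]

theorem act1_stepY (x : H) (q : ℝ) :
    k.act1 t (stepY t a b x) q = ∫ s in a..b, k.k11 s q x := by
  rw [act1, stepY_fst, map_zero, zero_add, intervalIntegral.integral_of_le (ha.trans (hab.trans hb)),
    integral_stepY ha hab hb (ψ := fun s y => k.k11 s q y) fun _ => map_zero _]

theorem inner_stepY_eq (hV : k.Represents t V) (e : H) (X : YSpace H t) :
    inner ℂ (stepY t a b e) (V X) = ∫ q in a..b, (inner ℂ e (k.act1 t X q) : ℂ) := by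
  rw [inner_ySpace, stepY_fst, inner_zero_left, zero_add, L2.inner_def,
    ← integral_stepY ha hab hb (ψ := fun q y => (inner ℂ y (k.act1 t X q) : ℂ))
      fun _ => inner_zero_left _]
  refine integral_congr_ae ?_
  filter_upwards [hV.snd_eq X] with q hq
  rw [hq]

end Step

theorem Represents.continuousOn_integral_k11 (hV : k.Represents t V) (ht : 0 ≤ t) {a b : ℝ}
    (ha : 0 ≤ a) (hab : a ≤ b) (hb : b ≤ t) (x : H) :
    ContinuousOn (fun q => ∫ s in a..b, k.k11 s q x) (Icc 0 t) := by
  have h1 : Continuous fun p : ℝ × ℝ => k.k11 (max 0 (min p.2 t)) (max 0 (min p.1 t)) x :=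
    (hV.cont11 x).comp_continuous
      (f := fun p : ℝ × ℝ => (max 0 (min p.2 t), max 0 (min p.1 t))) (by fun_prop)
      fun p => ⟨⟨le_max_left _ _, max_le ht (min_le_right _ _)⟩,
        ⟨le_max_left _ _, max_le ht (min_le_right _ _)⟩⟩
  refine (intervalIntegral.continuous_parametric_intervalIntegral_of_continuous'
    (μ := volume) (f := fun q s => k.k11 (max 0 (min s t)) (max 0 (min q t)) x) h1 a b
    ).continuousOn.congr fun q hq => ?_
  refine intervalIntegral.integral_congr fun s hs => ?_
  rw [uIcc_of_le hab] at hs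
  simp only [clamp_of_mem hq, clamp_of_mem (t := t) ⟨ha.trans hs.1, hs.2.trans hb⟩]

/-- The pairings with test elements control the entries: the kernels are limits of averages, which
are pairings with step functions. -/
theorem Represents.boundedBy (hV : k.Represents t V) (ht : 0 < t) (hq : 0 ≤ q)
    (hA : Dense (A.domain : Set H))
    (h : ∀ X X' : YSpace H t, InTestDomain A t X → InTestDomain A t X' →
      ‖(inner ℂ X' (V X) : ℂ)‖ ≤ q * ySize X * ySize X') : k.BoundedBy t q where
  bound00 := norm_le_of_forall_inner_le hA hq fun x hx e he => by
    have h1 := h _ _ (inTestDomain_mkY_zero (A.mem_graph ⟨x, hx⟩))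
      (inTestDomain_mkY_zero (A.mem_graph ⟨e, he⟩))
    rwa [inner_mkY_zero_eq hV, act0_mkY_zero ht.le, ySize_mkY_zero, ySize_mkY_zero,
      mul_assoc] at h1
  bound01 s hs := norm_le_of_forall_inner_le hA hq fun x hx e he => by
    refine norm_le_of_norm_integral_le (φ := fun s => inner ℂ e (k.k01 s x)) ht
      (continuousOn_const.inner (𝕜 := ℂ) (hV.cont01 x)) (fun a b ha hab hb => ?_) hs
    have h1 := h _ _ (inTestDomain_stepY (a := a) (b := b) (A.mem_graph ⟨x, hx⟩))
      (inTestDomain_mkY_zero (A.mem_graph ⟨e, he⟩))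
    rw [inner_mkY_zero_eq hV, act0_stepY ha hab hb, ySize_mkY_zero, ySize_stepY ha hab hb,
      intervalIntegral.integral_of_le hab, ← integral_inner] at h1
    · rw [intervalIntegral.integral_of_le hab]
      refine h1.trans_eq ?_
      ring
    · exact ((hV.cont01 x).mono (Icc_subset_Icc ha hb)).integrableOn_Icc.mono_set
        Ioc_subset_Icc_self
  bound10 s hs := norm_le_of_forall_inner_le hA hq fun x hx e he => by
    refine norm_le_of_norm_integral_le (φ := fun s => inner ℂ e (k.k10 s x)) ht
      (continuousOn_const.inner (𝕜 := ℂ) (hV.cont10 x)) (fun a b ha hab hb => ?_) hs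
    have h1 := h _ _ (inTestDomain_mkY_zero (A.mem_graph ⟨x, hx⟩))
      (inTestDomain_stepY (a := a) (b := b) (A.mem_graph ⟨e, he⟩))
    simp only [inner_stepY_eq ha hab hb hV, act1_mkY_zero ht.le, ySize_mkY_zero,
      ySize_stepY ha hab hb] at h1
    refine h1.trans_eq ?_
    ring
  bound11 s hs p hp := norm_le_of_forall_inner_le hA hq fun x hx e he => by
    refine norm_le_of_norm_integral_le (φ := fun s => inner ℂ e (k.k11 s p x)) ht
      (continuousOn_const.inner (𝕜 := ℂ) (hV.continuousOn_k11 hp x)) (fun a b ha hab hb => ?_) hs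
    have hint : ∀ p ∈ Icc 0 t, ∫ s in a..b, (inner ℂ e (k.k11 s p x) : ℂ) =
        inner ℂ e (∫ s in a..b, k.k11 s p x) := fun p hp => by
      rw [intervalIntegral.integral_of_le hab, intervalIntegral.integral_of_le hab,
        integral_inner]
      exact ((hV.continuousOn_k11 hp x).mono (Icc_subset_Icc ha hb)).integrableOn_Icc.mono_set
        Ioc_subset_Icc_self
    rw [hint p hp]
    refine norm_le_of_norm_integral_le (φ := fun p => inner ℂ e (∫ s in a..b, k.k11 s p x)) ht
      (continuousOn_const.inner (𝕜 := ℂ) (hV.continuousOn_integral_k11 ht.le ha hab hb x))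
      (fun a' b' ha' hab' hb' => ?_) hp
    have h1 := h _ _ (inTestDomain_stepY (a := a) (b := b) (A.mem_graph ⟨x, hx⟩))
      (inTestDomain_stepY (a := a') (b := b') (A.mem_graph ⟨e, he⟩))
    simp only [inner_stepY_eq ha' hab' hb' hV, act1_stepY ha hab hb,
      ySize_stepY ha hab hb, ySize_stepY ha' hab' hb'] at h1
    refine h1.trans_eq ?_
    ring

end BlockKernel

end Entries

/-! ### Uniqueness -/

section Uniqueness

variable {H U : Type*} [NormedAddCommGroup H] [InnerProductSpace ℂ H] [CompleteSpace H]
    [NormedAddCommGroup U] [InnerProductSpace ℂ U] [CompleteSpace U]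
    {A : H →ₗ.[ℂ] H} {S : ℝ → H →L[ℂ] H} {K : ℝ → ℝ} {B : U →L[ℂ] H} {Q : H →L[ℂ] H}
    {V₁ V₂ : (t : ℝ) → YSpace H t →L[ℂ] YSpace H t} {k₁ k₂ : ℝ → BlockKernel H}

theorem BlockKernel.BoundedBy.mono {k : BlockKernel H} {t N N' : ℝ} (h : k.BoundedBy t N)
    (hN : N ≤ N') : k.BoundedBy t N' where
  bound00 := h.bound00.trans hN
  bound01 s hs := (h.bound01 s hs).trans hN
  bound10 s hs := (h.bound10 s hs).trans hN
  bound11 s hs q hq := (h.bound11 s hs q hq).trans hN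

theorem exists_contraction_weight (a b : ℝ) :
    ∃ l : ℝ, 0 < l ∧ a / l + b * √(1 / (2 * l)) ≤ 1 / 2 := by
  have h1 : Tendsto (fun l : ℝ => a / l) atTop (𝓝 0) := tendsto_const_nhds.div_atTop tendsto_id
  have h2 : Tendsto (fun l : ℝ => 1 / (2 * l)) atTop (𝓝 0) :=
    tendsto_const_nhds.div_atTop (tendsto_id.const_mul_atTop two_pos)
  have h3 := h1.add ((Real.continuous_sqrt.continuousAt.tendsto.comp h2).const_mul b)
  rw [Real.sqrt_zero, mul_zero, add_zero] at h3
  obtain ⟨l, hl, hl0⟩ := ((h3.eventually (ge_mem_nhds (by norm_num : (0 : ℝ) < 1 / 2))).and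
    (eventually_gt_atTop 0)).exists
  exact ⟨l, hl0, hl⟩

/-- Two solutions coincide: the bound for the entries of their difference, with an exponential
weight, improves to half of itself. -/
theorem SolvesRiccatiWith.eq_of_solvesRiccatiWith {sys : MemorySystem H U}
    (h₁ : SolvesRiccatiWith sys.T A K B Q V₁ k₁) (h₂ : SolvesRiccatiWith sys.T A K B Q V₂ k₂)
    (hK : ∀ᵐ s, s ∈ Ioc 0 sys.T → K s = sys.K s) (hS : IsC0Semigroup S) (hA : IsGenerator S A)
    {t : ℝ} (ht : t ∈ Ioc 0 sys.T) : V₁ t = V₂ t := by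
  rcases ht.2.eq_or_lt with rfl | htT
  · rw [h₁.final, h₂.final]
  obtain ⟨C₁, hC₁⟩ := h₁.bounded
  obtain ⟨C₂, hC₂⟩ := h₂.bounded
  obtain ⟨C, hC⟩ : ∃ C, ∀ r ∈ Ioc 0 sys.T, (k₁ r).BoundedBy r C ∧ (k₂ r).BoundedBy r C :=
    ⟨max C₁ C₂, fun r hr => ⟨(hC₁ r hr).2.mono (le_max_left _ _),
      (hC₂ r hr).2.mono (le_max_right _ _)⟩⟩
  have hC0 : 0 ≤ C := (hC t ht).1.nonneg
  obtain ⟨M₀, hM₀, hM⟩ := hS.strCont_semigroupExt.exists_bound 0 sys.T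
  have hM1 : 1 ≤ max M₀ 1 := le_max_right _ _
  obtain ⟨l, hl, hl2⟩ := exists_contraction_weight
    (2 * (1 + ‖B‖ * (‖B‖ * C)) * (max M₀ 1 * max M₀ 1))
    (2 * max M₀ 1 * ‖(tensorOp sys.kernelClass : H →L[ℂ] L2R H)‖)
  have hiter : ∀ n : ℕ, ∀ r ∈ Ioo 0 sys.T,
      ((k₁ r).sub (k₂ r)).BoundedBy r (2 * C * (1 / 2) ^ n * Real.exp (l * (sys.T - r))) := by
    intro n
    induction n with
    | zero =>
      intro r hr
      refine ((hC r ⟨hr.1, hr.2.le⟩).1.sub (hC r ⟨hr.1, hr.2.le⟩).2).mono ?_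
      rw [pow_zero, mul_one, ← two_mul]
      exact le_mul_of_one_le_right (by positivity)
        (Real.one_le_exp (mul_nonneg hl.le (sub_nonneg.2 hr.2.le)))
    | succ n ih =>
      intro r hr
      have hr' : r ∈ Ioc 0 sys.T := ⟨hr.1, hr.2.le⟩
      refine (BlockKernel.Represents.sub hr.1.le (h₁.represents r hr')
        (h₂.represents r hr')).boundedBy hr.1 (by positivity) (hA.dense_domain hS)
        fun X X' hX hX' => ?_
      refine (h₁.norm_inner_sub_le h₂ hK hS hA hl hM1
        (fun s hs => (hM s hs).trans (le_max_left _ _)) hC ih hr hX hX').trans ?_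
      have := ySize_nonneg X
      have := ySize_nonneg X'
      calc _ ≤ 1 / 2 * (2 * C * (1 / 2) ^ n * Real.exp (l * (sys.T - r))) * ySize X * ySize X' := by
            gcongr
        _ = _ := by ring
  have hrep := BlockKernel.Represents.sub ht.1.le (h₁.represents t ht) (h₂.represents t ht)
  refine sub_eq_zero.1 (ContinuousLinearMap.ext fun Y => ?_)
  refine ext_inner_left ℂ fun Y' => ?_
  rw [_root_.zero_apply, inner_zero_right, ← norm_le_zero_iff]
  have hlim : Tendsto (fun n : ℕ => 2 * C * (1 / 2 : ℝ) ^ n * Real.exp (l * (sys.T - t)) *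
      ySize Y * ySize Y') atTop (𝓝 (2 * C * 0 * Real.exp (l * (sys.T - t)) *
      ySize Y * ySize Y')) :=
    ((((tendsto_pow_atTop_nhds_zero_of_lt_one (by norm_num) (by norm_num)).const_mul
      _).mul_const _).mul_const _).mul_const _
  rw [mul_zero, zero_mul, zero_mul, zero_mul] at hlim
  exact ge_of_tendsto' hlim fun n =>
    hrep.norm_inner_le (hiter n t ⟨ht.1, htT⟩) ht.1.le Y Y'

end Uniqueness

/-! ### The system of a Volterra equation -/

section Volterra

variable {H U : Type*} [NormedAddCommGroup H] [InnerProductSpace ℂ H] [CompleteSpace H]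
    [NormedAddCommGroup U] [InnerProductSpace ℂ U] [CompleteSpace U]
    {T : ℝ} {S : ℝ → H →L[ℂ] H} {K K₀ : ℝ → ℝ}

/-- The system with memory of the Volterra equation with semigroup `S` and kernel `K`, which is
replaced by its representative `K₀`. -/
def volterraSystem (hT : 0 ≤ T) (hS : IsC0Semigroup S) (hK : IsKernelRep T K K₀)
    (B : U →L[ℂ] H) {Q : H →L[ℂ] H} (hQ : Q.IsPositive) : MemorySystem H U where
  T := T
  T_nonneg := hT
  Φ := fundSol T S K₀
  strCont := strCont_fundSol hT hS hK
  K := K₀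
  measurable_K := hK.measurable
  memLp_K := hK.memLp
  B := B
  Q := Q
  Q_pos := hQ

theorem isModel_volterraSystem (hT : 0 ≤ T) (hS : IsC0Semigroup S) (hK : IsKernelRep T K K₀)
    (B : U →L[ℂ] H) {Q : H →L[ℂ] H} (hQ : Q.IsPositive) :
    MemorySystem.IsModel (volterraSystem hT hS hK B hQ) S K where
  FOp_eq _ _ hτ hτt ht := FOp_eq_fundSol hS hK hτ hτt ht
  MOp_eq _ _ _ hσ hστ hτt ht x := MOp_apply hS hK hσ hστ hτt ht x

theorem isRegular_volterraSystem (hT : 0 ≤ T) (hS : IsC0Semigroup S) (hK : IsKernelRep T K K₀)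
    (B : U →L[ℂ] H) {Q : H →L[ℂ] H} (hQ : Q.IsPositive) {A : H →ₗ.[ℂ] H} (hA : IsGenerator S A)
    {x a : H} (h : (x, a) ∈ A.graph) : (volterraSystem hT hS hK B hQ).IsRegular x a :=
  ⟨fun t => resolventExt T S K₀ t x, strCont_resolventExt hT hS hK x,
    fun _ ht => resolventExt_eq_kernelConv hS hK ht x,
    fun _ ht => fundSol_eq_integral hA hT hS hK h ht.1⟩

end Volterra

end

theorem theorem1p2 {H U : Type*}
    [NormedAddCommGroup H] [InnerProductSpace ℂ H] [CompleteSpace H]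
    [TopologicalSpace.SeparableSpace H]
    [NormedAddCommGroup U] [InnerProductSpace ℂ U] [CompleteSpace U]
    [TopologicalSpace.SeparableSpace U]
    (T : ℝ) (hT : 0 < T)
    (S : ℝ → H →L[ℂ] H) (hS : IsC0Semigroup S)
    (A : H →ₗ.[ℂ] H) (hA : IsGenerator S A)
    (K : ℝ → ℝ) (hK : MemLp K 2 (volume.restrict (Ioc 0 T)))
    (B : U →L[ℂ] H)
    (Q : H →L[ℂ] H) (hQ : Q.IsPositive) :
    SolvesRiccatiWith T A K B Q (costOp T S K B Q) (costKernel T S K B Q) ∧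
    ∀ V : (t : ℝ) → YSpace H t →L[ℂ] YSpace H t,
      SolvesRiccati T A K B Q V → ∀ t ∈ Ioc 0 T, V t = costOp T S K B Q t := by
  obtain ⟨K₀, hK₀⟩ := exists_isKernelRep hK
  let sys := volterraSystem hT.le hS hK₀ B hQ
  have hKK : ∀ᵐ s, s ∈ Ioc 0 sys.T → K s = sys.K s := by
    filter_upwards [(ae_restrict_iff' measurableSet_Ioc).1 hK₀.ae_eq] with s hs hs'
    exact (hs hs').symm
  have hP : SolvesRiccatiWith T A K B Q (costOp T S K B Q) (costKernel T S K B Q) :=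
    (isModel_volterraSystem hT.le hS hK₀ B hQ).solvesRiccatiWith hKK
      (fun x => by
        change fundSol T S K₀ 0 x = x
        rw [fundSol_zero hT.le hS hK₀]
        rfl)
      fun x a h => isRegular_volterraSystem hT.le hS hK₀ B hQ hA h
  refine ⟨hP, fun V hV t ht => ?_⟩
  obtain ⟨k, hk⟩ := hV
  exact SolvesRiccatiWith.eq_of_solvesRiccatiWith (sys := sys) hk hP hKK hS hA ht
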